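/- **Theorem (Carleman estimate with amplified Neumann condition).** Let $n\ge 1$, $s\in[\tfrac12,1)$, $a=1-2s$, $K\in\mathbb R$. Write $X=(x,x_{n+1})\in\mathbb R^n\times\mathbb R$, $\mathbb R^{n+1}_+=\{x_{n+1}>0\}$, $\mathbb B_4^+=\{|X|<4,\ x_{n+1}>0\}$, $\nabla=\nabla_X$, $\operatorname{div}=\operatorname{div}_X$, and $$\widetilde{\mathcal H}_s w=x_{n+1}^a\,\partial_t w+\operatorname{div}\big(x_{n+1}^a\nabla w\big),\qquad G(X,t)=t^{-\frac{n+1+a}{2}}e^{-\frac{|X|^2}{4t}},\qquad \theta_s(t)=t^s\Big(\log\frac1t\Big)^{1+s}.$$ For $\lambda>0$ let $\sigma_s$ be the solution (positive, with positive derivative, for $0<\lambda t<1$) of $$\frac{d}{dt}\log\Big(\frac{\sigma_s}{t\sigma_s'}\Big)=\frac{\theta_s(\lambda t)}{t}\quad(0<\lambda t<1),\qquad \sigma_s(0)=0,\ \sigma_s'(0)=1 .$$ There are $\delta_0\in(0,1)$ and $M>1$, depending only on $n,s,K$, such that the following holds. Let $V$ be of class $C^2$ on $\mathbb R^n\times(0,T)$,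 with $V$ and its first and second derivatives bounded by $K$ in (operator) norm. Let $x_0\in\mathbb R^n$, $\tilde t\ge 0$ with $\tilde t+1\le T$, $R\ge1$, and $V_R(x,t)=V(Rx+x_0,\,R^2t+\tilde t)$. Let $$0<\delta\le\delta_0,\qquad \alpha\ge MR^2,\qquad \lambda=\frac{\alpha}{\delta^2},\qquad 0<c\le\frac1{5\lambda}.$$ Let $w$ be a function on $\overline{\mathbb R^{n+1}_+}\times(0,\infty)$ whose support lies in $\overline{\mathbb B_4^+}\times[0,\tau']$ for some $\tau'<\frac1{e\lambda}$, which is $C^\infty$ in $\{x_{n+1}>0,\,t>0\}$ and for which $w$, $\nabla_xw$, $\partial_tw$, $x_{n+1}^a\partial_{x_{n+1}}w$ and $x_{n+1}^{-a}\widetilde{\mathcal H}_sw$ extend continuously to $\{x_{n+1}\ge0,\,t>0\}$. Suppose that $$\lim_{x_{n+1}\to0^+}x_{n+1}^a\,\partial_{x_{n+1}}w(x,x_{n+1},t)=R^{2s}\,V_R(x,t)\,w(x,0,t)\qquad\text{for } x\in\mathbb R^n,\ 0<t<\tfrac1{e\lambda}.$$ Then all the integrals below converge, and $$\begin{aligned}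 &\alpha^2\int_{\mathbb R^{n+1}_+\times[c,\infty)}x_{n+1}^a\,\sigma_s^{-2\alpha}(t)\,w^2\,G+\alpha\int_{\mathbb R^{n+1}_+\times[c,\infty)}x_{n+1}^a\,\sigma_s^{1-2\alpha}(t)\,|\nabla w|^2\,G\\ &\le M\int_{\mathbb R^{n+1}_+\times[c,\infty)}\sigma_s^{1-2\alpha}(t)\,x_{n+1}^{-a}\,|\widetilde{\mathcal H}_sw|^2\,G\\ &\quad+\sigma_s^{-2\alpha}(c)\Big\{-\frac cM\int_{\mathbb R^{n+1}_+}x_{n+1}^a|\nabla w(X,c)|^2G(X,c)\,dX+M\alpha\int_{\mathbb R^{n+1}_+}x_{n+1}^a|w(X,c)|^2G(X,c)\,dX\Big\}. \end{aligned}$$ -/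

import Mathlib

open Real Set Filter Topology MeasureTheory
open scoped ContDiff Gradient

namespace Carleman

/-- Squared Euclidean length `|X|^2` of a point `X = (x, y)` of `ℝⁿ × ℝ`; the second entry `y`
is the extension variable, denoted by `x_{n+1}` in coordinates. -/
noncomputable def normSq {n : ℕ} (x : EuclideanSpace ℝ (Fin n)) (y : ℝ) : ℝ :=
  ‖x‖ ^ 2 + y ^ 2

/-- The half-space `{X = (x, y) : y > 0}`. -/
def halfSpace (n : ℕ) : Set (EuclideanSpace ℝ (Fin n) × ℝ) :=
  {q | 0 < q.2}

/-- Space-time points `(x, y, t)` with `y > 0` and `t ≥ c`. -/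
def halfSpaceTime (n : ℕ) (c : ℝ) : Set (EuclideanSpace ℝ (Fin n) × ℝ × ℝ) :=
  {p | 0 < p.2.1 ∧ c ≤ p.2.2}

/-- Space-time points `(x, y, t)` with `y > 0` and `t > 0`. -/
def openRegion (n : ℕ) : Set (EuclideanSpace ℝ (Fin n) × ℝ × ℝ) :=
  {p | 0 < p.2.1 ∧ 0 < p.2.2}

/-- Space-time points `(x, y, t)` with `y ≥ 0` and `t > 0`: the open region together with the
thin set `{y = 0}`. -/
def closedRegion (n : ℕ) : Set (EuclideanSpace ℝ (Fin n) × ℝ × ℝ) :=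
  {p | 0 ≤ p.2.1 ∧ 0 < p.2.2}

/-- `f`, given for `y > 0`, extends continuously up to the thin set `{y = 0}`. -/
def ExtendsToThinSet {n : ℕ} {F : Type*} [TopologicalSpace F]
    (f : EuclideanSpace ℝ (Fin n) → ℝ → ℝ → F) : Prop :=
  ∃ g : EuclideanSpace ℝ (Fin n) × ℝ × ℝ → F,
    ContinuousOn g (closedRegion n) ∧ ∀ p ∈ openRegion n, g p = f p.1 p.2.1 p.2.2

/-- The gradient in the variable `x` only. -/
noncomputable def gradX {n : ℕ} (w : EuclideanSpace ℝ (Fin n) → ℝ → ℝ → ℝ)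
    (x : EuclideanSpace ℝ (Fin n)) (y t : ℝ) : EuclideanSpace ℝ (Fin n) :=
  ∇ (fun z => w z y t) x

/-- The partial derivative in the extension variable. -/
noncomputable def derivY {n : ℕ} (w : EuclideanSpace ℝ (Fin n) → ℝ → ℝ → ℝ)
    (x : EuclideanSpace ℝ (Fin n)) (y t : ℝ) : ℝ :=
  deriv (fun η => w x η t) y

/-- The partial derivative in time. -/
noncomputable def derivT {n : ℕ} (w : EuclideanSpace ℝ (Fin n) → ℝ → ℝ → ℝ)
    (x : EuclideanSpace ℝ (Fin n)) (y t : ℝ) : ℝ :=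
  deriv (fun τ => w x y τ) t

/-- `|∇w|^2`, the full gradient in `X = (x, y)`. -/
noncomputable def gradSq {n : ℕ} (w : EuclideanSpace ℝ (Fin n) → ℝ → ℝ → ℝ)
    (x : EuclideanSpace ℝ (Fin n)) (y t : ℝ) : ℝ :=
  ‖gradX w x y t‖ ^ 2 + derivY w x y t ^ 2

/-- The backward extension operator `y^a ∂_t w + div_X (y^a ∇_X w)`, for `y > 0`. The weight `y^a`
does not depend on `x`, so the `x`-part of the divergence is `y^a Δ_x w`. -/
noncomputable def backwardOp {n : ℕ} (a : ℝ) (w : EuclideanSpace ℝ (Fin n) → ℝ → ℝ → ℝ)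
    (x : EuclideanSpace ℝ (Fin n)) (y t : ℝ) : ℝ :=
  y ^ a * derivT w x y t
    + (y ^ a * Laplacian.laplacian (fun z => w z y t) x
      + deriv (fun η => η ^ a * derivY w x η t) y)

/-- The Gaussian `G(X, t) = t^{-(n+1+a)/2} exp(-|X|^2 / (4t))`. -/
noncomputable def gaussian {n : ℕ} (a : ℝ) (x : EuclideanSpace ℝ (Fin n)) (y t : ℝ) : ℝ :=
  1 / t ^ (((n : ℝ) + 1 + a) / 2) * exp (-(normSq x y) / (4 * t))

/-- `θ_s(t) = t^s (log (1/t))^{1+s}`. -/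
noncomputable def theta (s t : ℝ) : ℝ :=
  t ^ s * log (1 / t) ^ (1 + s)

/-- `σ` solves `(d/dt) log (σ / (t σ')) = θ_s(λ t) / t` for `0 < λ t < 1`, with `σ(0) = 0` and
`σ'(0) = 1` (derivative from the right). Positivity of `σ` and `σ'` gives the logarithm its
meaning. -/
structure IsCarlemanWeight (s lam : ℝ) (σ : ℝ → ℝ) : Prop where
  zero : σ 0 = 0
  deriv_zero : HasDerivWithinAt σ 1 (Ici 0) 0
  pos : ∀ t ∈ Ioo 0 (1 / lam), 0 < σ t
  deriv_pos : ∀ t ∈ Ioo 0 (1 / lam), 0 < deriv σ t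
  ode : ∀ t ∈ Ioo 0 (1 / lam),
    HasDerivAt (fun τ => log (σ τ / (τ * deriv σ τ))) (theta s (lam * t) / t) t

theorem weight_aux {f : ℝ → ℝ} {b C p : ℝ} (hp : 0 < p) (hf : ContinuousOn f (Ioo 0 b))
    (hC : ∀ r ∈ Ioo 0 b, |f r| ≤ C * r ^ (p - 1)) (t : ℝ) (ht : t ∈ Ioo 0 b) :
    HasDerivAt (fun τ => ∫ r in (0 : ℝ)..τ, f r) (f t) t ∧
      |∫ r in (0 : ℝ)..t, f r| ≤ C / p * t ^ p := by
  have hint0 : IntervalIntegrable (fun r : ℝ => C * r ^ (p - 1)) volume 0 t :=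
    (intervalIntegral.intervalIntegrable_rpow' (by linarith)).const_mul C
  have hsub : Ioc 0 t ⊆ Ioo 0 b := fun r hr => ⟨hr.1, hr.2.trans_lt ht.2⟩
  have hbd : ∀ᵐ r ∂(volume.restrict (Ioc 0 t)), ‖f r‖ ≤ C * r ^ (p - 1) :=
    (ae_restrict_iff' measurableSet_Ioc).2 (Eventually.of_forall fun r hr => hC r (hsub hr))
  have hint : IntervalIntegrable f volume 0 t := by
    rw [intervalIntegrable_iff_integrableOn_Ioc_of_le ht.1.le] at hint0 ⊢
    exact Integrable.mono' hint0
      ((hf.mono hsub).aestronglyMeasurable measurableSet_Ioc) hbd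
  refine ⟨intervalIntegral.integral_hasDerivAt_right hint
    (hf.stronglyMeasurableAtFilter isOpen_Ioo t ht) (hf.continuousAt (isOpen_Ioo.mem_nhds ht)), ?_⟩
  have h1 := intervalIntegral.norm_integral_le_of_norm_le ht.1.le
    ((ae_restrict_iff' measurableSet_Ioc).1 hbd) hint0
  rw [intervalIntegral.integral_const_mul, integral_rpow (Or.inl (by linarith))] at h1
  have h2 : C * ((t ^ (p - 1 + 1) - 0 ^ (p - 1 + 1)) / (p - 1 + 1)) = C / p * t ^ p := by
    rw [sub_add_cancel, Real.zero_rpow hp.ne']; ring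
  rw [h2] at h1
  exact h1

/-- The initial value problem defining the weight is solvable. -/
theorem exists_isCarlemanWeight {s lam : ℝ} (hs : 0 < s) (hl : 0 < lam) :
    ∃ σ, IsCarlemanWeight s lam σ := by
  set p : ℝ := s / 2 with hp_def
  have hp : 0 < p := by positivity
  set ε : ℝ := p / (1 + s) with hε_def
  have hε : 0 < ε := by positivity
  set f : ℝ → ℝ := fun r => theta s (lam * r) / r with hf_def
  have hlr : ∀ r ∈ Ioo 0 (1 / lam), 0 < lam * r ∧ lam * r < 1 := fun r hr =>
    ⟨mul_pos hl hr.1, by have := hr.2; rw [lt_div_iff₀ hl] at this; linarith⟩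
  have hfc : ContinuousOn f (Ioo 0 (1 / lam)) := by
    intro r hr
    obtain ⟨h0, h1⟩ := hlr r hr
    have hr0 : r ≠ 0 := hr.1.ne'
    have hlog : 0 < log (1 / (lam * r)) := log_pos (by rw [lt_div_iff₀ h0]; linarith)
    refine ContinuousAt.continuousWithinAt ?_
    have c1 : ContinuousAt (fun r : ℝ => lam * r) r := by fun_prop
    have c2 : ContinuousAt (fun r : ℝ => log (1 / (lam * r))) r :=
      (continuousAt_const.div c1 h0.ne').log (one_div_pos.2 h0).ne'
    exact ((c1.rpow_const (Or.inl h0.ne')).mul (c2.rpow_const (Or.inl hlog.ne'))).div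
      continuousAt_id hr0
  have hf0 : ∀ r ∈ Ioo 0 (1 / lam), 0 ≤ f r := by
    intro r hr
    obtain ⟨h0, h1⟩ := hlr r hr
    have hlog : 0 < log (1 / (lam * r)) := log_pos (by rw [lt_div_iff₀ h0]; linarith)
    have := hr.1
    simp only [hf_def, theta]
    positivity
  obtain ⟨C, hC⟩ : ∃ C, ∀ r ∈ Ioo 0 (1 / lam), |f r| ≤ C * r ^ (p - 1) := by
    refine ⟨(1 / ε) ^ (1 + s) * lam ^ p, fun r hr => ?_⟩
    obtain ⟨h0, h1⟩ := hlr r hr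
    have hr0 : 0 < r := hr.1
    have hlog : 0 < log (1 / (lam * r)) := log_pos (by rw [lt_div_iff₀ h0]; linarith)
    have e1 : log (1 / (lam * r)) ≤ (1 / (lam * r)) ^ ε / ε :=
      log_le_rpow_div (by positivity) hε
    have e2 : log (1 / (lam * r)) ^ (1 + s) ≤ (1 / ε) ^ (1 + s) * (lam * r) ^ (-p) := by
      refine (rpow_le_rpow hlog.le e1 (by linarith)).trans (le_of_eq ?_)
      rw [div_eq_mul_one_div, mul_comm, mul_rpow (by positivity) (by positivity), ← rpow_mul
        (by positivity), one_div (lam * r), inv_rpow h0.le, rpow_neg h0.le]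
      congr 3
      rw [hε_def]; field_simp
    rw [abs_of_nonneg (hf0 r hr)]
    simp only [hf_def, theta]
    rw [div_le_iff₀ hr0]
    calc (lam * r) ^ s * log (1 / (lam * r)) ^ (1 + s)
        ≤ (lam * r) ^ s * ((1 / ε) ^ (1 + s) * (lam * r) ^ (-p)) := by gcongr
      _ = (1 / ε) ^ (1 + s) * ((lam * r) ^ s * (lam * r) ^ (-p)) := by ring
      _ = (1 / ε) ^ (1 + s) * (lam ^ p * r ^ p) := by
          rw [← rpow_add h0, ← mul_rpow hl.le hr0.le]; congr 2; rw [hp_def]; ring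
      _ = (1 / ε) ^ (1 + s) * lam ^ p * r ^ (p - 1) * r := by
          rw [rpow_sub_one hr0.ne']; field_simp
  set Θ : ℝ → ℝ := fun τ => ∫ r in (0 : ℝ)..τ, f r with hΘ_def
  have hΘd : ∀ t ∈ Ioo 0 (1 / lam), HasDerivAt Θ (f t) t := fun t ht =>
    (weight_aux hp hfc hC t ht).1
  have hΘ0 : ∀ t ∈ Ioo 0 (1 / lam), 0 ≤ Θ t := fun t ht =>
    intervalIntegral.integral_nonneg_of_ae_restrict ht.1.le (by
      rw [Filter.EventuallyLE, ae_restrict_iff' measurableSet_Icc]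
      have : ∀ᵐ r : ℝ, r ≠ 0 := by simp [ae_iff]
      filter_upwards [this] with r hr hr'
      exact hf0 r ⟨lt_of_le_of_ne hr'.1 hr.symm, hr'.2.trans_lt ht.2⟩)
  set g : ℝ → ℝ := fun r => (exp (-Θ r) - 1) / r with hg_def
  have hgc : ContinuousOn g (Ioo 0 (1 / lam)) := fun r hr =>
    ((((hΘd r hr).continuousAt.neg.rexp).sub continuousAt_const).div continuousAt_id
      hr.1.ne').continuousWithinAt
  have hgC : ∀ r ∈ Ioo 0 (1 / lam), |g r| ≤ C / p * r ^ (p - 1) := by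
    intro r hr
    have h1 := hΘ0 r hr
    have h2 : |Θ r| ≤ C / p * r ^ p := (weight_aux hp hfc hC r hr).2
    rw [abs_of_nonneg h1] at h2
    have hr0 := hr.1
    simp only [hg_def]
    rw [abs_div, abs_of_pos hr0, div_le_iff₀ hr0, mul_assoc, ← rpow_add_one hr0.ne',
      sub_add_cancel]
    refine le_trans ?_ h2
    rw [abs_le]
    have h3 := add_one_le_exp (-Θ r)
    have h4 : exp (-Θ r) ≤ 1 := exp_le_one_iff.2 (by linarith)
    constructor <;> linarith
  set I : ℝ → ℝ := fun τ => ∫ r in (0 : ℝ)..τ, g r with hI_def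
  have hId : ∀ t ∈ Ioo 0 (1 / lam), HasDerivAt I (g t) t := fun t ht =>
    (weight_aux hp hgc hgC t ht).1
  have hIb : ∀ t ∈ Ioo 0 (1 / lam), |I t| ≤ C / p / p * t ^ p := fun t ht =>
    (weight_aux hp hgc hgC t ht).2
  have hd : ∀ t ∈ Ioo 0 (1 / lam),
      HasDerivAt (fun t => t * exp (I t)) (exp (I t) * exp (-Θ t)) t := by
    intro t ht
    refine ((hasDerivAt_id t).mul (hId t ht).exp).congr_deriv ?_
    have := ht.1.ne'
    simp only [id, hg_def]
    field_simp
    ring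
  have hlam : 0 < 1 / lam := by positivity
  refine ⟨fun t => t * exp (I t), by simp, ?_, fun t ht => mul_pos ht.1 (exp_pos _),
    fun t ht => by rw [(hd t ht).deriv]; positivity, fun t ht => ?_⟩
  · rw [hasDerivWithinAt_iff_tendsto_slope]
    have hset : Ici (0 : ℝ) \ {0} = Ioi 0 := by ext; simp [lt_iff_le_and_ne, eq_comm]
    rw [hset]
    have hI0 : Tendsto I (𝓝[>] 0) (𝓝 0) := by
      have h1 : Tendsto (fun t : ℝ => C / p / p * t ^ p) (𝓝[>] 0) (𝓝 0) := by
        have : ContinuousAt (fun t : ℝ => C / p / p * t ^ p) 0 :=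
          continuousAt_const.mul (continuousAt_id.rpow_const (Or.inr hp.le))
        have h := this.tendsto
        rw [Real.zero_rpow hp.ne', mul_zero] at h
        exact h.mono_left nhdsWithin_le_nhds
      refine squeeze_zero_norm' ?_ h1
      filter_upwards [Ioo_mem_nhdsGT hlam] with t ht using hIb t ht
    have h2 := (continuous_exp.tendsto 0).comp hI0
    rw [exp_zero] at h2
    refine h2.congr' ?_
    filter_upwards [self_mem_nhdsWithin] with t ht
    have : t ≠ 0 := ne_of_gt ht
    simp [slope_def_field, this]
  · refine (hΘd t ht).congr_of_eventuallyEq ?_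
    filter_upwards [isOpen_Ioo.mem_nhds ht] with τ hτ
    have := hτ.1.ne'
    rw [(hd τ hτ).deriv]
    have h : τ * exp (I τ) / (τ * (exp (I τ) * exp (-Θ τ))) = exp (Θ τ) := by
      rw [exp_neg]; field_simp
    rw [h, log_exp]

/-- Functions on the closed half-space times `(0, ∞)` that are smooth for `y > 0`, regular up to
the thin set `{y = 0}` in the sense adapted to the weight `y^a` (the functions `w`, `∇_x w`,
`∂_t w`, `y^a ∂_y w` and `y^{-a}` times the extension operator of `w` are continuous up to
`y = 0`), and have compact support in `{|X| ≤ 4} × [0, τ)`. -/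
structure IsTestFunction {n : ℕ} (a τ : ℝ) (w : EuclideanSpace ℝ (Fin n) → ℝ → ℝ → ℝ) :
    Prop where
  smooth : ContDiffOn ℝ ∞ (fun p : EuclideanSpace ℝ (Fin n) × ℝ × ℝ => w p.1 p.2.1 p.2.2)
    (openRegion n)
  continuous : ContinuousOn
    (fun p : EuclideanSpace ℝ (Fin n) × ℝ × ℝ => w p.1 p.2.1 p.2.2) (closedRegion n)
  gradX_extends : ExtendsToThinSet (gradX w)
  derivT_extends : ExtendsToThinSet (derivT w)
  flux_extends : ExtendsToThinSet (fun x y t => y ^ a * derivY w x y t)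
  op_extends : ExtendsToThinSet (fun x y t => y ^ (-a) * backwardOp a w x y t)
  support : ∃ τ' < τ, ∀ p ∈ closedRegion n,
    w p.1 p.2.1 p.2.2 ≠ 0 → normSq p.1 p.2.1 ≤ 4 ^ 2 ∧ p.2.2 ≤ τ'

/-- The weighted normal derivative of `w` on the thin set at `(x, t)`, that is, the limit of
`y^a ∂_y w (x, y, t)` as `y → 0+`, exists and equals `b`. -/
def HasWeightedNormalDeriv {n : ℕ} (a : ℝ) (w : EuclideanSpace ℝ (Fin n) → ℝ → ℝ → ℝ)
    (x : EuclideanSpace ℝ (Fin n)) (t b : ℝ) : Prop :=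
  Tendsto (fun y => y ^ a * derivY w x y t) (𝓝[>] 0) (𝓝 b)

/-- `V` is of class `C^2` on `ℝⁿ × (0, T)`, and `V` and its first and second derivatives are
bounded there by `K` in norm. -/
def HasC2Bound {n : ℕ} (V : EuclideanSpace ℝ (Fin n) → ℝ → ℝ) (T K : ℝ) : Prop :=
  ContDiffOn ℝ 2 (fun p : EuclideanSpace ℝ (Fin n) × ℝ => V p.1 p.2) (univ ×ˢ Ioo 0 T) ∧
    ∀ k : ℕ, k ≤ 2 → ∀ p ∈ (univ : Set (EuclideanSpace ℝ (Fin n))) ×ˢ Ioo 0 T,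
      ‖iteratedFDeriv ℝ k (fun p : EuclideanSpace ℝ (Fin n) × ℝ => V p.1 p.2) p‖ ≤ K

/-- The rescaled potential `V_R(x, t) = V(R x + x₀, R² t + t₁)`. -/
def rescaledPotential {n : ℕ} (V : EuclideanSpace ℝ (Fin n) → ℝ → ℝ)
    (x₀ : EuclideanSpace ℝ (Fin n)) (t₁ R : ℝ) (x : EuclideanSpace ℝ (Fin n)) (t : ℝ) : ℝ :=
  V (R • x + x₀) (R ^ 2 * t + t₁)

end Carleman

/-! Write y for the extension variable, μ = y^a G, and split y^(-a) times the backward operator as A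
+ L, where A = ∂_t + X/(2t)·∇ (`advect`) and L = μ⁻¹ div(μ ∇) (`genL`). The measure μ dX is
transported by the field X/(2t), that is ∂_t μ + div(X μ)/(2t) = 0. Hence, in L²(μ dX dt) and up to
boundary terms, A is antisymmetric and L is symmetric.

Put κ = σ^(-2α), γ = σ/(tσ') and θ = tγ'/γ = θ_s(λt), so that tγκ' = -2ακ. Expand κtγ(Aw + Lw)²,
move the cross term 2κtγ Aw Lw into divergences, and complete the squares of Aw and Lw with
multiples of w. The α² terms in w² and the α terms in |∇w|² cancel. The gain that survives is
(1/2)κγθ|∇w|² + (1/4)ακ(θ/t)w², provided γθ ≤ 4α. This is `pointwise_carleman`, an algebraic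
identity modulo squares. For λt ≤ 1/e one has θ ≥ (λt)^s ≥ λt ≥ αt, which turns the gain into the
left side of the theorem. The normalisation σ(0) = 0, σ'(0) = 1 forces γ(0+) = 1, and
`weight_bounds` then makes σ comparable with t and γ bounded.

The inequality is integrated over {y > ε, t > c}, because second y-derivatives of w are not
controlled at y = 0. Then ε → 0. At t = c there remain a mass term and a negative energy term. On
the thin set only the part of the flux that is linear in y^a ∂_y w survives, and the Neumann
condition replaces y^a ∂_y w by Qw with Q = R^(2s) V_R. What is left has the form κtγ Q A(w²) plus a
multiple of Q w². Integrating A by parts along the thin set (`thinFlux_integral_slice`) cancels the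
contribution of size α, since it also comes from (κtγ)'. This leaves a term at t = c and a density
bounded by R^(2s)(1 + |x|/√t) κγ G w², with constants depending on s, K.

Such terms are absorbed by a Gaussian trace inequality (`trace_time`): ∫_{y=0} (1 + |x|/√t) G w² is
at most a dimensional constant times t^(s-1)(∫ w² μ + t ∫ |∇w|² μ). The growing weight in x is paid
for by a Gaussian Hardy inequality. The resulting coefficient (R²t)^s/t is a small fraction of θ/t
because θ ≥ (λt)^s and λ ≥ α ≥ MR² with M large. The hypothesis s ≥ 1/2 enters through a ≤ 0 in the
trace inequality and through M^s ≥ √M in the scaling. -/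

namespace Carleman

/-! ### Compact support and integrability up to the thin set -/

/-- Points of space-time with `|X| ≤ 4` and `t ≤ τ`. -/
def supportSet (n : ℕ) (τ : ℝ) : Set (EuclideanSpace ℝ (Fin n) × ℝ × ℝ) :=
  {p | normSq p.1 p.2.1 ≤ 4 ^ 2 ∧ p.2.2 ≤ τ}

/-- Lebesgue measure on `{y > ε, t > c}`. -/
noncomputable def slab (n : ℕ) (ε c : ℝ) : Measure (EuclideanSpace ℝ (Fin n) × ℝ × ℝ) :=
  (volume : Measure (EuclideanSpace ℝ (Fin n))).prod
    ((volume.restrict (Ioi ε)).prod (volume.restrict (Ioi c)))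

/-- Lebesgue measure on `{(x, r) : r > c}`. -/
noncomputable def halfSlab (n : ℕ) (c : ℝ) : Measure (EuclideanSpace ℝ (Fin n) × ℝ) :=
  (volume : Measure (EuclideanSpace ℝ (Fin n))).prod (volume.restrict (Ioi c))

variable {n : ℕ}

theorem slab_eq (ε c : ℝ) : slab n ε c = volume.restrict (univ ×ˢ Ioi ε ×ˢ Ioi c) := by
  rw [slab, Measure.prod_restrict, ← Measure.restrict_univ (μ := (volume : Measure (EuclideanSpace ℝ (Fin n)))), Measure.prod_restrict]
  rfl

theorem halfSlab_eq (c : ℝ) : halfSlab n c = volume.restrict (univ ×ˢ Ioi c) := by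
  rw [halfSlab, ← Measure.restrict_univ (μ := (volume : Measure (EuclideanSpace ℝ (Fin n)))), Measure.prod_restrict]
  rfl

instance (c : ℝ) : SFinite (halfSlab n c) := by unfold halfSlab; infer_instance

theorem restrict_halfSpaceTime (c : ℝ) :
    volume.restrict (halfSpaceTime n c) = slab n 0 c := by
  rw [slab_eq]
  refine Measure.restrict_congr_set ?_
  have h : halfSpaceTime n c = univ ×ˢ Ioi 0 ×ˢ Ici c := by
    ext p; simp [halfSpaceTime]
  rw [h]
  exact Measure.set_prod_ae_eq (ae_eq_refl _)
    (Measure.set_prod_ae_eq (ae_eq_refl _) Ioi_ae_eq_Ici.symm)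

theorem restrict_halfSpace : volume.restrict (halfSpace n) = halfSlab n 0 := by
  rw [halfSlab_eq]
  congr 1
  ext p; simp [halfSpace]

theorem ae_slab (ε c : ℝ) : ∀ᵐ p ∂slab n ε c, ε < p.2.1 ∧ c < p.2.2 := by
  rw [slab_eq, ae_restrict_iff' (by measurability)]
  exact Eventually.of_forall fun p hp => ⟨hp.2.1, hp.2.2⟩

theorem ae_halfSlab (c : ℝ) : ∀ᵐ p ∂halfSlab n c, c < p.2 := by
  rw [halfSlab_eq, ae_restrict_iff' (by measurability)]
  exact Eventually.of_forall fun p hp => hp.2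

/-- The part of the support with `y ≥ ε` and `t ≥ c` is compact. -/
theorem isCompact_support (τ ε c : ℝ) : IsCompact
    {p : EuclideanSpace ℝ (Fin n) × ℝ × ℝ | p ∈ supportSet n τ ∧ ε ≤ p.2.1 ∧ c ≤ p.2.2} := by
  refine ((isCompact_closedBall (0 : EuclideanSpace ℝ (Fin n)) 4).prod
    ((isCompact_Icc (a := -4) (b := (4 : ℝ))).prod (isCompact_Icc (a := c) (b := τ)))).of_isClosed_subset
    ?_ ?_
  · have h1 : IsClosed {p : EuclideanSpace ℝ (Fin n) × ℝ × ℝ | normSq p.1 p.2.1 ≤ 4 ^ 2} := by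
      unfold normSq
      exact isClosed_le (by fun_prop) (by fun_prop)
    have h2 : IsClosed {p : EuclideanSpace ℝ (Fin n) × ℝ × ℝ | p.2.2 ≤ τ} :=
      isClosed_le (by fun_prop) (by fun_prop)
    have h3 : IsClosed {p : EuclideanSpace ℝ (Fin n) × ℝ × ℝ | ε ≤ p.2.1} :=
      isClosed_le (by fun_prop) (by fun_prop)
    have h4 : IsClosed {p : EuclideanSpace ℝ (Fin n) × ℝ × ℝ | c ≤ p.2.2} :=
      isClosed_le (by fun_prop) (by fun_prop)
    exact (h1.inter h2).inter (h3.inter h4)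
  · rintro ⟨x, y, t⟩ ⟨⟨h1, h2⟩, h3, h4⟩
    simp only [normSq] at h1 h2 h3 h4
    refine ⟨?_, ?_, h4, h2⟩
    · rw [mem_closedBall_zero_iff]
      exact abs_le_of_sq_le_sq' (by nlinarith) (by norm_num) |>.2
    · exact abs_le_of_sq_le_sq' (by nlinarith [sq_nonneg ‖x‖]) (by norm_num)

theorem norm_le_of_mem {τ : ℝ} {p : EuclideanSpace ℝ (Fin n) × ℝ × ℝ} (h : p ∈ supportSet n τ) :
    ‖p.1‖ ≤ 4 ∧ |p.2.1| ≤ 4 ∧ p.2.2 ≤ τ := by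
  obtain ⟨h1, h2⟩ := h
  simp only [normSq] at h1
  exact ⟨abs_le_of_sq_le_sq' (by nlinarith) (by norm_num) |>.2,
    abs_le_of_sq_le_sq (by nlinarith [sq_nonneg ‖p.1‖]) (by norm_num), h2⟩

/-- `f` is continuous up to the thin set for `0 < t < T` and supported in `supportSet n τ`. -/
structure IsNice (τ T : ℝ) (f : EuclideanSpace ℝ (Fin n) × ℝ × ℝ → ℝ) : Prop where
  cont : ContinuousOn f {p | 0 ≤ p.2.1 ∧ 0 < p.2.2 ∧ p.2.2 < T}
  zero : ∀ p, 0 ≤ p.2.1 → 0 < p.2.2 → p ∉ supportSet n τ → f p = 0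
  lt : τ < T

/-- Past τ < T the function vanishes identically, so coefficients that are only controlled on (0, T)
do no harm for t ≥ T. -/
theorem IsNice.continuousOn {τ T : ℝ} {f : EuclideanSpace ℝ (Fin n) × ℝ × ℝ → ℝ} (hf : IsNice τ T f) :
    ContinuousOn f (closedRegion n) := by
  intro p hp
  by_cases h : p.2.2 < T
  · refine (hf.cont p ⟨hp.1, hp.2, h⟩).mono_of_mem_nhdsWithin ?_
    have h1 : {q : EuclideanSpace ℝ (Fin n) × ℝ × ℝ | q.2.2 < T} ∈ 𝓝 p :=
      (isOpen_lt (by fun_prop) (by fun_prop)).mem_nhds h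
    filter_upwards [self_mem_nhdsWithin, nhdsWithin_le_nhds h1] with q hq hq'
    exact ⟨hq.1, hq.2, hq'⟩
  · have h1 : {q : EuclideanSpace ℝ (Fin n) × ℝ × ℝ | τ < q.2.2} ∈ 𝓝 p :=
      (isOpen_lt (by fun_prop) (by fun_prop)).mem_nhds (hf.lt.trans_le (not_lt.1 h))
    have h2 : f =ᶠ[𝓝[closedRegion n] p] fun _ => 0 := by
      filter_upwards [self_mem_nhdsWithin, nhdsWithin_le_nhds h1] with q hq hq'
      exact hf.zero q hq.1 hq.2 fun h => not_lt.2 h.2 hq'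
    exact continuousWithinAt_const.congr_of_eventuallyEq h2 (h2.self_of_nhdsWithin hp)

theorem IsNice.exists_bound {τ T : ℝ} {f : EuclideanSpace ℝ (Fin n) × ℝ × ℝ → ℝ} (hf : IsNice τ T f)
    {c : ℝ} (hc : 0 < c) : ∃ C, 0 ≤ C ∧ ∀ p, 0 ≤ p.2.1 → c ≤ p.2.2 → |f p| ≤ C := by
  obtain ⟨C, hC⟩ := (isCompact_support (n := n) τ 0 c).exists_bound_of_continuousOn
    (hf.continuousOn.mono fun p hp => ⟨hp.2.1, hc.trans_le hp.2.2⟩)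
  refine ⟨max C 0, le_max_right _ _, fun p h1 h2 => ?_⟩
  by_cases h : p ∈ supportSet n τ
  · exact (hC p ⟨h, h1, h2⟩).trans (le_max_left _ _)
  · rw [hf.zero p h1 (hc.trans_le h2) h, abs_zero]; exact le_max_right _ _

theorem integrable_ball_indicator :
    Integrable (indicator (Metric.closedBall (0 : EuclideanSpace ℝ (Fin n)) 4) (fun _ => (1 : ℝ))) :=
  (integrable_indicator_iff measurableSet_closedBall).2
    (integrableOn_const (isCompact_closedBall _ _).measure_lt_top.ne)

theorem integrable_rpow_indicator {b : ℝ} (hb : -1 < b) :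
    Integrable (indicator (Ioc 0 4) (fun y : ℝ => y ^ b)) (volume.restrict (Ioi 0)) :=
  ((integrable_indicator_iff measurableSet_Ioc).2
    ((intervalIntegrable_iff_integrableOn_Ioc_of_le (by norm_num)).1
      (intervalIntegral.intervalIntegrable_rpow' hb))).restrict

theorem integrable_time_indicator (c τ : ℝ) :
    Integrable (indicator (Icc c τ) (fun _ : ℝ => (1 : ℝ))) (volume.restrict (Ioi c)) :=
  ((integrable_indicator_iff measurableSet_Icc).2
    (integrableOn_const isCompact_Icc.measure_lt_top.ne)).restrict

/-- Supplies a dominating function in product form, so that integrability against y^b reduces to the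
one-dimensional condition b > -1. -/
theorem rpow_mul_bound {τ T : ℝ} {f : EuclideanSpace ℝ (Fin n) × ℝ × ℝ → ℝ} (hf : IsNice τ T f)
    {c C b : ℝ} (hc : 0 < c) (hC : ∀ p, 0 ≤ p.2.1 → c ≤ p.2.2 → |f p| ≤ C)
    {p : EuclideanSpace ℝ (Fin n) × ℝ × ℝ} (hy : 0 < p.2.1) (ht : c ≤ p.2.2) :
    ‖p.2.1 ^ b * f p‖ ≤ C * (indicator (Metric.closedBall 0 4) (fun _ => (1 : ℝ)) p.1 *
      (indicator (Ioc 0 4) (fun y : ℝ => y ^ b) p.2.1 * indicator (Icc c τ) (fun _ => (1 : ℝ)) p.2.2)) := by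
  by_cases h : p ∈ supportSet n τ
  · obtain ⟨h1, h2, h3⟩ := norm_le_of_mem h
    rw [indicator_of_mem (mem_closedBall_zero_iff.2 h1), indicator_of_mem (show p.2.1 ∈ Ioc 0 4 from ⟨hy, (le_abs_self _).trans h2⟩),
      indicator_of_mem (show p.2.2 ∈ Icc c τ from ⟨ht, h3⟩), norm_mul, Real.norm_of_nonneg (by positivity), one_mul, mul_one, mul_comm]
    exact mul_le_mul_of_nonneg_right (hC p hy.le ht) (by positivity)
  · rw [hf.zero p hy.le (hc.trans_le ht) h, mul_zero, norm_zero]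
    have : 0 ≤ C := (abs_nonneg _).trans (hC p hy.le ht)
    refine mul_nonneg this (mul_nonneg ?_ (mul_nonneg ?_ ?_)) <;> refine indicator_nonneg ?_ _
    · exact fun _ _ => zero_le_one
    · exact fun y hy => rpow_nonneg hy.1.le _
    · exact fun _ _ => zero_le_one

theorem IsNice.integrable_rpow_mul {τ T : ℝ} {f : EuclideanSpace ℝ (Fin n) × ℝ × ℝ → ℝ}
    (hf : IsNice τ T f) {b c : ℝ} (hb : -1 < b) (hc : 0 < c) :
    Integrable (fun p => p.2.1 ^ b * f p) (slab n 0 c) := by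
  obtain ⟨C, -, hC⟩ := hf.exists_bound hc
  have hm : AEStronglyMeasurable (fun p => p.2.1 ^ b * f p) (slab n 0 c) := by
    rw [slab_eq]
    refine ContinuousOn.aestronglyMeasurable (ContinuousOn.mul ?_ ?_) (by measurability)
    · exact ContinuousOn.rpow_const (by fun_prop) fun p hp => Or.inl (ne_of_gt hp.2.1)
    · exact hf.continuousOn.mono fun p hp => ⟨le_of_lt hp.2.1, hc.trans hp.2.2⟩
  refine Integrable.mono' ((integrable_ball_indicator.mul_prod
    ((integrable_rpow_indicator hb).mul_prod (integrable_time_indicator c τ))).const_mul C) hm ?_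
  filter_upwards [ae_slab 0 c] with p hp
  exact rpow_mul_bound hf hc hC hp.1 hp.2.le

theorem IsNice.integrable_rpow_mul_slice {τ T : ℝ} {f : EuclideanSpace ℝ (Fin n) × ℝ × ℝ → ℝ}
    (hf : IsNice τ T f) {b t : ℝ} (hb : -1 < b) (ht : 0 < t) :
    Integrable (fun q : EuclideanSpace ℝ (Fin n) × ℝ => q.2 ^ b * f (q.1, q.2, t)) (halfSlab n 0) := by
  obtain ⟨C, hC0, hC⟩ := hf.exists_bound ht
  have hm : AEStronglyMeasurable (fun q : EuclideanSpace ℝ (Fin n) × ℝ => q.2 ^ b * f (q.1, q.2, t))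
      (halfSlab n 0) := by
    rw [halfSlab_eq]
    refine ContinuousOn.aestronglyMeasurable (ContinuousOn.mul ?_ ?_) (by measurability)
    · exact ContinuousOn.rpow_const (by fun_prop) fun p hp => Or.inl (ne_of_gt hp.2)
    · exact hf.continuousOn.comp (by fun_prop) fun p hp => ⟨le_of_lt hp.2, ht⟩
  refine Integrable.mono' ((integrable_ball_indicator.mul_prod
    (integrable_rpow_indicator hb)).const_mul C) hm ?_
  filter_upwards [ae_halfSlab 0] with q hq
  refine (rpow_mul_bound (p := (q.1, q.2, t)) hf ht hC hq le_rfl).trans ?_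
  refine mul_le_mul_of_nonneg_left (mul_le_mul_of_nonneg_left ?_ (indicator_nonneg (fun _ _ => zero_le_one) _)) hC0
  refine mul_le_of_le_one_right (indicator_nonneg (fun y hy => rpow_nonneg hy.1.le _) _) ?_
  exact indicator_le_self' (fun _ _ => zero_le_one) _

theorem IsNice.slice_bound {τ T : ℝ} {f : EuclideanSpace ℝ (Fin n) × ℝ × ℝ → ℝ}
    (hf : IsNice τ T f) {c C : ℝ} (hc : 0 < c) (hC : ∀ p, 0 ≤ p.2.1 → c ≤ p.2.2 → |f p| ≤ C)
    {p : EuclideanSpace ℝ (Fin n) × ℝ × ℝ} (hy : 0 ≤ p.2.1) (ht : c ≤ p.2.2) :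
    ‖f p‖ ≤ C * (indicator (Metric.closedBall 0 4) (fun _ => (1 : ℝ)) p.1 *
      indicator (Icc c τ) (fun _ => (1 : ℝ)) p.2.2) := by
  by_cases h : p ∈ supportSet n τ
  · obtain ⟨h1, h2, h3⟩ := norm_le_of_mem h
    rw [indicator_of_mem (mem_closedBall_zero_iff.2 h1), indicator_of_mem (show p.2.2 ∈ Icc c τ from ⟨ht, h3⟩), mul_one, mul_one]
    exact hC p hy ht
  · rw [hf.zero p hy (hc.trans_le ht) h, norm_zero]
    exact mul_nonneg ((abs_nonneg _).trans (hC p hy ht)) (mul_nonneg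
      (indicator_nonneg (fun _ _ => zero_le_one) _) (indicator_nonneg (fun _ _ => zero_le_one) _))

theorem IsNice.aestronglyMeasurable_slice {τ T : ℝ} {f : EuclideanSpace ℝ (Fin n) × ℝ × ℝ → ℝ}
    (hf : IsNice τ T f) {y c : ℝ} (hy : 0 ≤ y) (hc : 0 < c) :
    AEStronglyMeasurable (fun q : EuclideanSpace ℝ (Fin n) × ℝ => f (q.1, y, q.2)) (halfSlab n c) := by
  rw [halfSlab_eq]
  exact ContinuousOn.aestronglyMeasurable (hf.continuousOn.comp (by fun_prop)
    fun p hp => ⟨hy, hc.trans hp.2⟩) (by measurability)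

theorem IsNice.integrable_slice {τ T : ℝ} {f : EuclideanSpace ℝ (Fin n) × ℝ × ℝ → ℝ}
    (hf : IsNice τ T f) {y c : ℝ} (hy : 0 ≤ y) (hc : 0 < c) :
    Integrable (fun q : EuclideanSpace ℝ (Fin n) × ℝ => f (q.1, y, q.2)) (halfSlab n c) := by
  obtain ⟨C, hC0, hC⟩ := hf.exists_bound hc
  refine Integrable.mono' ((integrable_ball_indicator.mul_prod
    (integrable_time_indicator c τ)).const_mul C) (hf.aestronglyMeasurable_slice hy hc) ?_
  filter_upwards [ae_halfSlab c] with q hq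
  exact hf.slice_bound (p := (q.1, y, q.2)) hc hC hy hq.le

theorem IsNice.tendsto_slice {τ T : ℝ} {f : EuclideanSpace ℝ (Fin n) × ℝ × ℝ → ℝ}
    (hf : IsNice τ T f) {c : ℝ} (hc : 0 < c) :
    Tendsto (fun y => ∫ q, f (q.1, y, q.2) ∂halfSlab n c) (𝓝[>] 0)
      (𝓝 (∫ q, f (q.1, 0, q.2) ∂halfSlab n c)) := by
  obtain ⟨C, hC0, hC⟩ := hf.exists_bound hc
  refine tendsto_integral_filter_of_dominated_convergence _ ?_ ?_ ((integrable_ball_indicator.mul_prod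
    (integrable_time_indicator c τ)).const_mul C) ?_
  · filter_upwards [self_mem_nhdsWithin] with y hy using hf.aestronglyMeasurable_slice (le_of_lt hy) hc
  · filter_upwards [self_mem_nhdsWithin] with y hy
    filter_upwards [ae_halfSlab c] with q hq
    exact hf.slice_bound (p := (q.1, y, q.2)) hc hC (le_of_lt hy) hq.le
  · filter_upwards [ae_halfSlab c] with q hq
    have h := hf.continuousOn (q.1, 0, q.2) ⟨le_rfl, hc.trans hq⟩
    refine h.tendsto.comp (tendsto_nhdsWithin_iff.2 ⟨?_, ?_⟩)
    · exact ((by fun_prop : Continuous fun y : ℝ => (q.1, y, q.2)).tendsto 0).mono_left nhdsWithin_le_nhds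
    · filter_upwards [self_mem_nhdsWithin] with y hy using ⟨le_of_lt hy, hc.trans hq⟩

theorem IsNice.integrable_bottom {τ T : ℝ} {f : EuclideanSpace ℝ (Fin n) × ℝ × ℝ → ℝ}
    (hf : IsNice τ T f) {y t : ℝ} (hy : 0 ≤ y) (ht : 0 < t) :
    Integrable (fun x : EuclideanSpace ℝ (Fin n) => f (x, y, t)) := by
  have hc : Continuous (fun x : EuclideanSpace ℝ (Fin n) => f (x, y, t)) :=
    hf.continuousOn.comp_continuous (by fun_prop) fun x => ⟨hy, ht⟩
  refine hc.integrable_of_hasCompactSupport (HasCompactSupport.intro (isCompact_closedBall 0 4) ?_)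
  intro x hx
  exact hf.zero _ hy ht fun h => hx (mem_closedBall_zero_iff.2 (norm_le_of_mem h).1)

theorem IsNice.tendsto_bottom {τ T : ℝ} {f : EuclideanSpace ℝ (Fin n) × ℝ × ℝ → ℝ}
    (hf : IsNice τ T f) {t : ℝ} (ht : 0 < t) :
    Tendsto (fun y => ∫ x, f (x, y, t)) (𝓝[>] 0) (𝓝 (∫ x, f (x, 0, t))) := by
  obtain ⟨C, hC0, hC⟩ := hf.exists_bound ht
  refine tendsto_integral_filter_of_dominated_convergence _ ?_ ?_
    (integrable_ball_indicator.const_mul C) ?_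
  · filter_upwards [self_mem_nhdsWithin] with y hy
      using (hf.integrable_bottom (le_of_lt hy) ht).aestronglyMeasurable
  · filter_upwards [self_mem_nhdsWithin] with y hy
    refine Eventually.of_forall fun x => ?_
    refine (hf.slice_bound (p := (x, y, t)) ht hC (le_of_lt hy) le_rfl).trans ?_
    exact mul_le_mul_of_nonneg_left (mul_le_of_le_one_right
      (indicator_nonneg (fun _ _ => zero_le_one) _) (indicator_le_self' (fun _ _ => zero_le_one) _)) hC0
  · refine Eventually.of_forall fun x => ?_
    have h := hf.continuousOn (x, 0, t) ⟨le_rfl, ht⟩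
    refine h.tendsto.comp (tendsto_nhdsWithin_iff.2 ⟨?_, ?_⟩)
    · exact ((by fun_prop : Continuous fun y : ℝ => (x, y, t)).tendsto 0).mono_left nhdsWithin_le_nhds
    · filter_upwards [self_mem_nhdsWithin] with y hy using ⟨le_of_lt hy, ht⟩


/-! ### Functions controlled only for y > 0 -/

/-- `f` is continuous for `y > 0`, `0 < t < T` and supported in `supportSet n τ`. -/
structure IsInner (τ T : ℝ) (f : EuclideanSpace ℝ (Fin n) × ℝ × ℝ → ℝ) : Prop where
  cont : ContinuousOn f {p | 0 < p.2.1 ∧ 0 < p.2.2 ∧ p.2.2 < T}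
  zero : ∀ p, 0 < p.2.1 → 0 < p.2.2 → p ∉ supportSet n τ → f p = 0
  lt : τ < T

theorem IsNice.isInner {τ T : ℝ} {f : EuclideanSpace ℝ (Fin n) × ℝ × ℝ → ℝ} (hf : IsNice τ T f) :
    IsInner τ T f :=
  ⟨hf.cont.mono fun _ hp => ⟨hp.1.le, hp.2⟩, fun p hy => hf.zero p hy.le, hf.lt⟩

theorem isOpen_openRegion : IsOpen (openRegion n) := by
  have h1 : IsOpen {p : EuclideanSpace ℝ (Fin n) × ℝ × ℝ | 0 < p.2.1} :=
    isOpen_lt (by fun_prop) (by fun_prop)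
  have h2 : IsOpen {p : EuclideanSpace ℝ (Fin n) × ℝ × ℝ | 0 < p.2.2} :=
    isOpen_lt (by fun_prop) (by fun_prop)
  exact h1.inter h2

theorem IsInner.continuousOn {τ T : ℝ} {f : EuclideanSpace ℝ (Fin n) × ℝ × ℝ → ℝ} (hf : IsInner τ T f) :
    ContinuousOn f (openRegion n) := by
  intro p hp
  by_cases h : p.2.2 < T
  · refine (hf.cont p ⟨hp.1, hp.2, h⟩).mono_of_mem_nhdsWithin ?_
    have h1 : {q : EuclideanSpace ℝ (Fin n) × ℝ × ℝ | q.2.2 < T} ∈ 𝓝 p :=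
      (isOpen_lt (by fun_prop) (by fun_prop)).mem_nhds h
    filter_upwards [self_mem_nhdsWithin, nhdsWithin_le_nhds h1] with q hq hq'
    exact ⟨hq.1, hq.2, hq'⟩
  · have h1 : {q : EuclideanSpace ℝ (Fin n) × ℝ × ℝ | τ < q.2.2} ∈ 𝓝 p :=
      (isOpen_lt (by fun_prop) (by fun_prop)).mem_nhds (hf.lt.trans_le (not_lt.1 h))
    have h2 : f =ᶠ[𝓝[openRegion n] p] fun _ => 0 := by
      filter_upwards [self_mem_nhdsWithin, nhdsWithin_le_nhds h1] with q hq hq'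
      exact hf.zero q hq.1 hq.2 fun h => not_lt.2 h.2 hq'
    exact continuousWithinAt_const.congr_of_eventuallyEq h2 (h2.self_of_nhdsWithin hp)

theorem IsInner.integrable {τ T ε c : ℝ} {f : EuclideanSpace ℝ (Fin n) × ℝ × ℝ → ℝ}
    (hf : IsInner τ T f) (hε : 0 < ε) (hc : 0 < c) : Integrable f (slab n ε c) := by
  rw [slab_eq]
  have h1 : IntegrableOn f {p | p ∈ supportSet n τ ∧ ε ≤ p.2.1 ∧ c ≤ p.2.2} :=
    (hf.continuousOn.mono fun p hp => ⟨hε.trans_le hp.2.1, hc.trans_le hp.2.2⟩).integrableOn_compact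
      (isCompact_support τ ε c)
  refine h1.of_forall_sdiff_eq_zero (by measurability) fun p hp => ?_
  have h2 : ε < p.2.1 := hp.1.2.1
  have h3 : c < p.2.2 := hp.1.2.2
  exact hf.zero p (hε.trans h2) (hc.trans h3) fun h => hp.2 ⟨h, h2.le, h3.le⟩

/-- Raising y increases |X| when y ≥ 0, so the translate is still supported in the same set. This
transfers the slice statements for functions continuous up to y = 0 to slices at positive height. -/
theorem IsInner.isNice_shift {τ T ε : ℝ} {f : EuclideanSpace ℝ (Fin n) × ℝ × ℝ → ℝ}
    (hf : IsInner τ T f) (hε : 0 < ε) :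
    IsNice τ T fun p : EuclideanSpace ℝ (Fin n) × ℝ × ℝ => f (p.1, p.2.1 + ε, p.2.2) := by
  refine ⟨hf.cont.comp (by fun_prop) fun p hp => ⟨add_pos_of_nonneg_of_pos hp.1 hε, hp.2⟩,
    fun p hy ht hp => hf.zero _ (add_pos_of_nonneg_of_pos hy hε) ht fun h => hp ?_, hf.lt⟩
  simp only [supportSet, normSq, mem_ofPred_eq] at h hy ⊢
  exact ⟨by nlinarith [h.1], h.2⟩

theorem IsInner.integrable_halfSlab {τ T y c : ℝ} {f : EuclideanSpace ℝ (Fin n) × ℝ × ℝ → ℝ}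
    (hf : IsInner τ T f) (hy : 0 < y) (hc : 0 < c) :
    Integrable (fun q : EuclideanSpace ℝ (Fin n) × ℝ => f (q.1, y, q.2)) (halfSlab n c) := by
  simpa using (hf.isNice_shift hy).integrable_slice le_rfl hc

theorem IsInner.integrable_x {τ T y t : ℝ} {f : EuclideanSpace ℝ (Fin n) × ℝ × ℝ → ℝ}
    (hf : IsInner τ T f) (hy : 0 < y) (ht : 0 < t) :
    Integrable fun x : EuclideanSpace ℝ (Fin n) => f (x, y, t) := by
  simpa using (hf.isNice_shift hy).integrable_bottom le_rfl ht

theorem IsInner.integrable_yx {τ T ε t : ℝ} {f : EuclideanSpace ℝ (Fin n) × ℝ × ℝ → ℝ}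
    (hf : IsInner τ T f) (hε : 0 < ε) (ht : 0 < t) :
    Integrable (fun q : EuclideanSpace ℝ (Fin n) × ℝ => f (q.1, q.2, t)) (halfSlab n ε) := by
  rw [halfSlab_eq]
  have hK : IsCompact ((Metric.closedBall (0 : EuclideanSpace ℝ (Fin n)) 4) ×ˢ (Icc ε 4)) :=
    (isCompact_closedBall _ _).prod isCompact_Icc
  have h1 : IntegrableOn (fun q : EuclideanSpace ℝ (Fin n) × ℝ => f (q.1, q.2, t))
      ((Metric.closedBall (0 : EuclideanSpace ℝ (Fin n)) 4) ×ˢ (Icc ε 4)) :=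
    ContinuousOn.integrableOn_compact hK (hf.continuousOn.comp (by fun_prop)
      fun p hp => ⟨hε.trans_le hp.2.1, ht⟩)
  refine h1.of_forall_sdiff_eq_zero (by measurability) fun p hp => ?_
  have h2 : ε < p.2 := hp.1.2
  refine hf.zero _ (hε.trans h2) ht fun h => hp.2 ?_
  obtain ⟨h3, h4, -⟩ := norm_le_of_mem h
  exact ⟨mem_closedBall_zero_iff.2 h3, h2.le, (le_abs_self _).trans h4⟩

/-! ### Integration by parts in t, y and x -/

theorem integral_Ioi_deriv_eq_neg {f f' : ℝ → ℝ} {a b : ℝ} (hf : ∀ r, a ≤ r → HasDerivAt f (f' r) r)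
    (hf' : ContinuousOn f' (Ici a)) (h0 : ∀ r, b < r → f r = 0) (h0' : ∀ r, b < r → f' r = 0) :
    ∫ r in Ioi a, f' r = -f a := by
  have hint : IntegrableOn f' (Ioi a) := by
    have h1 : IntegrableOn f' (Icc a b) :=
      (hf'.mono fun r hr => hr.1).integrableOn_compact isCompact_Icc
    refine h1.of_forall_sdiff_eq_zero measurableSet_Ioi fun r hr => h0' r ?_
    by_contra h
    exact hr.2 ⟨le_of_lt hr.1, not_lt.1 h⟩
  have hlim : Tendsto f atTop (𝓝 0) :=
    tendsto_const_nhds.congr' (by filter_upwards [eventually_gt_atTop b] with r hr using (h0 r hr).symm)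
  rw [integral_Ioi_of_hasDerivAt_of_tendsto (hf a le_rfl).continuousAt.continuousWithinAt
    (fun r hr => hf r (le_of_lt hr)) hint hlim, zero_sub]

theorem hasDerivAt_of_eventually_zero {f f' : ℝ → ℝ} {r : ℝ} (h : f =ᶠ[𝓝 r] fun _ => 0) (h' : f' r = 0) :
    HasDerivAt f (f' r) r := by
  rw [h']
  exact (hasDerivAt_const r (0 : ℝ)).congr_of_eventuallyEq h

/-- The `t`-derivative of a function on the region, extended by zero past its support. -/
theorem IsInner.hasDerivAt_time {τ T : ℝ} {f f' : EuclideanSpace ℝ (Fin n) × ℝ × ℝ → ℝ}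
    (hf : IsInner τ T f) (hf' : IsInner τ T f')
    (hd : ∀ x y t, 0 < y → 0 < t → t < T → HasDerivAt (fun r => f (x, y, r)) (f' (x, y, t)) t)
    (x : EuclideanSpace ℝ (Fin n)) {y t : ℝ} (hy : 0 < y) (ht : 0 < t) :
    HasDerivAt (fun r => f (x, y, r)) (f' (x, y, t)) t := by
  by_cases h : t < T
  · exact hd x y t hy ht h
  · have h1 : τ < t := hf.lt.trans_le (not_lt.1 h)
    refine hasDerivAt_of_eventually_zero (f' := fun r => f' (x, y, r)) ?_
      (hf'.zero _ hy ht fun h => not_lt.2 h.2 h1)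
    filter_upwards [lt_mem_nhds h1, lt_mem_nhds ht] with r hr hr'
    exact hf.zero _ hy hr' fun h => not_lt.2 h.2 hr

theorem IsInner.integral_time_line {τ T : ℝ} {f f' : EuclideanSpace ℝ (Fin n) × ℝ × ℝ → ℝ}
    (hf : IsInner τ T f) (hf' : IsInner τ T f')
    (hd : ∀ x y t, 0 < y → 0 < t → t < T → HasDerivAt (fun r => f (x, y, r)) (f' (x, y, t)) t)
    (x : EuclideanSpace ℝ (Fin n)) {y c : ℝ} (hy : 0 < y) (hc : 0 < c) :
    ∫ t in Ioi c, f' (x, y, t) = -f (x, y, c) := by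
  refine integral_Ioi_deriv_eq_neg (f := fun t => f (x, y, t)) (b := max τ c)
    (fun r hr => hf.hasDerivAt_time hf' hd x hy (hc.trans_le hr)) ?_ ?_ ?_
  · exact hf'.continuousOn.comp (by fun_prop) fun r hr => ⟨hy, hc.trans_le hr⟩
  · exact fun r hr => hf.zero _ hy (hc.trans ((le_max_right _ _).trans_lt hr))
      fun h => not_lt.2 h.2 ((le_max_left _ _).trans_lt hr)
  · exact fun r hr => hf'.zero _ hy (hc.trans ((le_max_right _ _).trans_lt hr))
      fun h => not_lt.2 h.2 ((le_max_left _ _).trans_lt hr)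

theorem IsInner.integral_time {τ T : ℝ} {f f' : EuclideanSpace ℝ (Fin n) × ℝ × ℝ → ℝ}
    (hf : IsInner τ T f) (hf' : IsInner τ T f')
    (hd : ∀ x y t, 0 < y → 0 < t → t < T → HasDerivAt (fun r => f (x, y, r)) (f' (x, y, t)) t)
    {ε c : ℝ} (hε : 0 < ε) (hc : 0 < c) :
    ∫ p, f' p ∂slab n ε c = -∫ q, f (q.1, q.2, c) ∂halfSlab n ε := by
  have hi : Integrable f' (slab n ε c) := hf'.integrable hε hc
  have hi2 := hf.integrable_yx hε hc
  unfold slab at hi ⊢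
  unfold halfSlab at hi2 ⊢
  rw [integral_prod _ hi, integral_prod _ hi2, ← integral_neg]
  refine integral_congr_ae ?_
  filter_upwards [hi.prod_right_ae] with x hx
  rw [integral_prod _ hx, ← integral_neg]
  refine setIntegral_congr_fun measurableSet_Ioi fun y hy => ?_
  exact hf.integral_time_line hf' hd x (hε.trans hy) hc

theorem IsInner.integral_time_slice {τ T : ℝ} {f f' : EuclideanSpace ℝ (Fin n) × ℝ × ℝ → ℝ}
    (hf : IsInner τ T f) (hf' : IsInner τ T f')
    (hd : ∀ x y t, 0 < y → 0 < t → t < T → HasDerivAt (fun r => f (x, y, r)) (f' (x, y, t)) t)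
    {y c : ℝ} (hy : 0 < y) (hc : 0 < c) :
    ∫ q, f' (q.1, y, q.2) ∂halfSlab n c = -∫ x, f (x, y, c) := by
  have hi := hf'.integrable_halfSlab hy hc
  unfold halfSlab at hi ⊢
  rw [integral_prod _ hi, ← integral_neg]
  exact integral_congr_ae (Eventually.of_forall fun x => hf.integral_time_line hf' hd x hy hc)

theorem IsInner.integral_y {τ T : ℝ} {f f' : EuclideanSpace ℝ (Fin n) × ℝ × ℝ → ℝ}
    (hf : IsInner τ T f) (hf' : IsInner τ T f')
    (hd : ∀ x y t, 0 < y → 0 < t → t < T → HasDerivAt (fun r => f (x, r, t)) (f' (x, y, t)) y)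
    {ε c : ℝ} (hε : 0 < ε) (hc : 0 < c) :
    ∫ p, f' p ∂slab n ε c = -∫ q, f (q.1, ε, q.2) ∂halfSlab n c := by
  have hi : Integrable f' (slab n ε c) := hf'.integrable hε hc
  have hi2 := hf.integrable_halfSlab hε hc
  unfold slab at hi ⊢
  unfold halfSlab at hi2 ⊢
  rw [integral_prod _ hi, integral_prod _ hi2, ← integral_neg]
  refine integral_congr_ae ?_
  filter_upwards [hi.prod_right_ae] with x hx
  rw [integral_prod_symm _ hx, ← integral_neg]
  refine setIntegral_congr_fun measurableSet_Ioi fun t ht => ?_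
  have ht0 : 0 < t := hc.trans ht
  have hv : ∀ r : ℝ, max ε 4 < r → (x, r, t) ∉ supportSet n τ := fun r hr h => by
    have := (norm_le_of_mem h).2.1
    exact not_lt.2 ((le_abs_self _).trans this) ((le_max_right _ _).trans_lt hr)
  by_cases hT : t < T
  · refine integral_Ioi_deriv_eq_neg (f := fun y => f (x, y, t)) (b := max ε 4)
      (fun r hr => hd x r t (hε.trans_le hr) ht0 hT) ?_ ?_ ?_
    · exact hf'.continuousOn.comp (by fun_prop) fun r hr => ⟨hε.trans_le hr, ht0⟩
    · exact fun r hr => hf.zero _ (hε.trans ((le_max_left _ _).trans_lt hr)) ht0 (hv r hr)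
    · exact fun r hr => hf'.zero _ (hε.trans ((le_max_left _ _).trans_lt hr)) ht0 (hv r hr)
  · have h1 : τ < t := hf.lt.trans_le (not_lt.1 hT)
    have h2 : ∀ r : ℝ, (x, r, t) ∉ supportSet n τ := fun r h => not_lt.2 h.2 h1
    show _ = -f (x, ε, t)
    rw [hf.zero _ hε ht0 (h2 ε), neg_zero]
    exact setIntegral_eq_zero_of_forall_eq_zero fun r hr => hf'.zero _ (hε.trans hr) ht0 (h2 r)

theorem IsInner.integral_x_line {τ T : ℝ} {f f' : EuclideanSpace ℝ (Fin n) × ℝ × ℝ → ℝ}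
    {v : EuclideanSpace ℝ (Fin n)} (hf : IsInner τ T f) (hf' : IsInner τ T f')
    (hd : ∀ x y t, 0 < y → 0 < t → t < T → HasLineDerivAt ℝ (fun z => f (z, y, t)) (f' (x, y, t)) x v)
    {y t : ℝ} (hy : 0 < y) (ht : 0 < t) : ∫ x, f' (x, y, t) = 0 := by
  by_cases hT : t < T
  -- Integration by parts against the constant function 1, whose derivative is 0.
  · have h := integral_bilinear_hasLineDerivAt_right_eq_neg_left_of_integrable
      (μ := (volume : Measure (EuclideanSpace ℝ (Fin n)))) (f := fun _ => (1 : ℝ)) (f' := fun _ => (0 : ℝ))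
      (g := fun x => f (x, y, t)) (g' := fun x => f' (x, y, t)) (v := v)
      (B := ContinuousLinearMap.mul ℝ ℝ) (by simp) (by simpa using hf'.integrable_x hy ht)
      (by simpa using hf.integrable_x hy ht) (fun x _ => by
        simpa [HasLineDerivAt] using hasDerivAt_const (0 : ℝ) (1 : ℝ)) (fun x _ => hd x y t hy ht hT)
    simpa using h
  · refine integral_eq_zero_of_ae (Eventually.of_forall fun x => ?_)
    exact hf'.zero _ hy ht fun h => not_lt.2 h.2 (hf.lt.trans_le (not_lt.1 hT))

theorem IsInner.integral_x {τ T : ℝ} {f f' : EuclideanSpace ℝ (Fin n) × ℝ × ℝ → ℝ}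
    {v : EuclideanSpace ℝ (Fin n)} (hf : IsInner τ T f) (hf' : IsInner τ T f')
    (hd : ∀ x y t, 0 < y → 0 < t → t < T → HasLineDerivAt ℝ (fun z => f (z, y, t)) (f' (x, y, t)) x v)
    {ε c : ℝ} (hε : 0 < ε) (hc : 0 < c) : ∫ p, f' p ∂slab n ε c = 0 := by
  have hi : Integrable f' (slab n ε c) := hf'.integrable hε hc
  have h := ae_slab (n := n) ε c
  unfold slab at hi ⊢
  rw [integral_prod_symm _ hi, Measure.prod_restrict]
  refine setIntegral_eq_zero_of_forall_eq_zero fun q hq => ?_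
  exact hf.integral_x_line hf' hd (hε.trans hq.1) (hc.trans hq.2)

theorem IsInner.integral_x_slice {τ T : ℝ} {f f' : EuclideanSpace ℝ (Fin n) × ℝ × ℝ → ℝ}
    {v : EuclideanSpace ℝ (Fin n)} (hf : IsInner τ T f) (hf' : IsInner τ T f')
    (hd : ∀ x y t, 0 < y → 0 < t → t < T → HasLineDerivAt ℝ (fun z => f (z, y, t)) (f' (x, y, t)) x v)
    {y c : ℝ} (hy : 0 < y) (hc : 0 < c) : ∫ q, f' (q.1, y, q.2) ∂halfSlab n c = 0 := by
  have hi := hf'.integrable_halfSlab hy hc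
  unfold halfSlab at hi ⊢
  rw [integral_prod_symm _ hi]
  exact setIntegral_eq_zero_of_forall_eq_zero fun t ht => hf.integral_x_line hf' hd hy (hc.trans ht)

/-- Exhaustion of `{y > 0}` by `{y > ε}`. -/
theorem tendsto_integral_slab {c : ℝ} {f : EuclideanSpace ℝ (Fin n) × ℝ × ℝ → ℝ}
    (hf : Integrable f (slab n 0 c)) :
    Tendsto (fun k : ℕ => ∫ p, f p ∂slab n (1 / ((k : ℝ) + 1)) c) atTop (𝓝 (∫ p, f p ∂slab n 0 c)) := by
  have hU : (⋃ k : ℕ, (univ : Set (EuclideanSpace ℝ (Fin n))) ×ˢ Ioi (1 / ((k : ℝ) + 1)) ×ˢ Ioi c)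
      = univ ×ˢ Ioi 0 ×ˢ Ioi c := by
    ext p
    simp only [mem_iUnion, mem_prod, mem_univ, mem_Ioi, true_and, exists_and_right]
    refine and_congr_left fun _ => ⟨fun ⟨k, hk⟩ => (by positivity : (0 : ℝ) < 1 / (k + 1)).trans hk, exists_nat_one_div_lt⟩
  simp only [slab_eq] at hf ⊢
  rw [← hU] at hf ⊢
  refine tendsto_setIntegral_of_monotone (fun k => by measurability) ?_ hf
  intro k l hkl p hp
  have h1 : 1 / ((l : ℝ) + 1) ≤ 1 / ((k : ℝ) + 1) :=
    one_div_le_one_div_of_le (by positivity) (by exact_mod_cast Nat.succ_le_succ hkl)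
  exact ⟨hp.1, h1.trans_lt hp.2.1, hp.2.2⟩

theorem tendsto_integral_halfSlab {f : EuclideanSpace ℝ (Fin n) × ℝ → ℝ}
    (hf : Integrable f (halfSlab n 0)) :
    Tendsto (fun k : ℕ => ∫ p, f p ∂halfSlab n (1 / ((k : ℝ) + 1))) atTop (𝓝 (∫ p, f p ∂halfSlab n 0)) := by
  have hU : (⋃ k : ℕ, (univ : Set (EuclideanSpace ℝ (Fin n))) ×ˢ Ioi (1 / ((k : ℝ) + 1)))
      = univ ×ˢ Ioi 0 := by
    ext p
    simp only [mem_iUnion, mem_prod, mem_univ, mem_Ioi, true_and]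
    exact ⟨fun ⟨k, hk⟩ => (by positivity : (0 : ℝ) < 1 / (k + 1)).trans hk, exists_nat_one_div_lt⟩
  simp only [halfSlab_eq] at hf ⊢
  rw [← hU] at hf ⊢
  refine tendsto_setIntegral_of_monotone (fun k => by measurability) ?_ hf
  intro k l hkl p hp
  have h1 : 1 / ((l : ℝ) + 1) ≤ 1 / ((k : ℝ) + 1) :=
    one_div_le_one_div_of_le (by positivity) (by exact_mod_cast Nat.succ_le_succ hkl)
  exact ⟨hp.1, h1.trans_lt hp.2⟩

theorem tendsto_one_div_nat_nhdsGT : Tendsto (fun k : ℕ => 1 / ((k : ℝ) + 1)) atTop (𝓝[>] 0) :=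
  tendsto_nhdsWithin_iff.2 ⟨tendsto_one_div_add_atTop_nhds_zero_nat,
    Eventually.of_forall fun k => by simp only [mem_Ioi]; positivity⟩


/-! ### The function θ_s and the Carleman weight -/

/-- A power of the logarithm costs an arbitrarily small power of r: from log u ≤ u^ε/ε with ε =
(s/2)/(1+s), raising to the exponent 1+s loses exactly r^(-s/2). The remaining r^(s/2) makes
θ_s(r)/r integrable at 0. -/
theorem theta_le {s : ℝ} (hs : 0 < s) : ∃ C, 0 < C ∧ ∀ r ∈ Ioo (0 : ℝ) 1,
    0 ≤ theta s r ∧ theta s r ≤ C * r ^ (s / 2) := by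
  set ε : ℝ := s / 2 / (1 + s) with hε_def
  have hε : 0 < ε := by positivity
  refine ⟨(1 / ε) ^ (1 + s), by positivity, fun r hr => ?_⟩
  obtain ⟨h0, h1⟩ := hr
  have hlog : 0 < log (1 / r) := log_pos (by rw [lt_div_iff₀ h0]; linarith)
  refine ⟨by unfold theta; positivity, ?_⟩
  have e1 : log (1 / r) ≤ (1 / r) ^ ε / ε := log_le_rpow_div (by positivity) hε
  have e2 : log (1 / r) ^ (1 + s) ≤ (1 / ε) ^ (1 + s) * r ^ (-(s / 2)) := by
    refine (rpow_le_rpow hlog.le e1 (by linarith)).trans (le_of_eq ?_)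
    rw [div_eq_mul_one_div, mul_comm, mul_rpow (by positivity) (by positivity), ← rpow_mul
      (by positivity), one_div r, inv_rpow h0.le, rpow_neg h0.le]
    congr 3
    rw [hε_def]; field_simp
  calc theta s r ≤ r ^ s * ((1 / ε) ^ (1 + s) * r ^ (-(s / 2))) := by unfold theta; gcongr
    _ = (1 / ε) ^ (1 + s) * (r ^ s * r ^ (-(s / 2))) := by ring
    _ = (1 / ε) ^ (1 + s) * r ^ (s / 2) := by rw [← rpow_add h0]; congr 2; ring

/-- The logarithm is at least 1 up to r = 1/e. This is where the time horizon 1/(eλ) of the theorem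
comes from. -/
theorem rpow_le_theta {s r : ℝ} (hs : 0 < s) (h0 : 0 < r) (h1 : r ≤ 1 / exp 1) :
    r ^ s ≤ theta s r := by
  have h : 1 ≤ log (1 / r) := by
    rw [le_log_iff_exp_le (by positivity), le_div_iff₀ h0]
    rw [le_div_iff₀ (exp_pos 1)] at h1
    linarith
  exact le_mul_of_one_le_right (by positivity) (one_le_rpow h (by linarith))

theorem continuousOn_theta {s : ℝ} : ContinuousOn (theta s) (Ioo 0 1) := by
  intro r hr
  have hlog : 0 < log (1 / r) := log_pos (by rw [lt_div_iff₀ hr.1]; linarith [hr.2])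
  have c2 : ContinuousAt (fun r : ℝ => log (1 / r)) r :=
    (continuousAt_const.div continuousAt_id hr.1.ne').log (one_div_pos.2 hr.1).ne'
  exact ((continuousAt_id.rpow_const (Or.inl hr.1.ne')).mul
    (c2.rpow_const (Or.inl hlog.ne'))).continuousWithinAt

theorem le_of_monotoneOn_of_tendsto {f : ℝ → ℝ} {b L : ℝ} (hf : MonotoneOn f (Ioo 0 b))
    (hL : Tendsto f (𝓝[>] 0) (𝓝 L)) {t : ℝ} (ht : t ∈ Ioo 0 b) : L ≤ f t := by
  refine le_of_tendsto hL ?_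
  filter_upwards [Ioo_mem_nhdsGT ht.1] with r hr
  exact hf ⟨hr.1, hr.2.trans ht.2⟩ ht hr.2.le

theorem monotoneOn_Ioo_of_hasDerivAt {f f' : ℝ → ℝ} {b : ℝ}
    (hf : ∀ t ∈ Ioo 0 b, HasDerivAt f (f' t) t) (h : ∀ t ∈ Ioo 0 b, 0 ≤ f' t) :
    MonotoneOn f (Ioo 0 b) := by
  refine monotoneOn_of_deriv_nonneg (convex_Ioo 0 b)
    (fun t ht => (hf t ht).continuousAt.continuousWithinAt) ?_ ?_
  · rw [interior_Ioo]; exact fun t ht => (hf t ht).differentiableAt.differentiableWithinAt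
  · rw [interior_Ioo]; exact fun t ht => by rw [(hf t ht).deriv]; exact h t ht

/-- The Carleman weight is comparable with `t`, and so is `σ / σ' = t γ`. -/
theorem weight_bounds {s : ℝ} (hs : 0 < s) : ∃ N, 0 < N ∧ ∀ (lam : ℝ) (σ : ℝ → ℝ), 0 < lam →
    IsCarlemanWeight s lam σ → ∃ γ : ℝ → ℝ, ∀ t ∈ Ioo 0 (1 / lam),
      1 ≤ γ t ∧ γ t ≤ exp N ∧ t * exp (-N) ≤ σ t ∧ σ t ≤ t ∧
      HasDerivAt γ (γ t * theta s (lam * t) / t) t ∧ HasDerivAt σ (σ t / (t * γ t)) t := by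
  obtain ⟨C, hC, hθ⟩ := theta_le hs
  set p : ℝ := s / 2 with hp_def
  have hp : 0 < p := by positivity
  refine ⟨C / p + C / p / p, by positivity, fun lam σ hl hσ => ?_⟩
  have hlr : ∀ r ∈ Ioo 0 (1 / lam), lam * r ∈ Ioo (0 : ℝ) 1 := fun r hr =>
    ⟨mul_pos hl hr.1, by have := hr.2; rw [lt_div_iff₀ hl] at this; linarith⟩
  set b := 1 / lam with hb_def
  have hb : 0 < b := by positivity
  -- The function γ is exp g. The equation for σ prescribes only g', so the work is to show that the
  -- initial conditions force g(0+) = 0.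
  set g : ℝ → ℝ := fun τ => log (σ τ / (τ * deriv σ τ)) with hg
  have hgd : ∀ t ∈ Ioo 0 b, HasDerivAt g (theta s (lam * t) / t) t := hσ.ode
  have hgexp : ∀ t ∈ Ioo 0 b, exp (g t) = σ t / (t * deriv σ t) := fun t ht =>
    exp_log (div_pos (hσ.pos t ht) (mul_pos ht.1 (hσ.deriv_pos t ht)))
  have hσd : ∀ t ∈ Ioo 0 b, HasDerivAt σ (σ t / (t * exp (g t))) t := by
    intro t ht
    have h1 := hσ.deriv_pos t ht
    have h2 := hσ.pos t ht
    have h3 := ht.1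
    have h : HasDerivAt σ (deriv σ t) t :=
      (differentiableAt_of_deriv_ne_zero h1.ne').hasDerivAt
    refine h.congr_deriv ?_
    rw [hgexp t ht]; field_simp
  have hgm : MonotoneOn g (Ioo 0 b) := monotoneOn_Ioo_of_hasDerivAt hgd fun t ht =>
    div_nonneg (hθ _ (hlr t ht)).1 ht.1.le
  have hpow : ∀ t ∈ Ioo 0 b, HasDerivAt (fun t => (lam * t) ^ p) (p * (lam * t) ^ p / t) t := by
    intro t ht
    have h0 := (hlr t ht).1
    refine (((hasDerivAt_id t).const_mul lam).rpow_const (p := p) (Or.inl h0.ne')).congr_deriv ?_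
    have := ht.1.ne'
    simp only [id]
    rw [rpow_sub_one h0.ne']; field_simp
  have hgb : MonotoneOn (fun t => C / p * (lam * t) ^ p - g t) (Ioo 0 b) := by
    refine monotoneOn_Ioo_of_hasDerivAt (fun t ht => ((hpow t ht).const_mul (C / p)).sub (hgd t ht)) ?_
    intro t ht
    have h1 := (hθ _ (hlr t ht)).2
    have h2 : C / p * (p * (lam * t) ^ p / t) = C * (lam * t) ^ p / t := by field_simp
    rw [h2, ← sub_div]
    exact div_nonneg (by linarith) ht.1.le
  -- The one-sided derivative σ'(0) = 1 says ℓ(0+) = 0, while tℓ' = exp(-g) - 1. Thus g cannot stay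
  -- away from 0 near t = 0 without making ℓ diverge logarithmically.
  set ℓ : ℝ → ℝ := fun t => log (σ t / t) with hℓ
  have hℓd : ∀ t ∈ Ioo 0 b, HasDerivAt ℓ ((exp (-g t) - 1) / t) t := by
    intro t ht
    have h2 := (hσ.pos t ht).ne'
    have h3 := ht.1.ne'
    refine (((hσd t ht).div (hasDerivAt_id t) h3).log (div_ne_zero h2 h3)).congr_deriv ?_
    simp only [Pi.div_apply, id]
    rw [exp_neg]
    have := exp_pos (g t)
    field_simp
  have hℓ0 : Tendsto ℓ (𝓝[>] 0) (𝓝 0) := by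
    have h1 := hσ.deriv_zero
    rw [hasDerivWithinAt_iff_tendsto_slope] at h1
    have hset : Ici (0 : ℝ) \ {0} = Ioi 0 := by ext; simp [lt_iff_le_and_ne, eq_comm]
    rw [hset] at h1
    have h2 := (continuousAt_log one_ne_zero).tendsto.comp h1
    rw [log_one] at h2
    refine h2.congr fun t => ?_
    simp [hℓ, slope_def_field, hσ.zero]
  have hlogt : ∀ t ∈ Ioo 0 b, HasDerivAt log (1 / t) t := fun t ht => by
    simpa using hasDerivAt_log ht.1.ne'
  -- If g(t₀) < 0, monotonicity keeps exp(-g) - 1 ≥ κ > 0 on (0, t₀). Then ℓ - κ log t would be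
  -- nondecreasing and yet tend to +∞ at 0+.
  have hg0 : ∀ t ∈ Ioo 0 b, 0 ≤ g t := by
    intro t₀ ht₀
    by_contra! hneg
    set κ := exp (-g t₀) - 1
    have hκ : 0 < κ := by
      have : 1 < exp (-g t₀) := one_lt_exp_iff.2 (by linarith)
      simp only [κ]; linarith
    have hm : MonotoneOn (fun t => ℓ t - κ * log t) (Ioo 0 t₀) := by
      refine monotoneOn_Ioo_of_hasDerivAt (fun t ht => (hℓd t ⟨ht.1, ht.2.trans ht₀.2⟩).sub
        ((hlogt t ⟨ht.1, ht.2.trans ht₀.2⟩).const_mul κ)) fun t ht => ?_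
      have h1 := hgm ⟨ht.1, ht.2.trans ht₀.2⟩ ht₀ ht.2.le
      have h2 : exp (-g t₀) ≤ exp (-g t) := exp_le_exp.2 (by linarith)
      rw [mul_one_div, ← sub_div]
      exact div_nonneg (by simp only [κ]; linarith) ht.1.le
    have hlim : Tendsto (fun t => ℓ t - κ * log t) (𝓝[>] 0) atTop := by
      have := (tendsto_log_nhdsGT_zero.const_mul_atBot hκ)
      exact hℓ0.add_atTop (tendsto_neg_atBot_atTop.comp this)
    have ht2 : t₀ / 2 ∈ Ioo 0 t₀ := ⟨by linarith [ht₀.1], by linarith [ht₀.1]⟩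
    obtain ⟨r, hr, hr'⟩ := ((hlim.eventually_gt_atTop (ℓ (t₀ / 2) - κ * log (t₀ / 2))).and
      (Ioo_mem_nhdsGT ht2.1)).exists
    exact not_lt.2 (hm ⟨hr'.1, hr'.2.trans ht2.2⟩ ht2 hr'.2.le) hr
  -- The mirror argument: if g ≥ ε throughout, then tℓ' ≤ -κ < 0 and -(ℓ + κ log t) would be
  -- nondecreasing with limit +∞ at 0+.
  have hginf : ∀ ε > 0, ∃ t ∈ Ioo 0 b, g t < ε := by
    intro ε hε
    by_contra! hcon
    set κ := 1 - exp (-ε)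
    have hκ : 0 < κ := by
      have : exp (-ε) < 1 := by rw [← exp_zero]; exact exp_lt_exp.2 (by linarith)
      simp only [κ]; linarith
    have hm : MonotoneOn (fun t => -(ℓ t + κ * log t)) (Ioo 0 b) := by
      refine monotoneOn_Ioo_of_hasDerivAt (fun t ht => ((hℓd t ht).add
        ((hlogt t ht).const_mul κ)).neg) fun t ht => ?_
      have h2 : exp (-g t) ≤ exp (-ε) := exp_le_exp.2 (by linarith [hcon t ht])
      rw [mul_one_div, ← add_div, ← neg_div]
      exact div_nonneg (by simp only [κ]; linarith) ht.1.le
    have hlim : Tendsto (fun t => -(ℓ t + κ * log t)) (𝓝[>] 0) atTop := by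
      have := (tendsto_log_nhdsGT_zero.const_mul_atBot hκ)
      exact tendsto_neg_atBot_atTop.comp (hℓ0.add_atBot this)
    have ht2 : b / 2 ∈ Ioo 0 b := ⟨by linarith, by linarith⟩
    obtain ⟨r, hr, hr'⟩ := ((hlim.eventually_gt_atTop (-(ℓ (b / 2) + κ * log (b / 2)))).and
      (Ioo_mem_nhdsGT ht2.1)).exists
    exact not_lt.2 (hm ⟨hr'.1, hr'.2.trans ht2.2⟩ ht2 hr'.2.le) hr
  -- The difference (C/p)(λt)^p - g is nondecreasing, and g takes values arbitrarily close to 0, so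
  -- the difference cannot be negative anywhere.
  have hgub : ∀ t ∈ Ioo 0 b, g t ≤ C / p * (lam * t) ^ p := by
    intro t ht
    by_contra! hcon
    obtain ⟨r, hr, hr'⟩ := hginf (g t - C / p * (lam * t) ^ p) (by linarith)
    have hpos : ∀ t ∈ Ioo 0 b, 0 ≤ C / p * (lam * t) ^ p := fun t ht => by
      have := (hlr t ht).1
      positivity
    rcases le_total r t with h | h
    · have h1 := hgb hr ht h
      simp only [] at h1
      linarith [hpos r hr]
    · linarith [hgm ht hr h, hpos t ht]
  have hpow1 : ∀ t ∈ Ioo 0 b, (lam * t) ^ p ≤ 1 := fun t ht =>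
    rpow_le_one (hlr t ht).1.le (hlr t ht).2.le hp.le
  have hℓub : ∀ t ∈ Ioo 0 b, ℓ t ≤ 0 := by
    intro t ht
    have hm : MonotoneOn (fun t => -ℓ t) (Ioo 0 b) :=
      monotoneOn_Ioo_of_hasDerivAt (fun t ht => (hℓd t ht).neg) fun t ht => by
        have : exp (-g t) ≤ 1 := exp_le_one_iff.2 (by linarith [hg0 t ht])
        rw [← neg_div]
        exact div_nonneg (by linarith) ht.1.le
    have := le_of_monotoneOn_of_tendsto hm (by simpa using hℓ0.neg) ht
    linarith
  -- Since exp(-g) - 1 ≥ -g ≥ -(C/p)(λt)^p, adding the antiderivative of that bound divided by t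
  -- makes ℓ nondecreasing from the limit 0.
  have hℓlb : ∀ t ∈ Ioo 0 b, 0 ≤ ℓ t + C / p / p * (lam * t) ^ p := by
    intro t ht
    have hm : MonotoneOn (fun t => ℓ t + C / p / p * (lam * t) ^ p) (Ioo 0 b) :=
      monotoneOn_Ioo_of_hasDerivAt (fun t ht => (hℓd t ht).add ((hpow t ht).const_mul (C / p / p)))
        fun t ht => by
          have h1 := add_one_le_exp (-g t)
          have h2 := hgub t ht
          have h3 : C / p / p * (p * (lam * t) ^ p / t) = C / p * (lam * t) ^ p / t := by field_simp
          rw [h3, ← add_div]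
          exact div_nonneg (by linarith) ht.1.le
    refine le_of_monotoneOn_of_tendsto hm ?_ ht
    have h1 : Tendsto (fun t : ℝ => C / p / p * (lam * t) ^ p) (𝓝[>] 0) (𝓝 0) := by
      have : ContinuousAt (fun t : ℝ => C / p / p * (lam * t) ^ p) 0 :=
        continuousAt_const.mul (ContinuousAt.rpow_const (by fun_prop) (Or.inr hp.le))
      have h := this.tendsto
      rw [mul_zero, Real.zero_rpow hp.ne', mul_zero] at h
      exact h.mono_left nhdsWithin_le_nhds
    simpa using hℓ0.add h1
  refine ⟨fun t => exp (g t), fun t ht => ?_⟩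
  have hN1 : 0 < C / p := by positivity
  have hN2 : 0 < C / p / p := by positivity
  have ht0 := ht.1
  have hσt : σ t = t * exp (ℓ t) := by
    rw [hℓ, exp_log (div_pos (hσ.pos t ht) ht0)]; field_simp
  refine ⟨one_le_exp (hg0 t ht), exp_le_exp.2 ?_, ?_, ?_, ?_, hσd t ht⟩
  · nlinarith [hgub t ht, hpow1 t ht]
  · rw [hσt]
    refine mul_le_mul_of_nonneg_left (exp_le_exp.2 ?_) ht0.le
    nlinarith [hℓlb t ht, hpow1 t ht]
  · rw [hσt]
    exact mul_le_of_le_one_right ht0.le (exp_le_one_iff.2 (hℓub t ht))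
  · exact (hgd t ht).exp.congr_deriv (by ring)


/-! ### Directional derivatives and the Gaussian measure μ = y^a G -/

/-- The derivative of `f` at `p` in the direction `v`. -/
noncomputable def pd (f : EuclideanSpace ℝ (Fin n) × ℝ × ℝ → ℝ) (v p : EuclideanSpace ℝ (Fin n) × ℝ × ℝ) : ℝ :=
  fderiv ℝ f p v

/-- The spatial coordinate directions; `none` stands for the extension variable. -/
noncomputable def dir : Option (Fin n) → EuclideanSpace ℝ (Fin n) × ℝ × ℝ
  | some i => (EuclideanSpace.single i 1, 0, 0)
  | none => (0, 1, 0)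

/-- The time direction. -/
def tdir : EuclideanSpace ℝ (Fin n) × ℝ × ℝ := (0, 0, 1)

/-- The spatial coordinates. -/
def coord : Option (Fin n) → EuclideanSpace ℝ (Fin n) × ℝ × ℝ → ℝ
  | some i => fun p => p.1 i
  | none => fun p => p.2.1

/-- The logarithmic derivatives of the weight `y^a G`. -/
noncomputable def drift (a : ℝ) (j : Option (Fin n)) (p : EuclideanSpace ℝ (Fin n) × ℝ × ℝ) : ℝ :=
  -coord j p / (2 * p.2.2) + (match j with | some _ => 0 | none => a / p.2.1)

/-- The weight `y^a G`. -/
noncomputable def wgt (a : ℝ) (p : EuclideanSpace ℝ (Fin n) × ℝ × ℝ) : ℝ :=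
  p.2.1 ^ a * gaussian a p.1 p.2.1 p.2.2

theorem gaussian_pos {a y t : ℝ} {x : EuclideanSpace ℝ (Fin n)} (ht : 0 < t) : 0 < gaussian a x y t := by
  unfold gaussian; positivity

theorem wgt_pos {a : ℝ} {p : EuclideanSpace ℝ (Fin n) × ℝ × ℝ} (hp : p ∈ openRegion n) : 0 < wgt a p :=
  mul_pos (rpow_pos_of_pos hp.1 _) (gaussian_pos hp.2)

theorem pd_contDiffOn {f : EuclideanSpace ℝ (Fin n) × ℝ × ℝ → ℝ} (hf : ContDiffOn ℝ ∞ f (openRegion n))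
    (v : EuclideanSpace ℝ (Fin n) × ℝ × ℝ) : ContDiffOn ℝ ∞ (pd f v) (openRegion n) :=
  (hf.fderiv_of_isOpen (m := ∞) isOpen_openRegion (by simp)).clm_apply contDiffOn_const

theorem hasFDerivAt_of_smooth {f : EuclideanSpace ℝ (Fin n) × ℝ × ℝ → ℝ}
    (hf : ContDiffOn ℝ ∞ f (openRegion n)) {p : EuclideanSpace ℝ (Fin n) × ℝ × ℝ} (hp : p ∈ openRegion n) :
    HasFDerivAt f (fderiv ℝ f p) p :=
  ((hf.contDiffAt (isOpen_openRegion.mem_nhds hp)).differentiableAt (by simp)).hasFDerivAt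

theorem pd_hasLineDerivAt {f : EuclideanSpace ℝ (Fin n) × ℝ × ℝ → ℝ} (hf : ContDiffOn ℝ ∞ f (openRegion n))
    {p : EuclideanSpace ℝ (Fin n) × ℝ × ℝ} (hp : p ∈ openRegion n) (v : EuclideanSpace ℝ (Fin n) × ℝ × ℝ) :
    HasLineDerivAt ℝ f (pd f v p) p v :=
  (hasFDerivAt_of_smooth hf hp).hasLineDerivAt v

theorem pd_comm {f : EuclideanSpace ℝ (Fin n) × ℝ × ℝ → ℝ} (hf : ContDiffOn ℝ ∞ f (openRegion n))
    {p : EuclideanSpace ℝ (Fin n) × ℝ × ℝ} (hp : p ∈ openRegion n) (u v : EuclideanSpace ℝ (Fin n) × ℝ × ℝ) :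
    pd (pd f u) v p = pd (pd f v) u p := by
  have hd : DifferentiableAt ℝ (fderiv ℝ f) p :=
    (((hf.fderiv_of_isOpen (m := ∞) isOpen_openRegion (by simp)).contDiffAt
      (isOpen_openRegion.mem_nhds hp)).differentiableAt (by simp))
  have key : ∀ u v, pd (pd f u) v p = fderiv ℝ (fderiv ℝ f) p v u := by
    intro u v
    have h := (hd.hasFDerivAt.clm_apply (hasFDerivAt_const u p)).fderiv
    change fderiv ℝ (fun q => fderiv ℝ f q u) p v = _
    rw [h]; simp
  rw [key, key]
  exact ((hf.contDiffAt (isOpen_openRegion.mem_nhds hp)).isSymmSndFDerivAt (by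
    simpa using (show ((2 : ℕ∞) : WithTop ℕ∞) ≤ ∞ from WithTop.coe_le_coe.2 le_top))) v u

theorem HasLineDerivAt.hasDerivAt_t {f : EuclideanSpace ℝ (Fin n) × ℝ × ℝ → ℝ} {x : EuclideanSpace ℝ (Fin n)}
    {y t f' : ℝ} (h : HasLineDerivAt ℝ f f' (x, y, t) tdir) : HasDerivAt (fun r => f (x, y, r)) f' t := by
  have h0 : HasDerivAt (fun s : ℝ => f ((x, y, t) + s • (tdir : EuclideanSpace ℝ (Fin n) × ℝ × ℝ))) f' (t - t) := by
    rw [sub_self]; exact h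
  have h1 := h0.comp_sub_const t t
  simpa [tdir] using h1

theorem HasLineDerivAt.hasDerivAt_y {f : EuclideanSpace ℝ (Fin n) × ℝ × ℝ → ℝ} {x : EuclideanSpace ℝ (Fin n)}
    {y t f' : ℝ} (h : HasLineDerivAt ℝ f f' (x, y, t) (dir none)) : HasDerivAt (fun r => f (x, r, t)) f' y := by
  have h0 : HasDerivAt (fun s : ℝ => f ((x, y, t) + s • (dir none : EuclideanSpace ℝ (Fin n) × ℝ × ℝ))) f' (y - y) := by
    rw [sub_self]; exact h
  have h1 := h0.comp_sub_const y y
  simpa [dir] using h1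

theorem HasLineDerivAt.slice_x {f : EuclideanSpace ℝ (Fin n) × ℝ × ℝ → ℝ} {x : EuclideanSpace ℝ (Fin n)}
    {y t f' : ℝ} {i : Fin n} (h : HasLineDerivAt ℝ f f' (x, y, t) (dir (some i))) :
    HasLineDerivAt ℝ (fun z => f (z, y, t)) f' x (EuclideanSpace.single i (1 : ℝ)) := by
  simpa [HasLineDerivAt, dir] using h

theorem coord_hasLineDerivAt (j : Option (Fin n)) (p : EuclideanSpace ℝ (Fin n) × ℝ × ℝ) (i : Option (Fin n)) :
    HasLineDerivAt ℝ (coord i) (if i = j then 1 else 0) p (dir j) := by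
  unfold HasLineDerivAt
  rcases i with _ | i <;> rcases j with _ | j
  · simpa [coord, dir] using (hasDerivAt_id (0 : ℝ)).const_add p.2.1
  · simpa [coord, dir] using hasDerivAt_const (0 : ℝ) p.2.1
  · simpa [coord, dir] using hasDerivAt_const (0 : ℝ) (p.1 i)
  · by_cases h : i = j
    · subst h
      simpa [coord, dir] using (hasDerivAt_id (0 : ℝ)).const_add (p.1 i)
    · simpa [coord, dir, h] using hasDerivAt_const (0 : ℝ) (p.1 i)

/-- The left side is μ⁻¹ div(X μ). The explicit value is needed only to match it with the time
derivative of G. -/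
theorem sum_coord_drift {a : ℝ} {p : EuclideanSpace ℝ (Fin n) × ℝ × ℝ} (hp : p ∈ openRegion n) :
    ∑ j, (1 + coord j p * drift a j p) = (n + 1 + a) - normSq p.1 p.2.1 / (2 * p.2.2) := by
  have hy : p.2.1 ≠ 0 := ne_of_gt hp.1
  have ht : p.2.2 ≠ 0 := ne_of_gt hp.2
  rw [Fintype.sum_option]
  simp only [coord, drift, normSq, EuclideanSpace.real_norm_sq_eq, add_zero, Finset.sum_add_distrib,
    Finset.sum_const, Finset.card_univ, Fintype.card_fin, nsmul_eq_mul, mul_one]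
  have : ∑ i, p.1 i * (-p.1 i / (2 * p.2.2)) = -(∑ i, p.1 i ^ 2) / (2 * p.2.2) := by
    rw [← Finset.sum_neg_distrib, Finset.sum_div]
    exact Finset.sum_congr rfl fun i _ => by ring
  rw [this]
  field_simp
  ring

theorem wgt_hasLineDerivAt {a : ℝ} {p : EuclideanSpace ℝ (Fin n) × ℝ × ℝ} (hp : p ∈ openRegion n)
    (j : Option (Fin n)) : HasLineDerivAt ℝ (wgt a) (drift a j p * wgt a p) p (dir j) := by
  obtain ⟨x, y, t⟩ := p
  have hy : 0 < y := hp.1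
  have ht : 0 < t := hp.2
  rcases j with _ | i
  · have h1 : HasDerivAt (fun s : ℝ => y + s) 1 0 := (hasDerivAt_id (0 : ℝ)).const_add y
    have h2 := (h1.rpow_const (p := a) (Or.inl (by simpa using hy.ne'))).mul
      ((((((h1.pow 2).const_add (‖x‖ ^ 2)).neg).div_const (4 * t)).exp).const_mul
        (1 / t ^ (((n : ℝ) + 1 + a) / 2)))
    unfold HasLineDerivAt
    refine (h2.congr_of_eventuallyEq (Eventually.of_forall fun s => ?_)).congr_deriv ?_
    · simp [wgt, gaussian, normSq, dir]
    simp only [wgt, gaussian, normSq, drift, coord, add_zero, rpow_sub_one hy.ne', Pi.pow_apply, Pi.neg_apply]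
    field_simp
    ring
  · have h1 : HasDerivAt (fun s : ℝ => x + s • (EuclideanSpace.single i (1 : ℝ))) (EuclideanSpace.single i (1 : ℝ)) 0 := by
      simpa using ((hasDerivAt_id (0 : ℝ)).smul_const (EuclideanSpace.single i (1 : ℝ))).const_add x
    have h2 := (((((h1.norm_sq.add_const (y ^ 2)).neg).div_const (4 * t)).exp).const_mul
        (1 / t ^ (((n : ℝ) + 1 + a) / 2))).const_mul (y ^ a)
    unfold HasLineDerivAt
    refine (h2.congr_of_eventuallyEq (Eventually.of_forall fun s => ?_)).congr_deriv ?_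
    · simp [wgt, gaussian, normSq, dir]
    simp only [wgt, gaussian, normSq, drift, coord, zero_smul, add_zero, EuclideanSpace.inner_single_right]
    simp
    field_simp
    ring

/-- This is the continuity equation ∂_t μ + div(X μ)/(2t) = 0, which holds because μ dX is invariant
under the parabolic scaling (X, t) ↦ (rX, r²t). Keeping the divergence as an unexpanded sum lets it
cancel against the spatial fluxes as a whole. -/
theorem wgt_hasLineDerivAt_t {a : ℝ} {p : EuclideanSpace ℝ (Fin n) × ℝ × ℝ} (hp : p ∈ openRegion n) :
    HasLineDerivAt ℝ (wgt a) (-(∑ j, (1 + coord j p * drift a j p)) / (2 * p.2.2) * wgt a p) p tdir := by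
  rw [sum_coord_drift hp]
  obtain ⟨x, y, t⟩ := p
  have hy : 0 < y := hp.1
  have ht : 0 < t := hp.2
  have h1 : HasDerivAt (fun s : ℝ => t + s) 1 0 := (hasDerivAt_id (0 : ℝ)).const_add t
  have h2 := ((h1.rpow_const (p := -(((n : ℝ) + 1 + a) / 2)) (Or.inl (by simpa using ht.ne'))).mul
    (((((h1.const_mul 4).inv (by simpa using ht.ne')).const_mul (-(normSq x y)))).exp)).const_mul (y ^ a)
  unfold HasLineDerivAt
  refine (h2.congr_of_eventuallyEq ?_).congr_deriv ?_
  · have : ∀ᶠ s : ℝ in 𝓝 0, 0 < t + s := by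
      have := h1.continuousAt.tendsto
      exact this.eventually (lt_mem_nhds (by simpa using ht))
    filter_upwards [this] with s hs
    simp only [wgt, gaussian, tdir, Prod.smul_mk, Prod.mk_add_mk, smul_zero, add_zero, smul_eq_mul, mul_one,
      mul_zero, one_mul, rpow_neg hs.le, Pi.mul_apply, Pi.inv_apply, div_eq_mul_inv]
  simp only [wgt, gaussian, add_zero, rpow_sub_one ht.ne', rpow_neg ht.le, Pi.inv_apply]
  field_simp
  ring


/-! ### The pointwise Carleman inequality -/

/-- The functions of time entering the Carleman argument on `(0, T)`: `κ = σ^{-2α}`,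
`γ = σ / (t σ')` and `θ = t γ' / γ`. -/
structure IsTimeWeight (T α : ℝ) (κ γ θ : ℝ → ℝ) : Prop where
  κ_pos : ∀ t ∈ Ioo 0 T, 0 < κ t
  γ_ge : ∀ t ∈ Ioo 0 T, 1 ≤ γ t
  θ_nonneg : ∀ t ∈ Ioo 0 T, 0 ≤ θ t
  θ_cont : ContinuousOn θ (Ioo 0 T)
  γ_deriv : ∀ t ∈ Ioo 0 T, HasDerivAt γ (γ t * θ t / t) t
  κ_deriv : ∀ t ∈ Ioo 0 T, HasDerivAt κ (-2 * α * κ t / (t * γ t)) t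
  γθ_le : ∀ t ∈ Ioo 0 T, γ t * θ t ≤ 4 * α

/-- `w_t + X / (2t) · ∇w`. -/
noncomputable def advect (W : EuclideanSpace ℝ (Fin n) × ℝ × ℝ → ℝ) (p : EuclideanSpace ℝ (Fin n) × ℝ × ℝ) : ℝ :=
  pd W tdir p + ∑ j, coord j p / (2 * p.2.2) * pd W (dir j) p

/-- The operator `(y^a G)⁻¹ div (y^a G ∇w)`. -/
noncomputable def genL (a : ℝ) (W : EuclideanSpace ℝ (Fin n) × ℝ × ℝ → ℝ) (p : EuclideanSpace ℝ (Fin n) × ℝ × ℝ) : ℝ :=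
  ∑ j, (pd (pd W (dir j)) (dir j) p + drift a j p * pd W (dir j) p)

/-- `|∇w|^2` in coordinates. -/
noncomputable def gradN (W : EuclideanSpace ℝ (Fin n) × ℝ × ℝ → ℝ) (p : EuclideanSpace ℝ (Fin n) × ℝ × ℝ) : ℝ :=
  ∑ j, pd W (dir j) p ^ 2

/-- The spatial components of the flux in the pointwise Carleman inequality. -/
noncomputable def flux (a α : ℝ) (κ γ θ : ℝ → ℝ) (W : EuclideanSpace ℝ (Fin n) × ℝ × ℝ → ℝ) (j : Option (Fin n))
    (p : EuclideanSpace ℝ (Fin n) × ℝ × ℝ) : ℝ :=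
  (2 * (κ p.2.2 * (p.2.2 * γ p.2.2)) * (advect W p * pd W (dir j) p)
    - κ p.2.2 * γ p.2.2 / 2 * (coord j p * gradN W p)
    + α * κ p.2.2 / (2 * p.2.2) * (coord j p * W p ^ 2)
    + 2 * κ p.2.2 * (γ p.2.2 * θ p.2.2 / 4 - α) * (W p * pd W (dir j) p)) * wgt a p

/-- The time component of the flux. -/
noncomputable def fluxT (a α : ℝ) (κ γ : ℝ → ℝ) (W : EuclideanSpace ℝ (Fin n) × ℝ × ℝ → ℝ)
    (p : EuclideanSpace ℝ (Fin n) × ℝ × ℝ) : ℝ :=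
  (α * κ p.2.2 * W p ^ 2 - κ p.2.2 * (p.2.2 * γ p.2.2) * gradN W p) * wgt a p

/-- The derivative of `advect W` in the direction `dir j`. -/
noncomputable def advectD (W : EuclideanSpace ℝ (Fin n) × ℝ × ℝ → ℝ) (j : Option (Fin n))
    (p : EuclideanSpace ℝ (Fin n) × ℝ × ℝ) : ℝ :=
  pd (pd W tdir) (dir j) p + (∑ i, coord i p / (2 * p.2.2) * pd (pd W (dir i)) (dir j) p
    + pd W (dir j) p / (2 * p.2.2))

/-- The derivative of `flux j` in the direction `dir j`. -/
noncomputable def fluxD (a α : ℝ) (κ γ θ : ℝ → ℝ) (W : EuclideanSpace ℝ (Fin n) × ℝ × ℝ → ℝ) (j : Option (Fin n))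
    (p : EuclideanSpace ℝ (Fin n) × ℝ × ℝ) : ℝ :=
  (2 * (κ p.2.2 * (p.2.2 * γ p.2.2)) * (advectD W j p * pd W (dir j) p + advect W p * pd (pd W (dir j)) (dir j) p)
    - κ p.2.2 * γ p.2.2 / 2 * (gradN W p + coord j p * ∑ i, 2 * pd W (dir i) p * pd (pd W (dir i)) (dir j) p)
    + α * κ p.2.2 / (2 * p.2.2) * (W p ^ 2 + coord j p * (2 * W p * pd W (dir j) p))
    + 2 * κ p.2.2 * (γ p.2.2 * θ p.2.2 / 4 - α) *
      (pd W (dir j) p * pd W (dir j) p + W p * pd (pd W (dir j)) (dir j) p)) * wgt a p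
  + (2 * (κ p.2.2 * (p.2.2 * γ p.2.2)) * (advect W p * pd W (dir j) p)
    - κ p.2.2 * γ p.2.2 / 2 * (coord j p * gradN W p)
    + α * κ p.2.2 / (2 * p.2.2) * (coord j p * W p ^ 2)
    + 2 * κ p.2.2 * (γ p.2.2 * θ p.2.2 / 4 - α) * (W p * pd W (dir j) p)) * (drift a j p * wgt a p)

/-- The derivative of `fluxT` in time. -/
noncomputable def fluxTD (a α : ℝ) (κ γ θ : ℝ → ℝ) (W : EuclideanSpace ℝ (Fin n) × ℝ × ℝ → ℝ)
    (p : EuclideanSpace ℝ (Fin n) × ℝ × ℝ) : ℝ :=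
  (α * (-2 * α * κ p.2.2 / (p.2.2 * γ p.2.2)) * W p ^ 2 + α * κ p.2.2 * (2 * W p * pd W tdir p)
    - (κ p.2.2 * (γ p.2.2 * (1 + θ p.2.2) - 2 * α) * gradN W p
      + κ p.2.2 * (p.2.2 * γ p.2.2) * ∑ i, 2 * pd W (dir i) p * pd (pd W (dir i)) tdir p)) * wgt a p
  + (α * κ p.2.2 * W p ^ 2 - κ p.2.2 * (p.2.2 * γ p.2.2) * gradN W p) *
    (-(∑ j, (1 + coord j p * drift a j p)) / (2 * p.2.2) * wgt a p)

theorem dir_time (j : Option (Fin n)) (p : EuclideanSpace ℝ (Fin n) × ℝ × ℝ) (s : ℝ) :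
    (p + s • dir j).2.2 = p.2.2 := by
  cases j <;> simp [dir]

theorem gradN_hasLineDerivAt {W : EuclideanSpace ℝ (Fin n) × ℝ × ℝ → ℝ} (hW : ContDiffOn ℝ ∞ W (openRegion n))
    {p : EuclideanSpace ℝ (Fin n) × ℝ × ℝ} (hp : p ∈ openRegion n) (v : EuclideanSpace ℝ (Fin n) × ℝ × ℝ) :
    HasLineDerivAt ℝ (gradN W) (∑ i, 2 * pd W (dir i) p * pd (pd W (dir i)) v p) p v := by
  unfold HasLineDerivAt gradN
  refine (HasDerivAt.fun_sum fun i _ =>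
    (pd_hasLineDerivAt (pd_contDiffOn hW (dir i)) hp v).pow 2).congr_deriv ?_
  refine Finset.sum_congr rfl fun i _ => ?_
  simp

theorem advect_hasLineDerivAt {W : EuclideanSpace ℝ (Fin n) × ℝ × ℝ → ℝ} (hW : ContDiffOn ℝ ∞ W (openRegion n))
    {p : EuclideanSpace ℝ (Fin n) × ℝ × ℝ} (hp : p ∈ openRegion n) (j : Option (Fin n)) :
    HasLineDerivAt ℝ (advect W) (advectD W j p) p (dir j) := by
  unfold HasLineDerivAt advect advectD
  simp only [dir_time]
  have h1 := pd_hasLineDerivAt (pd_contDiffOn hW tdir) hp (dir j)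
  have h2 := HasDerivAt.fun_sum (u := Finset.univ) fun i (_ : i ∈ Finset.univ) =>
    ((coord_hasLineDerivAt j p i).div_const (2 * p.2.2)).mul
    (pd_hasLineDerivAt (pd_contDiffOn hW (dir i)) hp (dir j))
  refine (h1.add h2).congr_deriv ?_
  congr 1
  simp only [zero_smul, add_zero, Finset.sum_add_distrib]
  rw [add_comm]
  congr 1
  rw [Finset.sum_eq_single j]
  · simp; ring
  · intro i _ hij; simp [hij]
  · simp

theorem flux_hasLineDerivAt {a α : ℝ} {κ γ θ : ℝ → ℝ} {W : EuclideanSpace ℝ (Fin n) × ℝ × ℝ → ℝ}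
    (hW : ContDiffOn ℝ ∞ W (openRegion n)) {p : EuclideanSpace ℝ (Fin n) × ℝ × ℝ} (hp : p ∈ openRegion n)
    (j : Option (Fin n)) :
    HasLineDerivAt ℝ (flux a α κ γ θ W j) (fluxD a α κ γ θ W j p) p (dir j) := by
  have hw := pd_hasLineDerivAt hW hp (dir j)
  have hS := pd_hasLineDerivAt (pd_contDiffOn hW (dir j)) hp (dir j)
  have hN := gradN_hasLineDerivAt hW hp (dir j)
  have hA := advect_hasLineDerivAt hW hp j
  have hX := coord_hasLineDerivAt j p j
  have hμ := wgt_hasLineDerivAt (a := a) hp j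
  unfold HasLineDerivAt flux fluxD at *
  simp only [dir_time]
  refine (((((hA.mul hS).const_mul _).sub ((hX.mul hN).const_mul _)).add ((hX.mul (hw.pow 2)).const_mul _)).add
    ((hw.mul hS).const_mul _)).mul hμ |>.congr_deriv ?_
  simp

/-- The factor γ(1 + θ) - 2α is (κtγ)'/κ, by tγ' = γθ and tγκ' = -2ακ. -/
theorem fluxT_hasLineDerivAt {T a α : ℝ} {κ γ θ : ℝ → ℝ} (hκ : IsTimeWeight T α κ γ θ)
    {W : EuclideanSpace ℝ (Fin n) × ℝ × ℝ → ℝ}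
    (hW : ContDiffOn ℝ ∞ W (openRegion n)) {p : EuclideanSpace ℝ (Fin n) × ℝ × ℝ} (hp : p ∈ openRegion n)
    (hT : p.2.2 < T) :
    HasLineDerivAt ℝ (fluxT a α κ γ W) (fluxTD a α κ γ θ W p) p tdir := by
  have ht : p.2.2 ∈ Ioo 0 T := ⟨hp.2, hT⟩
  have hw := pd_hasLineDerivAt hW hp tdir
  have hN := gradN_hasLineDerivAt hW hp tdir
  have hμ := wgt_hasLineDerivAt_t (a := a) hp
  have htt : ∀ s : ℝ, (p + s • (tdir : EuclideanSpace ℝ (Fin n) × ℝ × ℝ)).2.2 = p.2.2 + s := fun s => by simp [tdir]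
  have hid : HasDerivAt (fun s : ℝ => p.2.2 + s) 1 0 := (hasDerivAt_id (0 : ℝ)).const_add _
  have h0 : p.2.2 + 0 = p.2.2 := add_zero _
  have hk : HasDerivAt (fun s : ℝ => κ (p.2.2 + s)) (-2 * α * κ p.2.2 / (p.2.2 * γ p.2.2)) 0 := by
    exact HasDerivAt.comp_const_add p.2.2 0 (by rw [h0]; exact hκ.κ_deriv _ ht)
  have hg : HasDerivAt (fun s : ℝ => γ (p.2.2 + s)) (γ p.2.2 * θ p.2.2 / p.2.2) 0 := by
    exact HasDerivAt.comp_const_add p.2.2 0 (by rw [h0]; exact hκ.γ_deriv _ ht)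
  have hg1 : γ p.2.2 ≠ 0 := by linarith [hκ.γ_ge _ ht]
  have ht1 : p.2.2 ≠ 0 := ht.1.ne'
  unfold HasLineDerivAt fluxT fluxTD at *
  simp only [htt]
  refine ((((hk.const_mul α).mul (hw.pow 2)).sub ((hk.mul (hid.mul hg)).mul hN)).mul hμ).congr_deriv ?_
  have hz : p + (0 : ℝ) • (tdir : EuclideanSpace ℝ (Fin n) × ℝ × ℝ) = p := by simp
  simp only [Pi.sub_apply, Pi.mul_apply, Pi.pow_apply, hz, add_zero]
  push_cast
  field_simp
  ring

/-- The pointwise Carleman inequality. -/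
theorem pointwise_carleman {T a α : ℝ} {κ γ θ : ℝ → ℝ} (hκ : IsTimeWeight T α κ γ θ)
    {W : EuclideanSpace ℝ (Fin n) × ℝ × ℝ → ℝ}
    (hW : ContDiffOn ℝ ∞ W (openRegion n)) {p : EuclideanSpace ℝ (Fin n) × ℝ × ℝ} (hp : p ∈ openRegion n)
    (hT : p.2.2 < T) :
    ∑ j, fluxD a α κ γ θ W j p + fluxTD a α κ γ θ W p
      + (1 / 2 * (κ p.2.2 * γ p.2.2 * θ p.2.2) * gradN W p
        + 1 / 4 * (α * κ p.2.2 * (θ p.2.2 / p.2.2)) * W p ^ 2) * wgt a p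
      ≤ κ p.2.2 * (p.2.2 * γ p.2.2) * (advect W p + genL a W p) ^ 2 * wgt a p := by
  have ht : p.2.2 ∈ Ioo 0 T := ⟨hp.2, hT⟩
  have hκp := hκ.κ_pos _ ht
  have hγ1 := hκ.γ_ge _ ht
  have hθ0 := hκ.θ_nonneg _ ht
  have hle := hκ.γθ_le _ ht
  have hμ := wgt_pos (a := a) hp
  have ht0 := ht.1
  set t := p.2.2
  set k := κ t
  set g := γ t
  set th := θ t
  set μ := wgt a p
  set w := W p
  set A := advect W p with hA
  set N := gradN W p with hN
  set L := genL a W p with hL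
  set Y := ∑ j, coord j p * ∑ i, 2 * pd W (dir i) p * pd (pd W (dir i)) (dir j) p with hY
  set Z := ∑ j, (1 + coord j p * drift a j p) with hZ
  set Q := ∑ i, 2 * pd W (dir i) p * pd (pd W (dir i)) tdir p with hQ
  set B := ∑ j, coord j p * pd W (dir j) p with hB
  -- This is ∇A·∇w. By symmetry of second derivatives it is half the derivative of |∇w|² along ∂_t +
  -- X/(2t)·∇, plus |∇w|²/(2t) from differentiating the coefficient X/(2t).
  have e1 : ∑ j, advectD W j p * pd W (dir j) p = Q / 2 + Y / (4 * t) + N / (2 * t) := by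
    have h1 : ∀ j, advectD W j p * pd W (dir j) p = 2 * pd W (dir j) p * pd (pd W (dir j)) tdir p / 2
        + (∑ i, coord i p * (2 * pd W (dir j) p * pd (pd W (dir j)) (dir i) p)) / (4 * t)
        + pd W (dir j) p ^ 2 / (2 * t) := by
      intro j
      rw [advectD, pd_comm hW hp tdir (dir j), add_mul, add_mul, Finset.sum_mul, Finset.sum_div]
      have : ∀ i, coord i p / (2 * p.2.2) * pd (pd W (dir i)) (dir j) p * pd W (dir j) p
          = coord i p * (2 * pd W (dir j) p * pd (pd W (dir j)) (dir i) p) / (4 * t) := fun i => by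
        rw [pd_comm hW hp (dir i) (dir j)]
        change coord i p / (2 * t) * _ * _ = _
        field_simp
        ring
      rw [Finset.sum_congr rfl fun i _ => this i]
      ring
    rw [Finset.sum_congr rfl fun j _ => h1 j, Finset.sum_add_distrib, Finset.sum_add_distrib, ← Finset.sum_div,
      ← Finset.sum_div, ← Finset.sum_div, Finset.sum_comm]
    simp only [hQ, hY, hN, gradN, Finset.mul_sum]
  have e2 : A = pd W tdir p + B / (2 * t) := by
    rw [hA, advect, hB, Finset.sum_div]
    congr 1
    exact Finset.sum_congr rfl fun j _ => by ring
  -- Differentiating μ produces the drift terms, which combine with the pure second derivatives of w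
  -- into L, and with the derivatives of the coordinates into μ⁻¹ div(X μ).
  have e3 : ∑ j, fluxD a α κ γ θ W j p = (2 * (k * (t * g)) * (Q / 2 + Y / (4 * t) + N / (2 * t) + A * L)
      - k * g / 2 * (Z * N + Y) + α * k / (2 * t) * (Z * w ^ 2 + 2 * w * B)
      + 2 * k * (g * th / 4 - α) * (N + w * L)) * μ := by
    have h1 : ∀ j, fluxD a α κ γ θ W j p = (2 * (k * (t * g)) * (advectD W j p * pd W (dir j) p
        + A * (pd (pd W (dir j)) (dir j) p + drift a j p * pd W (dir j) p))
        - k * g / 2 * ((1 + coord j p * drift a j p) * N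
          + coord j p * ∑ i, 2 * pd W (dir i) p * pd (pd W (dir i)) (dir j) p)
        + α * k / (2 * t) * ((1 + coord j p * drift a j p) * w ^ 2 + 2 * w * (coord j p * pd W (dir j) p))
        + 2 * k * (g * th / 4 - α) * (pd W (dir j) p ^ 2
          + w * (pd (pd W (dir j)) (dir j) p + drift a j p * pd W (dir j) p))) * μ := by
      intro j
      unfold fluxD
      ring
    rw [Finset.sum_congr rfl fun j _ => h1 j, ← Finset.sum_mul, Finset.sum_add_distrib, Finset.sum_add_distrib,
      Finset.sum_sub_distrib, ← Finset.mul_sum, ← Finset.mul_sum, ← Finset.mul_sum, ← Finset.mul_sum,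
      Finset.sum_add_distrib, Finset.sum_add_distrib, Finset.sum_add_distrib, Finset.sum_add_distrib,
      ← Finset.mul_sum, ← Finset.mul_sum, ← Finset.mul_sum, ← Finset.sum_mul, ← Finset.sum_mul, e1]
    rfl
  have e4 : fluxTD a α κ γ θ W p = (α * (-2 * α * k / (t * g)) * w ^ 2 + α * k * (2 * w * (A - B / (2 * t)))
    - (k * (g * (1 + th) - 2 * α) * N + k * (t * g) * Q)) * μ
    + (α * k * w ^ 2 - k * (t * g) * N) * (-Z / (2 * t) * μ) := by
    rw [e2, add_sub_cancel_right]; rfl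
  rw [e3, e4]
  have hg0 : 0 < g := by linarith
  -- The square of A is completed with the shift -αw/(tγ), that of L with αw/(tγ) - θw/(4t). In
  -- |∇w|² the shift αw/(tγ) of L cancels the -2α coming from κ', and the correction -θw/(4t) costs
  -- half of γθ. In w² the α² terms cancel and αθ/(2t) - γθ²/(16t) remains. Of this αθ/(4t) is kept,
  -- and the rest is the last summand, nonnegative exactly when γθ ≤ 4α.
  have key : k * (t * g) * (A + L) ^ 2 * μ - (((2 * (k * (t * g)) * (Q / 2 + Y / (4 * t) + N / (2 * t) + A * L)
      - k * g / 2 * (Z * N + Y) + α * k / (2 * t) * (Z * w ^ 2 + 2 * w * B)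
      + 2 * k * (g * th / 4 - α) * (N + w * L)) * μ)
      + ((α * (-2 * α * k / (t * g)) * w ^ 2 + α * k * (2 * w * (A - B / (2 * t)))
    - (k * (g * (1 + th) - 2 * α) * N + k * (t * g) * Q)) * μ
    + (α * k * w ^ 2 - k * (t * g) * N) * (-Z / (2 * t) * μ))
    + (1 / 2 * (k * g * th) * N + 1 / 4 * (α * k * (th / t)) * w ^ 2) * μ)
    = μ * k * (t * g * (A - α / (t * g) * w) ^ 2 + t * g * (L + α / (t * g) * w - th * w / (4 * t)) ^ 2
      + th / (16 * t) * w ^ 2 * (4 * α - g * th)) := by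
    field_simp
    ring
  have hpos : 0 ≤ μ * k * (t * g * (A - α / (t * g) * w) ^ 2 + t * g * (L + α / (t * g) * w - th * w / (4 * t)) ^ 2
      + th / (16 * t) * w ^ 2 * (4 * α - g * th)) := by
    have : 0 ≤ 4 * α - g * th := by linarith
    positivity
  linarith


/-! ### Test functions and their traces on the thin set -/

/-- `W` together with continuous extensions to `{y ≥ 0}` of its derivatives `∂_{x_i} W`, `∂_t W`,
`y^a ∂_y W` and of `y^{-a}` times the extension operator. -/
structure JetExt (a τ T : ℝ) (W : EuclideanSpace ℝ (Fin n) × ℝ × ℝ → ℝ)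
    (gX : Fin n → EuclideanSpace ℝ (Fin n) × ℝ × ℝ → ℝ) (gt gφ gf : EuclideanSpace ℝ (Fin n) × ℝ × ℝ → ℝ) :
    Prop where
  smooth : ContDiffOn ℝ ∞ W (openRegion n)
  W_nice : IsNice τ T W
  gX_nice : ∀ i, IsNice τ T (gX i)
  gt_nice : IsNice τ T gt
  gφ_nice : IsNice τ T gφ
  gf_nice : IsNice τ T gf
  gX_eq : ∀ i, ∀ p ∈ openRegion n, pd W (dir (some i)) p = gX i p
  gt_eq : ∀ p ∈ openRegion n, pd W tdir p = gt p
  gφ_eq : ∀ p ∈ openRegion n, p.2.1 ^ a * pd W (dir none) p = gφ p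
  gf_eq : ∀ p ∈ openRegion n, advect W p + genL a W p = gf p

theorem isClosed_supportSet (τ : ℝ) : IsClosed (supportSet n τ) := by
  have h1 : IsClosed {p : EuclideanSpace ℝ (Fin n) × ℝ × ℝ | normSq p.1 p.2.1 ≤ 4 ^ 2} := by
    unfold normSq
    exact isClosed_le (by fun_prop) (by fun_prop)
  have h2 : IsClosed {p : EuclideanSpace ℝ (Fin n) × ℝ × ℝ | p.2.2 ≤ τ} :=
    isClosed_le (by fun_prop) (by fun_prop)
  exact h1.inter h2

theorem pd_eq_zero {τ : ℝ} {f : EuclideanSpace ℝ (Fin n) × ℝ × ℝ → ℝ}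
    (hf : ∀ p ∈ openRegion n, p ∉ supportSet n τ → f p = 0) (v : EuclideanSpace ℝ (Fin n) × ℝ × ℝ) :
    ∀ p ∈ openRegion n, p ∉ supportSet n τ → pd f v p = 0 := by
  intro p hp hs
  have h : f =ᶠ[𝓝 p] fun _ => 0 := by
    filter_upwards [isOpen_openRegion.mem_nhds hp, (isClosed_supportSet τ).isOpen_compl.mem_nhds hs] with q h1 h2
    exact hf q h1 h2
  rw [pd, h.fderiv_eq]
  simp

theorem tendsto_to_thin {p : EuclideanSpace ℝ (Fin n) × ℝ × ℝ} :
    Tendsto (fun ε : ℝ => (p.1, p.2.1 + ε, p.2.2)) (𝓝[>] 0) (𝓝 p) := by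
  have : Continuous fun ε : ℝ => (p.1, p.2.1 + ε, p.2.2) := by fun_prop
  simpa using (this.tendsto 0).mono_left (nhdsWithin_le_nhds (s := Ioi 0))

/-- A boundary point outside the closed support set is approached vertically from inside the region
by points that still avoid that set, where g vanishes. -/
theorem eq_zero_of_continuousOn {τ : ℝ} {g : EuclideanSpace ℝ (Fin n) × ℝ × ℝ → ℝ}
    (hg : ContinuousOn g (closedRegion n))
    (h0 : ∀ p ∈ openRegion n, p ∉ supportSet n τ → g p = 0) :
    ∀ p, 0 ≤ p.2.1 → 0 < p.2.2 → p ∉ supportSet n τ → g p = 0 := by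
  intro p hy ht hs
  have h1 : Tendsto (fun ε : ℝ => g (p.1, p.2.1 + ε, p.2.2)) (𝓝[>] 0) (𝓝 (g p)) := by
    refine (hg p ⟨hy, ht⟩).tendsto.comp (tendsto_nhdsWithin_iff.2 ⟨tendsto_to_thin, ?_⟩)
    filter_upwards [self_mem_nhdsWithin] with ε hε using ⟨add_nonneg hy (le_of_lt hε), ht⟩
  have h2 : (fun ε : ℝ => g (p.1, p.2.1 + ε, p.2.2)) =ᶠ[𝓝[>] 0] fun _ => 0 := by
    filter_upwards [self_mem_nhdsWithin,
      tendsto_to_thin.eventually ((isClosed_supportSet τ).isOpen_compl.mem_nhds hs)] with ε hε hε'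
    exact h0 _ ⟨add_pos_of_nonneg_of_pos hy hε, ht⟩ hε'
  exact tendsto_nhds_unique h1 (tendsto_const_nhds.congr' h2.symm)

theorem isNice_of_continuousOn {τ T : ℝ} {g : EuclideanSpace ℝ (Fin n) × ℝ × ℝ → ℝ} (hT : τ < T)
    (hg : ContinuousOn g (closedRegion n))
    (h0 : ∀ p ∈ openRegion n, p ∉ supportSet n τ → g p = 0) : IsNice τ T g :=
  ⟨hg.mono fun _ hp => ⟨hp.1, hp.2.1⟩, eq_zero_of_continuousOn hg h0, hT⟩

section
variable {w : EuclideanSpace ℝ (Fin n) → ℝ → ℝ → ℝ}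

theorem hasFDerivAt_slice_x (hW : ContDiffOn ℝ ∞ (fun p : EuclideanSpace ℝ (Fin n) × ℝ × ℝ => w p.1 p.2.1 p.2.2)
    (openRegion n)) {y t : ℝ} (hy : 0 < y) (ht : 0 < t) (x : EuclideanSpace ℝ (Fin n)) :
    HasFDerivAt (fun z => w z y t) ((fderiv ℝ (fun p : EuclideanSpace ℝ (Fin n) × ℝ × ℝ => w p.1 p.2.1 p.2.2)
      (x, y, t)).comp (ContinuousLinearMap.inl ℝ _ _)) x :=
  (hasFDerivAt_of_smooth hW (p := (x, y, t)) ⟨hy, ht⟩).comp (f := fun z => (z, y, t)) x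
    (hasFDerivAt_prodMk_left x (y, t))

theorem gradX_apply (hW : ContDiffOn ℝ ∞ (fun p : EuclideanSpace ℝ (Fin n) × ℝ × ℝ => w p.1 p.2.1 p.2.2)
    (openRegion n)) {y t : ℝ} (hy : 0 < y) (ht : 0 < t) (x : EuclideanSpace ℝ (Fin n)) (i : Fin n) :
    gradX w x y t i = pd (fun p : EuclideanSpace ℝ (Fin n) × ℝ × ℝ => w p.1 p.2.1 p.2.2) (dir (some i)) (x, y, t) := by
  have h1 : inner ℝ (gradX w x y t) (EuclideanSpace.single i (1 : ℝ)) = gradX w x y t i := by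
    simp [EuclideanSpace.inner_single_right]
  rw [← h1, gradX, gradient, InnerProductSpace.toDual_symm_apply, (hasFDerivAt_slice_x hW hy ht x).fderiv]
  simp only [pd, dir, ContinuousLinearMap.comp_apply, ContinuousLinearMap.inl_apply]
  rfl

theorem derivY_eq (hW : ContDiffOn ℝ ∞ (fun p : EuclideanSpace ℝ (Fin n) × ℝ × ℝ => w p.1 p.2.1 p.2.2)
    (openRegion n)) {y t : ℝ} (hy : 0 < y) (ht : 0 < t) (x : EuclideanSpace ℝ (Fin n)) :
    derivY w x y t = pd (fun p : EuclideanSpace ℝ (Fin n) × ℝ × ℝ => w p.1 p.2.1 p.2.2) (dir none) (x, y, t) :=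
  (HasLineDerivAt.hasDerivAt_y (pd_hasLineDerivAt hW (p := (x, y, t)) ⟨hy, ht⟩ (dir none))).deriv

theorem derivT_eq (hW : ContDiffOn ℝ ∞ (fun p : EuclideanSpace ℝ (Fin n) × ℝ × ℝ => w p.1 p.2.1 p.2.2)
    (openRegion n)) {y t : ℝ} (hy : 0 < y) (ht : 0 < t) (x : EuclideanSpace ℝ (Fin n)) :
    derivT w x y t = pd (fun p : EuclideanSpace ℝ (Fin n) × ℝ × ℝ => w p.1 p.2.1 p.2.2) tdir (x, y, t) :=
  (HasLineDerivAt.hasDerivAt_t (pd_hasLineDerivAt hW (p := (x, y, t)) ⟨hy, ht⟩ tdir)).deriv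

theorem gradSq_eq (hW : ContDiffOn ℝ ∞ (fun p : EuclideanSpace ℝ (Fin n) × ℝ × ℝ => w p.1 p.2.1 p.2.2)
    (openRegion n)) {y t : ℝ} (hy : 0 < y) (ht : 0 < t) (x : EuclideanSpace ℝ (Fin n)) :
    gradSq w x y t = gradN (fun p : EuclideanSpace ℝ (Fin n) × ℝ × ℝ => w p.1 p.2.1 p.2.2) (x, y, t) := by
  rw [gradSq, gradN, Fintype.sum_option, EuclideanSpace.real_norm_sq_eq, derivY_eq hW hy ht, add_comm]
  simp only [gradX_apply hW hy ht]

/-- The transport term X/(2t)·∇w added in `advect` is removed again by the Gaussian part of the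
drift in `genL`; the remaining drift a/y is the derivative of the weight y^a. -/
theorem backwardOp_eq {a : ℝ} (hW : ContDiffOn ℝ ∞ (fun p : EuclideanSpace ℝ (Fin n) × ℝ × ℝ => w p.1 p.2.1 p.2.2)
    (openRegion n)) {y t : ℝ} (hy : 0 < y) (ht : 0 < t) (x : EuclideanSpace ℝ (Fin n)) :
    backwardOp a w x y t = y ^ a * (advect (fun p : EuclideanSpace ℝ (Fin n) × ℝ × ℝ => w p.1 p.2.1 p.2.2) (x, y, t)
      + genL a (fun p : EuclideanSpace ℝ (Fin n) × ℝ × ℝ => w p.1 p.2.1 p.2.2) (x, y, t)) := by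
  set W := fun p : EuclideanSpace ℝ (Fin n) × ℝ × ℝ => w p.1 p.2.1 p.2.2 with hWdef
  have hp : (x, y, t) ∈ openRegion n := ⟨hy, ht⟩
  have hlap : Laplacian.laplacian (fun z => w z y t) x = ∑ i, pd (pd W (dir (some i))) (dir (some i)) (x, y, t) := by
    rw [InnerProductSpace.laplacian_eq_iteratedFDeriv_orthonormalBasis _ (EuclideanSpace.basisFun (Fin n) ℝ)]
    refine Finset.sum_congr rfl fun i _ => ?_
    rw [iteratedFDeriv_two_apply]
    simp only [Matrix.cons_val_zero, Matrix.cons_val_one, EuclideanSpace.basisFun_apply]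
    have h1 : fderiv ℝ (fun z => w z y t) = fun z => (fderiv ℝ W (z, y, t)).comp (ContinuousLinearMap.inl ℝ _ _) :=
      funext fun z => (hasFDerivAt_slice_x hW hy ht z).fderiv
    have hd : DifferentiableAt ℝ (fderiv ℝ W) (x, y, t) :=
      (((hW.fderiv_of_isOpen (m := ∞) isOpen_openRegion (by simp)).contDiffAt
        (isOpen_openRegion.mem_nhds hp)).differentiableAt (by simp))
    have h2 : HasFDerivAt (fun z => fderiv ℝ W (z, y, t))
        ((fderiv ℝ (fderiv ℝ W) (x, y, t)).comp (ContinuousLinearMap.inl ℝ _ _)) x :=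
      hd.hasFDerivAt.comp (f := fun z => (z, y, t)) x (hasFDerivAt_prodMk_left x (y, t))
    rw [h1, (h2.clm_comp (hasFDerivAt_const _ x)).fderiv]
    have h3 : pd (pd W (dir (some i))) (dir (some i)) (x, y, t)
        = fderiv ℝ (fderiv ℝ W) (x, y, t) (dir (some i)) (dir (some i)) := by
      have h := (hd.hasFDerivAt.clm_apply (hasFDerivAt_const (dir (some i)) (x, y, t))).fderiv
      change fderiv ℝ (fun q => fderiv ℝ W q (dir (some i))) (x, y, t) (dir (some i)) = _
      rw [h]; simp
    rw [h3]
    simp [dir]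
    rfl
  have hyy : deriv (fun η => η ^ a * derivY w x η t) y = a * y ^ (a - 1) * pd W (dir none) (x, y, t)
      + y ^ a * pd (pd W (dir none)) (dir none) (x, y, t) := by
    have h1 : HasDerivAt (fun η => η ^ a * pd W (dir none) (x, η, t)) _ y :=
      (hasDerivAt_rpow_const (p := a) (Or.inl hy.ne')).mul
        (HasLineDerivAt.hasDerivAt_y (pd_hasLineDerivAt (pd_contDiffOn hW (dir none)) hp (dir none)))
    refine HasDerivAt.deriv (h1.congr_of_eventuallyEq ?_)
    filter_upwards [lt_mem_nhds hy] with η hη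
    rw [derivY_eq hW hη ht]
  rw [backwardOp, derivT_eq hW hy ht, hlap, hyy, advect, genL, Fintype.sum_option, Fintype.sum_option,
    rpow_sub_one hy.ne']
  simp only [coord, drift, add_zero, Finset.sum_add_distrib]
  have : ∑ i, -x i / (2 * t) * pd W (dir (some i)) (x, y, t) = -∑ i, x i / (2 * t) * pd W (dir (some i)) (x, y, t) := by
    rw [← Finset.sum_neg_distrib]
    exact Finset.sum_congr rfl fun i _ => by ring
  rw [this]
  field_simp
  ring

/-- Bundles the continuous extensions of the regularity hypotheses. They vanish off the support
because they agree for y > 0 with derivatives of w, and by continuity also at y = 0. -/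
theorem exists_jetExt {a T : ℝ} (hw : IsTestFunction a T w) : ∃ τ gX gt gφ gf,
    JetExt a τ T (fun p : EuclideanSpace ℝ (Fin n) × ℝ × ℝ => w p.1 p.2.1 p.2.2) gX gt gφ gf := by
  obtain ⟨τ, hτ, hsupp⟩ := hw.support
  have hW := hw.smooth
  set W := fun p : EuclideanSpace ℝ (Fin n) × ℝ × ℝ => w p.1 p.2.1 p.2.2 with hWdef
  obtain ⟨gx, hgx, hgx'⟩ := hw.gradX_extends
  obtain ⟨gt, hgt, hgt'⟩ := hw.derivT_extends
  obtain ⟨gφ, hgφ, hgφ'⟩ := hw.flux_extends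
  obtain ⟨gf, hgf, hgf'⟩ := hw.op_extends
  have h0 : ∀ p ∈ closedRegion n, p ∉ supportSet n τ → W p = 0 := fun p hp hs => by
    by_contra h
    exact hs (hsupp p hp h)
  have h1 : ∀ p ∈ openRegion n, p ∉ supportSet n τ → W p = 0 := fun p hp => h0 p ⟨le_of_lt hp.1, hp.2⟩
  have eX : ∀ i, ∀ p ∈ openRegion n, pd W (dir (some i)) p = gx p i := fun i p hp => by
    rw [hgx' p hp, gradX_apply hW hp.1 hp.2]
  have eT : ∀ p ∈ openRegion n, pd W tdir p = gt p := fun p hp => by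
    rw [hgt' p hp, derivT_eq hW hp.1 hp.2]
  have eφ : ∀ p ∈ openRegion n, p.2.1 ^ a * pd W (dir none) p = gφ p := fun p hp => by
    rw [hgφ' p hp]
    change _ = p.2.1 ^ a * derivY w p.1 p.2.1 p.2.2
    rw [derivY_eq hW hp.1 hp.2]
  have ef : ∀ p ∈ openRegion n, advect W p + genL a W p = gf p := fun p hp => by
    have hy : 0 < p.2.1 := hp.1
    rw [hgf' p hp]
    change _ = p.2.1 ^ (-a) * backwardOp a w p.1 p.2.1 p.2.2
    rw [backwardOp_eq hW hp.1 hp.2, ← mul_assoc, ← rpow_add hy]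
    simp
    rfl
  refine ⟨τ, fun i p => gx p i, gt, gφ, gf, hW, ⟨hw.continuous.mono fun p hp => ⟨hp.1, hp.2.1⟩,
    fun p hy ht => h0 p ⟨hy, ht⟩, hτ⟩, fun i => ?_, ?_, ?_, ?_, eX, eT, eφ, ef⟩
  · exact isNice_of_continuousOn hτ (by fun_prop) fun p hp hs => by
      rw [← eX i p hp]; exact pd_eq_zero h1 _ p hp hs
  · exact isNice_of_continuousOn hτ hgt fun p hp hs => by
      rw [← eT p hp]; exact pd_eq_zero h1 _ p hp hs
  · exact isNice_of_continuousOn hτ hgφ fun p hp hs => by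
      rw [← eφ p hp, pd_eq_zero h1 _ p hp hs, mul_zero]
  · exact isNice_of_continuousOn hτ hgf fun p hp hs => by
      rw [← ef p hp, advect, genL]
      simp only [pd_eq_zero h1 _ p hp hs, pd_eq_zero (pd_eq_zero h1 _) _ p hp hs, mul_zero, add_zero,
        Finset.sum_const_zero]

end


/-! ### Integrability of the weighted quantities -/

theorem IsNice.mul_left {τ T : ℝ} {h f : EuclideanSpace ℝ (Fin n) × ℝ × ℝ → ℝ} (hf : IsNice τ T f)
    (hh : ContinuousOn h {p | 0 ≤ p.2.1 ∧ 0 < p.2.2 ∧ p.2.2 < T}) : IsNice τ T fun p => h p * f p :=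
  ⟨hh.mul hf.cont, fun p hy ht hs => by rw [hf.zero p hy ht hs, mul_zero], hf.lt⟩

theorem IsNice.mul {τ T : ℝ} {h f : EuclideanSpace ℝ (Fin n) × ℝ × ℝ → ℝ} (hh : IsNice τ T h) (hf : IsNice τ T f) :
    IsNice τ T fun p => h p * f p := hf.mul_left hh.cont

theorem IsNice.sq {τ T : ℝ} {f : EuclideanSpace ℝ (Fin n) × ℝ × ℝ → ℝ} (hf : IsNice τ T f) :
    IsNice τ T fun p => f p ^ 2 := by
  simpa only [pow_two] using hf.mul hf

theorem IsNice.add {τ T : ℝ} {h f : EuclideanSpace ℝ (Fin n) × ℝ × ℝ → ℝ} (hh : IsNice τ T h) (hf : IsNice τ T f) :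
    IsNice τ T fun p => h p + f p :=
  ⟨hh.cont.add hf.cont, fun p hy ht hs => by rw [hf.zero p hy ht hs, hh.zero p hy ht hs, add_zero], hf.lt⟩

theorem IsNice.sum {ι : Type*} [Fintype ι] {τ T : ℝ} {f : ι → EuclideanSpace ℝ (Fin n) × ℝ × ℝ → ℝ} (hT : τ < T)
    (hf : ∀ i, IsNice τ T (f i)) : IsNice τ T fun p => ∑ i, f i p :=
  ⟨continuousOn_finsetSum _ fun i _ => (hf i).cont,
    fun p hy ht hs => Finset.sum_eq_zero fun i _ => (hf i).zero p hy ht hs, hT⟩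

theorem continuousOn_time {T : ℝ} {h : ℝ → ℝ} (hh : ContinuousOn h (Ioo 0 T)) :
    ContinuousOn (fun p : EuclideanSpace ℝ (Fin n) × ℝ × ℝ => h p.2.2) {p | 0 ≤ p.2.1 ∧ 0 < p.2.2 ∧ p.2.2 < T} :=
  hh.comp (by fun_prop) fun _ hp => hp.2

theorem continuousOn_gaussian {a T : ℝ} :
    ContinuousOn (fun p : EuclideanSpace ℝ (Fin n) × ℝ × ℝ => gaussian a p.1 p.2.1 p.2.2)
      {p | 0 ≤ p.2.1 ∧ 0 < p.2.2 ∧ p.2.2 < T} := by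
  unfold gaussian normSq
  refine ContinuousOn.mul (ContinuousOn.div continuousOn_const ?_ ?_) (ContinuousOn.rexp (ContinuousOn.div ?_ ?_ ?_))
  · exact ContinuousOn.rpow_const (by fun_prop) fun p hp => Or.inl hp.2.1.ne'
  · exact fun p hp => (rpow_pos_of_pos hp.2.1 _).ne'
  · fun_prop
  · fun_prop
  · exact fun p hp => (mul_pos (by norm_num) hp.2.1).ne'

section
variable {a τ T : ℝ} {W : EuclideanSpace ℝ (Fin n) × ℝ × ℝ → ℝ} {gX : Fin n → EuclideanSpace ℝ (Fin n) × ℝ × ℝ → ℝ}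
  {gt gφ gf : EuclideanSpace ℝ (Fin n) × ℝ × ℝ → ℝ}

theorem JetExt.pd_none (hJ : JetExt a τ T W gX gt gφ gf) {p : EuclideanSpace ℝ (Fin n) × ℝ × ℝ}
    (hp : p ∈ openRegion n) : pd W (dir none) p = p.2.1 ^ (-a) * gφ p := by
  have hy : 0 < p.2.1 := hp.1
  rw [← hJ.gφ_eq p hp, ← mul_assoc, ← rpow_add hy]
  simp

/-- With φ = y^a ∂_y w continuous, the vertical energy y^a |∂_y w|² equals y^(-a) φ². The energy is
therefore integrable at y = 0 precisely because both a and -a exceed -1. -/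
theorem JetExt.gradN_wgt (hJ : JetExt a τ T W gX gt gφ gf) {p : EuclideanSpace ℝ (Fin n) × ℝ × ℝ}
    (hp : p ∈ openRegion n) : gradN W p * wgt a p =
      p.2.1 ^ a * (gaussian a p.1 p.2.1 p.2.2 * ∑ i, gX i p ^ 2)
        + p.2.1 ^ (-a) * (gaussian a p.1 p.2.1 p.2.2 * gφ p ^ 2) := by
  have hy : 0 < p.2.1 := hp.1
  rw [gradN, Fintype.sum_option, hJ.pd_none hp, Finset.sum_congr rfl fun i _ => by rw [hJ.gX_eq i p hp], wgt]
  have h : p.2.1 ^ (-a) * p.2.1 ^ a = 1 := by rw [← rpow_add hy]; simp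
  linear_combination (p.2.1 ^ (-a) * gφ p ^ 2 * gaussian a p.1 p.2.1 p.2.2) * h

theorem JetExt.integrable_sq {f : EuclideanSpace ℝ (Fin n) × ℝ × ℝ → ℝ} (hf : IsNice τ T f) (ha : -1 < a) {h : ℝ → ℝ}
    (hh : ContinuousOn h (Ioo 0 T)) {c : ℝ} (hc : 0 < c) :
    Integrable (fun p => h p.2.2 * (f p ^ 2 * wgt a p)) (slab n 0 c) := by
  refine (((hf.sq.mul_left (continuousOn_gaussian (a := a))).mul_left (continuousOn_time hh)).integrable_rpow_mul ha hc).congr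
    (Eventually.of_forall fun p => ?_)
  simp only [wgt]; ring

theorem JetExt.integrable_gradN (hJ : JetExt a τ T W gX gt gφ gf) (ha : -1 < a) (ha' : a < 1) {h : ℝ → ℝ}
    (hh : ContinuousOn h (Ioo 0 T)) {c : ℝ} (hc : 0 < c) :
    Integrable (fun p => h p.2.2 * (gradN W p * wgt a p)) (slab n 0 c) := by
  have h1 := ((((IsNice.sum hJ.W_nice.lt fun i => (hJ.gX_nice i).sq).mul_left (continuousOn_gaussian (a := a))).mul_left
    (continuousOn_time hh)).integrable_rpow_mul ha hc).add
    (((hJ.gφ_nice.sq.mul_left (continuousOn_gaussian (a := a))).mul_left (continuousOn_time hh)).integrable_rpow_mul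
      (b := -a) (by linarith) hc)
  refine h1.congr ?_
  filter_upwards [ae_slab 0 c] with p hp
  rw [hJ.gradN_wgt ⟨hp.1, hc.trans hp.2⟩]
  simp only [Pi.add_apply]
  ring

theorem JetExt.integrable_sq_slice {f : EuclideanSpace ℝ (Fin n) × ℝ × ℝ → ℝ} (hf : IsNice τ T f) (ha : -1 < a)
    {t : ℝ} (ht : 0 < t) :
    Integrable (fun q : EuclideanSpace ℝ (Fin n) × ℝ => f (q.1, q.2, t) ^ 2 * wgt a (q.1, q.2, t)) (halfSlab n 0) := by
  refine ((hf.sq.mul_left (continuousOn_gaussian (a := a))).integrable_rpow_mul_slice ha ht).congr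
    (Eventually.of_forall fun p => ?_)
  simp only [wgt]; ring

theorem JetExt.integrable_gradN_slice (hJ : JetExt a τ T W gX gt gφ gf) (ha : -1 < a) (ha' : a < 1)
    {t : ℝ} (ht : 0 < t) :
    Integrable (fun q : EuclideanSpace ℝ (Fin n) × ℝ => gradN W (q.1, q.2, t) * wgt a (q.1, q.2, t)) (halfSlab n 0) := by
  have h1 := (((IsNice.sum hJ.W_nice.lt fun i => (hJ.gX_nice i).sq).mul_left
    (continuousOn_gaussian (a := a))).integrable_rpow_mul_slice ha ht).add
    ((hJ.gφ_nice.sq.mul_left (continuousOn_gaussian (a := a))).integrable_rpow_mul_slice (b := -a) (by linarith) ht)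
  refine h1.congr ?_
  filter_upwards [ae_halfSlab 0] with q hq
  rw [hJ.gradN_wgt (p := (q.1, q.2, t)) ⟨hq, ht⟩]
  simp only [Pi.add_apply]

theorem JetExt.pd_zero (hJ : JetExt a τ T W gX gt gφ gf) (v : EuclideanSpace ℝ (Fin n) × ℝ × ℝ) :
    ∀ p ∈ openRegion n, p ∉ supportSet n τ → pd W v p = 0 :=
  pd_eq_zero (fun p hp => hJ.W_nice.zero p (le_of_lt hp.1) hp.2) v

theorem continuousOn_wgt : ContinuousOn (wgt a) {p : EuclideanSpace ℝ (Fin n) × ℝ × ℝ | 0 < p.2.1 ∧ 0 < p.2.2 ∧ p.2.2 < T} := by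
  refine ContinuousOn.mul (ContinuousOn.rpow_const (by fun_prop) fun p hp => Or.inl hp.1.ne') ?_
  exact continuousOn_gaussian.mono fun p hp => ⟨hp.1.le, hp.2⟩

theorem continuousOn_drift (j : Option (Fin n)) :
    ContinuousOn (drift a j) {p : EuclideanSpace ℝ (Fin n) × ℝ × ℝ | 0 < p.2.1 ∧ 0 < p.2.2 ∧ p.2.2 < T} := by
  have h1 : ∀ p ∈ {p : EuclideanSpace ℝ (Fin n) × ℝ × ℝ | 0 < p.2.1 ∧ 0 < p.2.2 ∧ p.2.2 < T}, 2 * p.2.2 ≠ 0 :=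
    fun p hp => (mul_pos two_pos hp.2.1).ne'
  cases j
  · exact ContinuousOn.add (ContinuousOn.div (by simp only [coord]; fun_prop) (by fun_prop) h1)
      (ContinuousOn.div (by fun_prop) (by fun_prop) fun p hp => hp.1.ne')
  · exact ContinuousOn.add (ContinuousOn.div (by simp only [coord]; fun_prop) (by fun_prop) h1) continuousOn_const

theorem continuous_coord (j : Option (Fin n)) : Continuous (coord j) := by
  cases j <;> simp only [coord] <;> fun_prop

variable {α : ℝ} {κ γ θ : ℝ → ℝ}

theorem IsTimeWeight.κ_cont (hκ : IsTimeWeight T α κ γ θ) : ContinuousOn κ (Ioo 0 T) :=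
  fun t ht => (hκ.κ_deriv t ht).continuousAt.continuousWithinAt

theorem IsTimeWeight.γ_cont (hκ : IsTimeWeight T α κ γ θ) : ContinuousOn γ (Ioo 0 T) :=
  fun t ht => (hκ.γ_deriv t ht).continuousAt.continuousWithinAt

/-- Continuity is claimed for y > 0 only: the derivatives of the fluxes contain second derivatives
of w, about which nothing is assumed separately at y = 0. -/
theorem flux_isInner (hκ : IsTimeWeight T α κ γ θ) (hJ : JetExt a τ T W gX gt gφ gf) (j : Option (Fin n)) :
    IsInner τ T (flux a α κ γ θ W j) ∧ IsInner τ T (fluxD a α κ γ θ W j) ∧ IsInner τ T (fluxT a α κ γ W) ∧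
      IsInner τ T (fluxTD a α κ γ θ W) := by
  set S := {p : EuclideanSpace ℝ (Fin n) × ℝ × ℝ | 0 < p.2.1 ∧ 0 < p.2.2 ∧ p.2.2 < T} with hS
  have hSU : S ⊆ openRegion n := fun p hp => ⟨hp.1, hp.2.1⟩
  have hSc : S ⊆ {p | 0 ≤ p.2.1 ∧ 0 < p.2.2 ∧ p.2.2 < T} := fun p hp => ⟨hp.1.le, hp.2⟩
  have c1 : ContinuousOn (fun p : EuclideanSpace ℝ (Fin n) × ℝ × ℝ => κ p.2.2) S := (continuousOn_time hκ.κ_cont).mono hSc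
  have c2 : ContinuousOn (fun p : EuclideanSpace ℝ (Fin n) × ℝ × ℝ => γ p.2.2) S := (continuousOn_time hκ.γ_cont).mono hSc
  have c3 : ContinuousOn (fun p : EuclideanSpace ℝ (Fin n) × ℝ × ℝ => θ p.2.2) S := (continuousOn_time hκ.θ_cont).mono hSc
  have c4 : ContinuousOn W S := hJ.smooth.continuousOn.mono hSU
  have c5 : ∀ v, ContinuousOn (pd W v) S := fun v => (pd_contDiffOn hJ.smooth v).continuousOn.mono hSU
  have c6 : ∀ v u, ContinuousOn (pd (pd W v) u) S := fun v u =>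
    (pd_contDiffOn (pd_contDiffOn hJ.smooth v) u).continuousOn.mono hSU
  have c7 : ContinuousOn (wgt a) S := continuousOn_wgt
  have c8 : ∀ j, ContinuousOn (drift a j) S := fun j => continuousOn_drift j
  have c9 : ∀ j, ContinuousOn (coord j) S := fun j => (continuous_coord j).continuousOn
  have n1 : ∀ p ∈ S, 2 * p.2.2 ≠ 0 := fun p hp => (mul_pos two_pos hp.2.1).ne'
  have n2 : ∀ p ∈ S, p.2.2 * γ p.2.2 ≠ 0 := fun p hp =>
    (mul_pos hp.2.1 (by linarith [hκ.γ_ge _ hp.2])).ne'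
  have ct : ContinuousOn (fun p : EuclideanSpace ℝ (Fin n) × ℝ × ℝ => p.2.2) S := by fun_prop
  have cN : ContinuousOn (gradN W) S := continuousOn_finsetSum _ fun i _ => (c5 _).pow 2
  have cA : ContinuousOn (advect W) S := (c5 _).add (continuousOn_finsetSum _ fun i _ =>
    ((c9 i).div (by fun_prop) n1).mul (c5 _))
  have cD : ContinuousOn (advectD W j) S := (c6 _ _).add ((continuousOn_finsetSum _ fun i _ =>
    ((c9 i).div (by fun_prop) n1).mul (c6 _ _)).add ((c5 _).div (by fun_prop) n1))
  have cQ : ∀ v, ContinuousOn (fun p => ∑ i, 2 * pd W (dir i) p * pd (pd W (dir i)) v p) S := fun v =>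
    continuousOn_finsetSum _ fun i _ => (continuousOn_const.mul (c5 _)).mul (c6 _ _)
  have cZ : ContinuousOn (fun p => (-∑ i, (1 + coord i p * drift a i p)) / (2 * p.2.2)) S :=
    (continuousOn_finsetSum _ fun i _ => continuousOn_const.add ((c9 _).mul (c8 _))).neg.div (by fun_prop) n1
  have cα : ContinuousOn (fun p : EuclideanSpace ℝ (Fin n) × ℝ × ℝ => α * κ p.2.2 / (2 * p.2.2)) S :=
    (continuousOn_const.mul c1).div (by fun_prop) n1
  have cβ : ContinuousOn (fun p : EuclideanSpace ℝ (Fin n) × ℝ × ℝ => -2 * α * κ p.2.2 / (p.2.2 * γ p.2.2)) S :=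
    (continuousOn_const.mul c1).div (ct.mul c2) n2
  have hWz : ∀ p ∈ openRegion n, p ∉ supportSet n τ → W p = 0 :=
    fun p hp => hJ.W_nice.zero p (le_of_lt hp.1) hp.2
  have z1 := fun v => pd_eq_zero hWz v
  have z2 := fun v u => pd_eq_zero (z1 v) u
  have c5j := c5 (dir j)
  have c5t := c5 tdir
  have c6j := c6 (dir j) (dir j)
  have c8j := c8 j
  have c9j := c9 j
  have cQj := cQ (dir j)
  have cQt := cQ tdir
  have ck2 : ContinuousOn (fun p : EuclideanSpace ℝ (Fin n) × ℝ × ℝ => 2 * (κ p.2.2 * (p.2.2 * γ p.2.2))) S :=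
    continuousOn_const.mul (c1.mul (ct.mul c2))
  have ck : ContinuousOn (fun p : EuclideanSpace ℝ (Fin n) × ℝ × ℝ => κ p.2.2 * γ p.2.2 / 2) S :=
    (c1.mul c2).div_const 2
  have cm : ContinuousOn (fun p : EuclideanSpace ℝ (Fin n) × ℝ × ℝ =>
      2 * κ p.2.2 * (γ p.2.2 * θ p.2.2 / 4 - α)) S :=
    (continuousOn_const.mul c1).mul (((c2.mul c3).div_const 4).sub continuousOn_const)
  have cF := (((ck2.mul (cA.mul c5j)).sub (ck.mul (c9j.mul cN))).add (cα.mul (c9j.mul (c4.pow 2)))).add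
    (cm.mul (c4.mul c5j))
  have cG := ((continuousOn_const (c := α)).mul c1 |>.mul (c4.pow 2)).sub ((c1.mul (ct.mul c2)).mul cN)
  refine ⟨⟨?_, fun p hy ht hs => ?_, hJ.W_nice.lt⟩, ⟨?_, fun p hy ht hs => ?_, hJ.W_nice.lt⟩,
    ⟨?_, fun p hy ht hs => ?_, hJ.W_nice.lt⟩, ⟨?_, fun p hy ht hs => ?_, hJ.W_nice.lt⟩⟩
  · exact cF.mul c7
  · simp [flux, gradN, z1 _ p ⟨hy, ht⟩ hs, hWz p ⟨hy, ht⟩ hs]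
  · exact ((((((ck2.mul ((cD.mul c5j).add (cA.mul c6j))).sub (ck.mul (cN.add (c9j.mul cQj)))).add
      (cα.mul ((c4.pow 2).add (c9j.mul ((continuousOn_const.mul c4).mul c5j))))).add
      (cm.mul ((c5j.mul c5j).add (c4.mul c6j))))).mul c7).add (cF.mul (c8j.mul c7))
  · simp [fluxD, gradN, z1 _ p ⟨hy, ht⟩ hs, hWz p ⟨hy, ht⟩ hs, z2 _ _ p ⟨hy, ht⟩ hs]
  · exact cG.mul c7
  · simp [fluxT, gradN, z1 _ p ⟨hy, ht⟩ hs, hWz p ⟨hy, ht⟩ hs]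
  · exact (((((continuousOn_const.mul cβ).mul (c4.pow 2)).add ((continuousOn_const.mul c1).mul
      ((continuousOn_const.mul c4).mul c5t))).sub (((c1.mul ((c2.mul (continuousOn_const.add c3)).sub
      continuousOn_const)).mul cN).add ((c1.mul (ct.mul c2)).mul cQt))).mul c7).add (cG.mul (cZ.mul c7))
  · simp [fluxTD, gradN, z1 _ p ⟨hy, ht⟩ hs, hWz p ⟨hy, ht⟩ hs]

end

/-! ### The integrated inequality and the limit ε → 0 -/

section
variable {a τ T : ℝ} {W : EuclideanSpace ℝ (Fin n) × ℝ × ℝ → ℝ} {gX : Fin n → EuclideanSpace ℝ (Fin n) × ℝ × ℝ → ℝ}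
  {gt gφ gf : EuclideanSpace ℝ (Fin n) × ℝ × ℝ → ℝ} {α : ℝ} {κ γ θ : ℝ → ℝ}

theorem IsTimeWeight.cont_grad (hκ : IsTimeWeight T α κ γ θ) :
    ContinuousOn (fun t => 1 / 2 * (κ t * γ t * θ t)) (Ioo 0 T) :=
  continuousOn_const.mul ((hκ.κ_cont.mul hκ.γ_cont).mul hκ.θ_cont)

theorem IsTimeWeight.cont_sq (hκ : IsTimeWeight T α κ γ θ) :
    ContinuousOn (fun t => 1 / 4 * (α * κ t * (θ t / t))) (Ioo 0 T) :=
  continuousOn_const.mul ((continuousOn_const.mul hκ.κ_cont).mul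
    (hκ.θ_cont.div continuousOn_id fun _ ht => ht.1.ne'))

theorem IsTimeWeight.cont_op (hκ : IsTimeWeight T α κ γ θ) :
    ContinuousOn (fun t => κ t * (t * γ t)) (Ioo 0 T) :=
  hκ.κ_cont.mul (continuousOn_id.mul hκ.γ_cont)

theorem slab_le {ε c : ℝ} (hε : 0 ≤ ε) : slab n ε c ≤ slab n 0 c := by
  simp only [slab_eq]
  exact Measure.restrict_mono (prod_mono_right (prod_mono_left (Ioi_subset_Ioi hε))) le_rfl

/-- The pointwise inequality integrated over `{y > ε, t > c}`. -/
theorem integrated_carleman (ha : -1 < a) (ha' : a < 1) (hκ : IsTimeWeight T α κ γ θ)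
    (hJ : JetExt a τ T W gX gt gφ gf) {ε c : ℝ} (hε : 0 < ε) (hc : 0 < c) :
    ∫ p, (1 / 2 * (κ p.2.2 * γ p.2.2 * θ p.2.2)) * (gradN W p * wgt a p)
        + (1 / 4 * (α * κ p.2.2 * (θ p.2.2 / p.2.2))) * (W p ^ 2 * wgt a p) ∂slab n ε c ≤
      ∫ p, (κ p.2.2 * (p.2.2 * γ p.2.2)) * (gf p ^ 2 * wgt a p) ∂slab n ε c
      + ∫ q, flux a α κ γ θ W none (q.1, ε, q.2) ∂halfSlab n c
      + ∫ q, fluxT a α κ γ W (q.1, q.2, c) ∂halfSlab n ε := by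
  have hI := fun j => flux_isInner (α := α) (κ := κ) (γ := γ) (θ := θ) hκ hJ j
  have i1 : Integrable (fun p => (1 / 2 * (κ p.2.2 * γ p.2.2 * θ p.2.2)) * (gradN W p * wgt a p)
        + (1 / 4 * (α * κ p.2.2 * (θ p.2.2 / p.2.2))) * (W p ^ 2 * wgt a p)) (slab n ε c) :=
    ((hJ.integrable_gradN ha ha' hκ.cont_grad hc).add
      (JetExt.integrable_sq hJ.W_nice ha hκ.cont_sq hc)).mono_measure (slab_le hε.le)
  have i2 := (JetExt.integrable_sq hJ.gf_nice ha hκ.cont_op hc).mono_measure (slab_le hε.le)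
  have i3 : ∀ j, Integrable (fluxD a α κ γ θ W j) (slab n ε c) := fun j => (hI j).2.1.integrable hε hc
  have i4 : Integrable (fluxTD a α κ γ θ W) (slab n ε c) := (hI none).2.2.2.integrable hε hc
  have i34 : Integrable (fun p => ∑ j, fluxD a α κ γ θ W j p + fluxTD a α κ γ θ W p) (slab n ε c) :=
    (integrable_finsetSum _ fun j _ => i3 j).add i4
  -- The horizontal fluxes have compact support in x and contribute nothing; only the faces y = ε
  -- and t = c do.
  have e1 : ∀ i : Fin n, ∫ p, fluxD a α κ γ θ W (some i) p ∂slab n ε c = 0 := fun i =>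
    (hI (some i)).1.integral_x (hI (some i)).2.1 (fun x y t hy ht _ =>
      HasLineDerivAt.slice_x (flux_hasLineDerivAt hJ.smooth (p := (x, y, t)) ⟨hy, ht⟩ (some i))) hε hc
  have e2 : ∫ p, fluxD a α κ γ θ W none p ∂slab n ε c = -∫ q, flux a α κ γ θ W none (q.1, ε, q.2) ∂halfSlab n c :=
    (hI none).1.integral_y (hI none).2.1 (fun x y t hy ht _ =>
      HasLineDerivAt.hasDerivAt_y (flux_hasLineDerivAt hJ.smooth (p := (x, y, t)) ⟨hy, ht⟩ none)) hε hc
  have e3 : ∫ p, fluxTD a α κ γ θ W p ∂slab n ε c = -∫ q, fluxT a α κ γ W (q.1, q.2, c) ∂halfSlab n ε :=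
    (hI none).2.2.1.integral_time (hI none).2.2.2 (fun x y t hy ht htT =>
      HasLineDerivAt.hasDerivAt_t (fluxT_hasLineDerivAt hκ hJ.smooth (p := (x, y, t)) ⟨hy, ht⟩ htT)) hε hc
  have e4 : ∫ p, ∑ j, fluxD a α κ γ θ W j p ∂slab n ε c
      = -∫ q, flux a α κ γ θ W none (q.1, ε, q.2) ∂halfSlab n c := by
    rw [integral_finsetSum _ fun j _ => i3 j, Fintype.sum_option, e2, Finset.sum_eq_zero fun i _ => e1 i, add_zero]
  have hmono : ∫ p, (∑ j, fluxD a α κ γ θ W j p + fluxTD a α κ γ θ W p)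
      + ((1 / 2 * (κ p.2.2 * γ p.2.2 * θ p.2.2)) * (gradN W p * wgt a p)
        + (1 / 4 * (α * κ p.2.2 * (θ p.2.2 / p.2.2))) * (W p ^ 2 * wgt a p)) ∂slab n ε c
      ≤ ∫ p, (κ p.2.2 * (p.2.2 * γ p.2.2)) * (gf p ^ 2 * wgt a p) ∂slab n ε c := by
    refine integral_mono_ae (i34.add i1) i2 ?_
    filter_upwards [ae_slab ε c] with p hp
    have hpU : p ∈ openRegion n := ⟨hε.trans hp.1, hc.trans hp.2⟩
    -- For t ≥ T the time weights are uncontrolled, but every term carries a factor that vanishes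
    -- there.
    by_cases hT : p.2.2 < T
    · have h := pointwise_carleman (a := a) hκ hJ.smooth hpU hT
      rw [hJ.gf_eq p hpU] at h
      linarith
    · have hs : p ∉ supportSet n τ := fun h => not_lt.2 h.2 (hJ.W_nice.lt.trans_le (not_lt.1 hT))
      have h1 : gradN W p = 0 := by simp [gradN, hJ.pd_zero _ p hpU hs]
      simp only [(hI _).2.1.zero p hpU.1 hpU.2 hs, (hI none).2.2.2.zero p hpU.1 hpU.2 hs, h1,
        hJ.W_nice.zero p (le_of_lt hpU.1) hpU.2 hs, hJ.gf_nice.zero p (le_of_lt hpU.1) hpU.2 hs]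
      simp
  rw [integral_add i34 i1,
    integral_add (integrable_finsetSum _ fun j _ => i3 j) i4, e4, e3] at hmono
  linarith

/-- The extension of the normal flux up to the thin set. -/
noncomputable def fluxExt (a α : ℝ) (κ γ θ : ℝ → ℝ) (W : EuclideanSpace ℝ (Fin n) × ℝ × ℝ → ℝ)
    (gX : Fin n → EuclideanSpace ℝ (Fin n) × ℝ × ℝ → ℝ) (gt gφ : EuclideanSpace ℝ (Fin n) × ℝ × ℝ → ℝ)
    (p : EuclideanSpace ℝ (Fin n) × ℝ × ℝ) : ℝ :=
  gaussian a p.1 p.2.1 p.2.2 *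
    (2 * (κ p.2.2 * (p.2.2 * γ p.2.2)) *
        ((gt p + (∑ i, p.1 i / (2 * p.2.2) * gX i p + p.2.1 ^ (1 - a) / (2 * p.2.2) * gφ p)) * gφ p)
      + -(κ p.2.2 * γ p.2.2 / 2) * (p.2.1 ^ (1 + a) * (∑ i, gX i p ^ 2) + p.2.1 ^ (1 - a) * gφ p ^ 2)
      + α * κ p.2.2 / (2 * p.2.2) * (p.2.1 ^ (1 + a) * W p ^ 2)
      + 2 * κ p.2.2 * (γ p.2.2 * θ p.2.2 / 4 - α) * (W p * gφ p))

/-- After replacing ∂_y w by y^(-a) φ, the only powers of y left are y^(1-a) and y^(1+a), continuous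
up to 0 since |a| < 1. -/
theorem fluxExt_isNice (ha : -1 < a) (ha' : a < 1) (hκ : IsTimeWeight T α κ γ θ)
    (hJ : JetExt a τ T W gX gt gφ gf) : IsNice τ T (fluxExt a α κ γ θ W gX gt gφ) := by
  have hτ := hJ.W_nice.lt
  have c1 := continuousOn_time (n := n) hκ.κ_cont
  have c2 := continuousOn_time (n := n) hκ.γ_cont
  have c3 := continuousOn_time (n := n) hκ.θ_cont
  have cop := continuousOn_time (n := n) hκ.cont_op
  have n1 : ∀ p ∈ {p : EuclideanSpace ℝ (Fin n) × ℝ × ℝ | 0 ≤ p.2.1 ∧ 0 < p.2.2 ∧ p.2.2 < T}, 2 * p.2.2 ≠ 0 :=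
    fun p hp => (mul_pos two_pos hp.2.1).ne'
  have r1 : ∀ b : ℝ, 0 ≤ b → ContinuousOn (fun p : EuclideanSpace ℝ (Fin n) × ℝ × ℝ => p.2.1 ^ b)
      {p | 0 ≤ p.2.1 ∧ 0 < p.2.2 ∧ p.2.2 < T} := fun b hb =>
    ContinuousOn.rpow_const (by fun_prop) fun p hp => Or.inr hb
  have r2 := r1 (1 - a) (by linarith)
  have r3 := r1 (1 + a) (by linarith)
  have nA := hJ.gt_nice.add ((IsNice.sum hτ fun i => (hJ.gX_nice i).mul_left
    (h := fun p => p.1 i / (2 * p.2.2)) (ContinuousOn.div (by fun_prop) (by fun_prop) n1)).add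
    (hJ.gφ_nice.mul_left (h := fun p => p.2.1 ^ (1 - a) / (2 * p.2.2)) (r2.div (by fun_prop) n1)))
  exact (((((nA.mul hJ.gφ_nice).mul_left (continuousOn_const.mul cop)).add
    ((((IsNice.sum hτ fun i => (hJ.gX_nice i).sq).mul_left r3).add (hJ.gφ_nice.sq.mul_left r2)).mul_left
      ((c1.mul c2).div_const 2).neg)).add
    ((hJ.W_nice.sq.mul_left r3).mul_left ((continuousOn_const.mul c1).div (by fun_prop) n1))).add
    ((hJ.W_nice.mul hJ.gφ_nice).mul_left ((continuousOn_const.mul c1).mul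
      (((c2.mul c3).div_const 4).sub continuousOn_const)))).mul_left continuousOn_gaussian

theorem flux_eq_fluxExt (hJ : JetExt a τ T W gX gt gφ gf) {p : EuclideanSpace ℝ (Fin n) × ℝ × ℝ}
    (hp : p ∈ openRegion n) : flux a α κ γ θ W none p = fluxExt a α κ γ θ W gX gt gφ p := by
  have hy : 0 < p.2.1 := hp.1
  have ht : 0 < p.2.2 := hp.2
  have h1 : p.2.1 ^ (1 - a) = p.2.1 * p.2.1 ^ (-a) := by
    rw [sub_eq_add_neg, rpow_add hy, rpow_one]
  have h2 : p.2.1 ^ (1 + a) = p.2.1 * p.2.1 ^ a := by rw [rpow_add hy, rpow_one]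
  have h3 : p.2.1 ^ (-a) * p.2.1 ^ a = 1 := by rw [← rpow_add hy]; simp
  have hA : advect W p = gt p + (∑ i, p.1 i / (2 * p.2.2) * gX i p + p.2.1 ^ (1 - a) / (2 * p.2.2) * gφ p) := by
    rw [advect, Fintype.sum_option, hJ.gt_eq p hp, hJ.pd_none hp, h1,
      Finset.sum_congr rfl fun i _ => by rw [hJ.gX_eq i p hp]]
    simp only [coord]
    ring
  have hN : gradN W p = ∑ i, gX i p ^ 2 + (p.2.1 ^ (-a) * gφ p) ^ 2 := by
    rw [gradN, Fintype.sum_option, hJ.pd_none hp, Finset.sum_congr rfl fun i _ => by rw [hJ.gX_eq i p hp], add_comm]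
  rw [flux, fluxExt, ← hA, hN, hJ.pd_none hp, wgt, h1, h2]
  simp only [coord]
  linear_combination (gaussian a p.1 p.2.1 p.2.2 * (2 * (κ p.2.2 * (p.2.2 * γ p.2.2)) * advect W p * gφ p
    - κ p.2.2 * γ p.2.2 / 2 * p.2.1 * p.2.1 ^ (-a) * gφ p ^ 2
    + 2 * κ p.2.2 * (γ p.2.2 * θ p.2.2 / 4 - α) * W p * gφ p)) * h3

theorem integral_flux_eq (hJ : JetExt a τ T W gX gt gφ gf) {ε c : ℝ} (hε : 0 < ε) (hc : 0 < c) :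
    ∫ q, flux a α κ γ θ W none (q.1, ε, q.2) ∂halfSlab n c
      = ∫ q, fluxExt a α κ γ θ W gX gt gφ (q.1, ε, q.2) ∂halfSlab n c := by
  refine integral_congr_ae ?_
  filter_upwards [ae_halfSlab c] with q hq
  exact flux_eq_fluxExt hJ (p := (q.1, ε, q.2)) ⟨hε, hc.trans hq⟩

/-- The integrated inequality up to the thin set. -/
theorem carleman_with_boundary (ha : -1 < a) (ha' : a < 1) (hκ : IsTimeWeight T α κ γ θ)
    (hJ : JetExt a τ T W gX gt gφ gf) {c : ℝ} (hc : 0 < c) :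
    ∫ p, (1 / 2 * (κ p.2.2 * γ p.2.2 * θ p.2.2)) * (gradN W p * wgt a p)
        + (1 / 4 * (α * κ p.2.2 * (θ p.2.2 / p.2.2))) * (W p ^ 2 * wgt a p) ∂slab n 0 c ≤
      ∫ p, (κ p.2.2 * (p.2.2 * γ p.2.2)) * (gf p ^ 2 * wgt a p) ∂slab n 0 c
      + ∫ q, fluxExt a α κ γ θ W gX gt gφ (q.1, 0, q.2) ∂halfSlab n c
      + ∫ q, fluxT a α κ γ W (q.1, q.2, c) ∂halfSlab n 0 := by
  have i1 := (hJ.integrable_gradN ha ha' hκ.cont_grad hc).add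
    (JetExt.integrable_sq hJ.W_nice ha hκ.cont_sq hc)
  have i2 := JetExt.integrable_sq hJ.gf_nice ha hκ.cont_op hc
  have i3 : Integrable (fun q : EuclideanSpace ℝ (Fin n) × ℝ => fluxT a α κ γ W (q.1, q.2, c)) (halfSlab n 0) := by
    refine (((JetExt.integrable_sq_slice hJ.W_nice ha hc).const_mul (α * κ c)).sub
      ((hJ.integrable_gradN_slice ha ha' hc).const_mul (κ c * (c * γ c)))).congr (Eventually.of_forall fun q => ?_)
    simp only [fluxT, Pi.sub_apply]
    ring
  -- The limit is taken along ε = 1/(k+1): bulk integrals by exhaustion, the flux through y = ε by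
  -- dominated convergence to its value on the thin set.
  refine le_of_tendsto_of_tendsto' (tendsto_integral_slab i1) (((tendsto_integral_slab i2).add
    ((fluxExt_isNice ha ha' hκ hJ).tendsto_slice hc |>.comp tendsto_one_div_nat_nhdsGT)).add
    (tendsto_integral_halfSlab i3)) fun k => ?_
  have hk : (0 : ℝ) < 1 / (k + 1) := by positivity
  have h := integrated_carleman ha ha' hκ hJ hk hc
  rw [integral_flux_eq hJ hk hc] at h
  exact h

end

/-! ### The Neumann condition and integration by parts on the thin set -/

/-- A potential on `ℝⁿ × (0, T)` with continuous first derivatives. -/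
structure IsPotential (T : ℝ) (Q Qt : EuclideanSpace ℝ (Fin n) → ℝ → ℝ)
    (Qx : Fin n → EuclideanSpace ℝ (Fin n) → ℝ → ℝ) : Prop where
  cont : ContinuousOn (fun z : EuclideanSpace ℝ (Fin n) × ℝ => Q z.1 z.2) (univ ×ˢ Ioo 0 T)
  cont_t : ContinuousOn (fun z : EuclideanSpace ℝ (Fin n) × ℝ => Qt z.1 z.2) (univ ×ˢ Ioo 0 T)
  cont_x : ∀ i, ContinuousOn (fun z : EuclideanSpace ℝ (Fin n) × ℝ => Qx i z.1 z.2) (univ ×ˢ Ioo 0 T)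
  deriv_t : ∀ x, ∀ t ∈ Ioo 0 T, HasDerivAt (fun r => Q x r) (Qt x t) t
  deriv_x : ∀ i x, ∀ t ∈ Ioo 0 T, HasLineDerivAt ℝ (fun z => Q z t) (Qx i x t) x (EuclideanSpace.single i 1)

/-- Obtained from the derivative of y^a G by multiplying with the constant y^(-a). -/
theorem gaussian_hasDerivAt_t {a y t : ℝ} (x : EuclideanSpace ℝ (Fin n)) (hy : 0 < y) (ht : 0 < t) :
    HasDerivAt (fun r => gaussian a x y r)
      (-((n + 1 + a) - normSq x y / (2 * t)) / (2 * t) * gaussian a x y t) t := by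
  have hp : (x, y, t) ∈ openRegion n := ⟨hy, ht⟩
  have h := (HasLineDerivAt.hasDerivAt_t (wgt_hasLineDerivAt_t (a := a) hp)).const_mul (y ^ (-a))
  rw [sum_coord_drift hp] at h
  have h3 : y ^ (-a) * y ^ a = 1 := by rw [← rpow_add hy]; simp
  refine (h.congr_of_eventuallyEq (Eventually.of_forall fun r => ?_)).congr_deriv ?_
  · simp only [wgt]; rw [← mul_assoc, h3, one_mul]
  · simp only [wgt]
    linear_combination (-((n + 1 + a) - normSq x y / (2 * t)) / (2 * t) * gaussian a x y t) * h3

theorem gaussian_hasLineDerivAt_x {a y t : ℝ} (x : EuclideanSpace ℝ (Fin n)) (hy : 0 < y) (ht : 0 < t) (i : Fin n) :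
    HasLineDerivAt ℝ (fun z => gaussian a z y t) (-x i / (2 * t) * gaussian a x y t) x
      (EuclideanSpace.single i (1 : ℝ)) := by
  have hp : (x, y, t) ∈ openRegion n := ⟨hy, ht⟩
  have h : HasDerivAt _ _ _ := (HasLineDerivAt.slice_x (wgt_hasLineDerivAt (a := a) hp (some i)))
  have h := h.const_mul (y ^ (-a))
  have h3 : y ^ (-a) * y ^ a = 1 := by rw [← rpow_add hy]; simp
  unfold HasLineDerivAt
  refine (h.congr_of_eventuallyEq (Eventually.of_forall fun r => ?_)).congr_deriv ?_
  · simp only [wgt]; rw [← mul_assoc, h3, one_mul]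
  · simp only [wgt, drift, coord, add_zero]
    linear_combination (-x i / (2 * t) * gaussian a x y t) * h3

theorem coord_slice_hasLineDerivAt (x : EuclideanSpace ℝ (Fin n)) (i : Fin n) :
    HasLineDerivAt ℝ (fun z : EuclideanSpace ℝ (Fin n) => z i) 1 x (EuclideanSpace.single i (1 : ℝ)) := by
  have h := HasLineDerivAt.slice_x (coord_hasLineDerivAt (some i) (x, 0, 0) (some i))
  simpa [coord] using h

section
variable {a τ T : ℝ} {W : EuclideanSpace ℝ (Fin n) × ℝ × ℝ → ℝ} {gX : Fin n → EuclideanSpace ℝ (Fin n) × ℝ × ℝ → ℝ}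
  {gt gφ gf : EuclideanSpace ℝ (Fin n) × ℝ × ℝ → ℝ} {α : ℝ} {κ γ θ : ℝ → ℝ}
  {Q Qt : EuclideanSpace ℝ (Fin n) → ℝ → ℝ} {Qx : Fin n → EuclideanSpace ℝ (Fin n) → ℝ → ℝ}

/-- The density of the boundary integral left after integrating by parts on the thin set. -/
noncomputable def thinDensity (a : ℝ) (κ γ θ : ℝ → ℝ) (W : EuclideanSpace ℝ (Fin n) × ℝ × ℝ → ℝ)
    (Q Qt : EuclideanSpace ℝ (Fin n) → ℝ → ℝ) (Qx : Fin n → EuclideanSpace ℝ (Fin n) → ℝ → ℝ)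
    (p : EuclideanSpace ℝ (Fin n) × ℝ × ℝ) : ℝ :=
  κ p.2.2 * γ p.2.2 * (((1 - a) / 2 + θ p.2.2 / 2 + p.2.1 ^ 2 / (4 * p.2.2)) * Q p.1 p.2.2
      + (p.2.2 * Qt p.1 p.2.2 + (∑ i, p.1 i * Qx i p.1 p.2.2) / 2))
    * (gaussian a p.1 p.2.1 p.2.2 * W p ^ 2)

theorem continuousOn_potential {F : EuclideanSpace ℝ (Fin n) → ℝ → ℝ}
    (hF : ContinuousOn (fun z : EuclideanSpace ℝ (Fin n) × ℝ => F z.1 z.2) (univ ×ˢ Ioo 0 T)) :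
    ContinuousOn (fun p : EuclideanSpace ℝ (Fin n) × ℝ × ℝ => F p.1 p.2.2)
      {p | 0 ≤ p.2.1 ∧ 0 < p.2.2 ∧ p.2.2 < T} :=
  hF.comp (f := fun p : EuclideanSpace ℝ (Fin n) × ℝ × ℝ => (p.1, p.2.2)) (by fun_prop) fun _ hp => ⟨mem_univ _, hp.2⟩

theorem continuousOn_thin_coeff (hκ : IsTimeWeight T α κ γ θ) (hQ : IsPotential T Q Qt Qx) :
    ContinuousOn (fun p : EuclideanSpace ℝ (Fin n) × ℝ × ℝ =>
      κ p.2.2 * γ p.2.2 * (((1 - a) / 2 + θ p.2.2 / 2 + p.2.1 ^ 2 / (4 * p.2.2)) * Q p.1 p.2.2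
      + (p.2.2 * Qt p.1 p.2.2 + (∑ i, p.1 i * Qx i p.1 p.2.2) / 2)))
      {p | 0 ≤ p.2.1 ∧ 0 < p.2.2 ∧ p.2.2 < T} := by
  have c1 := continuousOn_time (n := n) hκ.κ_cont
  have c2 := continuousOn_time (n := n) hκ.γ_cont
  have c3 := continuousOn_time (n := n) hκ.θ_cont
  have ct : ContinuousOn (fun p : EuclideanSpace ℝ (Fin n) × ℝ × ℝ => p.2.2)
    {p | 0 ≤ p.2.1 ∧ 0 < p.2.2 ∧ p.2.2 < T} := by fun_prop
  refine (c1.mul c2).mul ((((continuousOn_const.add (c3.div_const 2)).add (ContinuousOn.div (by fun_prop)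
    (by fun_prop) fun p hp => (mul_pos four_pos hp.2.1).ne')).mul (continuousOn_potential hQ.cont)).add
    ((ct.mul (continuousOn_potential hQ.cont_t)).add ((continuousOn_finsetSum _ fun i _ =>
      ContinuousOn.mul (by fun_prop) (continuousOn_potential (hQ.cont_x i))).div_const 2)))

theorem thinDensity_isNice (hκ : IsTimeWeight T α κ γ θ) (hQ : IsPotential T Q Qt Qx) (hW : IsNice τ T W) :
    IsNice τ T (thinDensity a κ γ θ W Q Qt Qx) :=
  (hW.sq.mul_left continuousOn_gaussian).mul_left (continuousOn_thin_coeff hκ hQ)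

/-- The trace of the normal flux once the boundary condition is used, continued to `y > 0`. -/
noncomputable def thinFlux (a α : ℝ) (κ γ θ : ℝ → ℝ) (W : EuclideanSpace ℝ (Fin n) × ℝ × ℝ → ℝ)
    (gX : Fin n → EuclideanSpace ℝ (Fin n) × ℝ × ℝ → ℝ) (gt : EuclideanSpace ℝ (Fin n) × ℝ × ℝ → ℝ)
    (Q : EuclideanSpace ℝ (Fin n) → ℝ → ℝ) (p : EuclideanSpace ℝ (Fin n) × ℝ × ℝ) : ℝ :=
  gaussian a p.1 p.2.1 p.2.2 * (Q p.1 p.2.2 * (2 * (κ p.2.2 * (p.2.2 * γ p.2.2)) *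
        ((gt p + ∑ i, p.1 i / (2 * p.2.2) * gX i p) * W p)
      + 2 * κ p.2.2 * (γ p.2.2 * θ p.2.2 / 4 - α) * W p ^ 2))

theorem thinFlux_isNice (hκ : IsTimeWeight T α κ γ θ) (hQ : IsPotential T Q Qt Qx)
    (hJ : JetExt a τ T W gX gt gφ gf) : IsNice τ T (thinFlux a α κ γ θ W gX gt Q) := by
  have hτ := hJ.W_nice.lt
  have c1 := continuousOn_time (n := n) hκ.κ_cont
  have c2 := continuousOn_time (n := n) hκ.γ_cont
  have c3 := continuousOn_time (n := n) hκ.θ_cont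
  have cop := continuousOn_time (n := n) hκ.cont_op
  have n1 : ∀ p ∈ {p : EuclideanSpace ℝ (Fin n) × ℝ × ℝ | 0 ≤ p.2.1 ∧ 0 < p.2.2 ∧ p.2.2 < T}, 2 * p.2.2 ≠ 0 :=
    fun p hp => (mul_pos two_pos hp.2.1).ne'
  have nA := hJ.gt_nice.add (IsNice.sum hτ fun i => (hJ.gX_nice i).mul_left
    (h := fun p => p.1 i / (2 * p.2.2)) (ContinuousOn.div (by fun_prop) (by fun_prop) n1))
  exact ((((nA.mul hJ.W_nice).mul_left (continuousOn_const.mul cop)).add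
    (hJ.W_nice.sq.mul_left ((continuousOn_const.mul c1).mul
      (((c2.mul c3).div_const 4).sub continuousOn_const)))).mul_left
      (continuousOn_potential hQ.cont)).mul_left continuousOn_gaussian

/-- All terms with a factor y^(1-a) or y^(1+a) die at y = 0, and every surviving term contains φ,
hence the factor Q W. -/
theorem fluxExt_eq_thinFlux (ha : -1 < a) (ha' : a < 1) {x : EuclideanSpace ℝ (Fin n)} {t : ℝ}
    (h : gφ (x, 0, t) = Q x t * W (x, 0, t)) :
    fluxExt a α κ γ θ W gX gt gφ (x, 0, t) = thinFlux a α κ γ θ W gX gt Q (x, 0, t) := by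
  simp only [fluxExt, thinFlux, h, Real.zero_rpow (show 1 - a ≠ 0 by linarith),
    Real.zero_rpow (show 1 + a ≠ 0 by linarith)]
  ring

/-- The integrand of `thinFlux` contains κtγ Q (∂_t + x/(2t)·∇_x)(W²) G. Moving the derivatives off
W² makes (κtγ)' produce +2ακ Q W² G, which cancels the -2ακ Q W² G already present, so `thinDensity`
does not contain α. In n dimensions G is not exactly transported: ∂_t G + div_x(xG)/(2t) equals
-(1+a)/(2t) + y²/(4t²) times G, the source of the coefficient (1-a)/2 and of the y² term. The
computation is done at y > 0, where the traces are genuine derivatives of W. -/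
theorem thinFlux_integral_slice (hκ : IsTimeWeight T α κ γ θ) (hQ : IsPotential T Q Qt Qx)
    (hJ : JetExt a τ T W gX gt gφ gf) {y c : ℝ} (hy : 0 < y) (hc : 0 < c) :
    ∫ q, thinFlux a α κ γ θ W gX gt Q (q.1, y, q.2) ∂halfSlab n c
      + ∫ q, thinDensity a κ γ θ W Q Qt Qx (q.1, y, q.2) ∂halfSlab n c
      = -∫ x, κ c * (c * γ c) * (Q x c * (gaussian a x y c * W (x, y, c) ^ 2)) := by
  have hτ := hJ.W_nice.lt
  have c1 := continuousOn_time (n := n) hκ.κ_cont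
  have c2 := continuousOn_time (n := n) hκ.γ_cont
  have c3 := continuousOn_time (n := n) hκ.θ_cont
  have cop := continuousOn_time (n := n) hκ.cont_op
  have cQ := continuousOn_potential (n := n) hQ.cont
  have cQt := continuousOn_potential (n := n) hQ.cont_t
  have cQx := fun i => continuousOn_potential (n := n) (hQ.cont_x i)
  have cG := continuousOn_gaussian (n := n) (a := a) (T := T)
  have ct : ContinuousOn (fun p : EuclideanSpace ℝ (Fin n) × ℝ × ℝ => p.2.2)
    {p | 0 ≤ p.2.1 ∧ 0 < p.2.2 ∧ p.2.2 < T} := by fun_prop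
  have cX : ∀ i, ContinuousOn (fun p : EuclideanSpace ℝ (Fin n) × ℝ × ℝ => p.1 i)
    {p | 0 ≤ p.2.1 ∧ 0 < p.2.2 ∧ p.2.2 < T} := fun i => by fun_prop
  have n1 : ∀ p ∈ {p : EuclideanSpace ℝ (Fin n) × ℝ × ℝ | 0 ≤ p.2.1 ∧ 0 < p.2.2 ∧ p.2.2 < T}, 2 * p.2.2 ≠ 0 :=
    fun p hp => (mul_pos two_pos hp.2.1).ne'
  have nW := hJ.W_nice.sq.mul_left cG
  set F : EuclideanSpace ℝ (Fin n) × ℝ × ℝ → ℝ := fun p =>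
    κ p.2.2 * (p.2.2 * γ p.2.2) * (Q p.1 p.2.2 * (gaussian a p.1 p.2.1 p.2.2 * W p ^ 2)) with hF
  set F' : EuclideanSpace ℝ (Fin n) × ℝ × ℝ → ℝ := fun p =>
    κ p.2.2 * (γ p.2.2 * (1 + θ p.2.2) - 2 * α) * (Q p.1 p.2.2 * (gaussian a p.1 p.2.1 p.2.2 * W p ^ 2))
    + κ p.2.2 * (p.2.2 * γ p.2.2) * (Qt p.1 p.2.2 * (gaussian a p.1 p.2.1 p.2.2 * W p ^ 2)
      + Q p.1 p.2.2 * (-((n + 1 + a) - normSq p.1 p.2.1 / (2 * p.2.2)) / (2 * p.2.2) *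
          (gaussian a p.1 p.2.1 p.2.2 * W p ^ 2)
        + gaussian a p.1 p.2.1 p.2.2 * (2 * W p * gt p))) with hF'
  -- These are x_i/(2t) times the time flux `F`, so (Z, F) is the flux of the field ∂_t +
  -- x/(2t)·∇_x.
  set Z : Fin n → EuclideanSpace ℝ (Fin n) × ℝ × ℝ → ℝ := fun i p =>
    κ p.2.2 * γ p.2.2 / 2 * (p.1 i * (Q p.1 p.2.2 * (gaussian a p.1 p.2.1 p.2.2 * W p ^ 2))) with hZ
  set Z' : Fin n → EuclideanSpace ℝ (Fin n) × ℝ × ℝ → ℝ := fun i p =>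
    κ p.2.2 * γ p.2.2 / 2 * (Q p.1 p.2.2 * (gaussian a p.1 p.2.1 p.2.2 * W p ^ 2)
      + p.1 i * (Qx i p.1 p.2.2 * (gaussian a p.1 p.2.1 p.2.2 * W p ^ 2)
      + Q p.1 p.2.2 * (-p.1 i / (2 * p.2.2) * (gaussian a p.1 p.2.1 p.2.2 * W p ^ 2)
        + gaussian a p.1 p.2.1 p.2.2 * (2 * W p * gX i p)))) with hZ'
  have nF : IsNice τ T F := (nW.mul_left cQ).mul_left cop
  have nWt : ∀ g, IsNice τ T g → IsNice τ T fun p => gaussian a p.1 p.2.1 p.2.2 * (2 * W p * g p) := fun g hg =>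
    (hg.mul_left (continuousOn_const.mul hJ.W_nice.cont)).mul_left cG
  have cN : ContinuousOn (fun p : EuclideanSpace ℝ (Fin n) × ℝ × ℝ =>
      -((n + 1 + a) - normSq p.1 p.2.1 / (2 * p.2.2)) / (2 * p.2.2)) {p | 0 ≤ p.2.1 ∧ 0 < p.2.2 ∧ p.2.2 < T} := by
    unfold normSq
    exact (continuousOn_const.sub (ContinuousOn.div (by fun_prop) (by fun_prop) n1)).neg.div (by fun_prop) n1
  have nF' : IsNice τ T F' := ((nW.mul_left cQ).mul_left (c1.mul ((c2.mul (continuousOn_const.add c3)).sub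
    continuousOn_const))).add (((nW.mul_left cQt).add (((nW.mul_left cN).add (nWt gt hJ.gt_nice)).mul_left cQ)).mul_left cop)
  have nZ : ∀ i, IsNice τ T (Z i) := fun i => ((nW.mul_left cQ).mul_left (cX i)).mul_left ((c1.mul c2).div_const 2)
  have nZ' : ∀ i, IsNice τ T (Z' i) := fun i => ((nW.mul_left cQ).add (((nW.mul_left (cQx i)).add
    (((nW.mul_left ((cX i).neg.div (by fun_prop) n1)).add (nWt _ (hJ.gX_nice i))).mul_left cQ)).mul_left
    (cX i))).mul_left ((c1.mul c2).div_const 2)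
  have dF : ∀ x y t, 0 < y → 0 < t → t < T → HasDerivAt (fun r => F (x, y, r)) (F' (x, y, t)) t := by
    intro x y t hy ht hT
    have htT : t ∈ Ioo 0 T := ⟨ht, hT⟩
    have hW := HasLineDerivAt.hasDerivAt_t (pd_hasLineDerivAt hJ.smooth (p := (x, y, t)) ⟨hy, ht⟩ tdir)
    rw [hJ.gt_eq _ ⟨hy, ht⟩] at hW
    have hg1 : γ t ≠ 0 := by linarith [hκ.γ_ge _ htT]
    have h := ((hκ.κ_deriv t htT).mul ((hasDerivAt_id t).mul (hκ.γ_deriv t htT))).mul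
      ((hQ.deriv_t x t htT).mul ((gaussian_hasDerivAt_t (a := a) x hy ht).mul (hW.pow 2)))
    refine h.congr_deriv ?_
    simp only [hF', Pi.mul_apply, Pi.pow_apply, id]
    push_cast
    field_simp
    ring
  have dZ : ∀ i, ∀ x y t, 0 < y → 0 < t → t < T →
      HasLineDerivAt ℝ (fun z => Z i (z, y, t)) (Z' i (x, y, t)) x (EuclideanSpace.single i (1 : ℝ)) := by
    intro i x y t hy ht hT
    have htT : t ∈ Ioo 0 T := ⟨ht, hT⟩
    have hW := HasLineDerivAt.slice_x (pd_hasLineDerivAt hJ.smooth (p := (x, y, t)) ⟨hy, ht⟩ (dir (some i)))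
    rw [hJ.gX_eq _ _ ⟨hy, ht⟩] at hW
    have hx := coord_slice_hasLineDerivAt x i
    have hq := hQ.deriv_x i x t htT
    have hg := gaussian_hasLineDerivAt_x (a := a) x hy ht i
    unfold HasLineDerivAt at *
    refine ((hx.mul (hq.mul (hg.mul (hW.pow 2)))).const_mul (κ t * γ t / 2)).congr_deriv ?_
    simp only [hZ', Pi.mul_apply, Pi.pow_apply, zero_smul, add_zero]
    push_cast
    ring
  have eF := nF.isInner.integral_time_slice nF'.isInner dF hy hc
  have eZ : ∀ i, ∫ q, Z' i (q.1, y, q.2) ∂halfSlab n c = 0 := fun i =>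
    (nZ i).isInner.integral_x_slice (nZ' i).isInner (dZ i) hy hc
  have iF := nF'.integrable_slice hy.le hc
  have iZ := fun i => (nZ' i).integrable_slice hy.le hc
  have i1 := (thinFlux_isNice hκ hQ hJ).integrable_slice hy.le hc
  have i2 := (thinDensity_isNice (a := a) hκ hQ hJ.W_nice).integrable_slice hy.le hc
  have hsum : ∫ q, (F' (q.1, y, q.2) + ∑ i, Z' i (q.1, y, q.2)) ∂halfSlab n c = -∫ x, F (x, y, c) := by
    rw [integral_add iF (integrable_finsetSum _ fun i _ => iZ i), integral_finsetSum _ fun i _ => iZ i, eF,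
      Finset.sum_eq_zero fun i _ => eZ i, add_zero]
  rw [← integral_add i1 i2, ← hsum]
  refine integral_congr_ae ?_
  filter_upwards [ae_halfSlab c] with q hq
  have ht : 0 < q.2 := hc.trans hq
  simp only [hF', hZ', thinFlux, thinDensity, normSq, EuclideanSpace.real_norm_sq_eq]
  set G := gaussian a q.1 y q.2
  set w := W (q.1, y, q.2)
  have e1 : ∀ i, κ q.2 * γ q.2 / 2 * (Q q.1 q.2 * (G * w ^ 2) + q.1 i * (Qx i q.1 q.2 * (G * w ^ 2)
      + Q q.1 q.2 * (-q.1 i / (2 * q.2) * (G * w ^ 2) + G * (2 * w * gX i (q.1, y, q.2)))))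
      = κ q.2 * γ q.2 / 2 * (G * w ^ 2) * Q q.1 q.2 + κ q.2 * γ q.2 / 2 * (G * w ^ 2) * (q.1 i * Qx i q.1 q.2)
        - κ q.2 * γ q.2 / (4 * q.2) * (G * w ^ 2) * Q q.1 q.2 * q.1 i ^ 2
        + 2 * (κ q.2 * (q.2 * γ q.2)) * G * w * Q q.1 q.2 * (q.1 i / (2 * q.2) * gX i (q.1, y, q.2)) := by
    intro i
    field_simp
    ring
  rw [Finset.sum_congr rfl fun i _ => e1 i, Finset.sum_add_distrib, Finset.sum_sub_distrib, Finset.sum_add_distrib,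
    Finset.sum_const, Finset.card_univ, Fintype.card_fin, nsmul_eq_mul, ← Finset.mul_sum, ← Finset.mul_sum,
    ← Finset.mul_sum]
  generalize ∑ i, q.1 i * Qx i q.1 q.2 = S1
  generalize ∑ i, q.1 i / (2 * q.2) * gX i (q.1, y, q.2) = S2
  generalize ∑ i, q.1 i ^ 2 = S3
  field_simp
  ring

/-- The boundary flux on the thin set, integrated by parts. -/
theorem integral_fluxExt_eq (ha : -1 < a) (ha' : a < 1) (hκ : IsTimeWeight T α κ γ θ) (hQ : IsPotential T Q Qt Qx)
    (hJ : JetExt a τ T W gX gt gφ gf) (hb : ∀ x t, 0 < t → t < T → gφ (x, 0, t) = Q x t * W (x, 0, t))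
    {c : ℝ} (hc : c ∈ Ioo 0 T) :
    ∫ q, fluxExt a α κ γ θ W gX gt gφ (q.1, 0, q.2) ∂halfSlab n c
      = -(∫ x, κ c * (c * γ c) * (Q x c * (gaussian a x 0 c * W (x, 0, c) ^ 2)))
        - ∫ q, thinDensity a κ γ θ W Q Qt Qx (q.1, 0, q.2) ∂halfSlab n c := by
  have e1 : ∫ q, fluxExt a α κ γ θ W gX gt gφ (q.1, 0, q.2) ∂halfSlab n c
      = ∫ q, thinFlux a α κ γ θ W gX gt Q (q.1, 0, q.2) ∂halfSlab n c := by
    refine integral_congr_ae ?_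
    filter_upwards [ae_halfSlab c] with q hq
    have ht : 0 < q.2 := hc.1.trans hq
    by_cases hT : q.2 < T
    · exact fluxExt_eq_thinFlux ha ha' (hb _ _ ht hT)
    · have hs : (q.1, (0 : ℝ), q.2) ∉ supportSet n τ := fun h => not_lt.2 h.2 (hJ.W_nice.lt.trans_le (not_lt.1 hT))
      rw [(fluxExt_isNice ha ha' hκ hJ).zero _ le_rfl ht hs, (thinFlux_isNice hκ hQ hJ).zero _ le_rfl ht hs]
  have nF : IsNice τ T fun p : EuclideanSpace ℝ (Fin n) × ℝ × ℝ =>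
      κ p.2.2 * (p.2.2 * γ p.2.2) * (Q p.1 p.2.2 * (gaussian a p.1 p.2.1 p.2.2 * W p ^ 2)) :=
    ((hJ.W_nice.sq.mul_left continuousOn_gaussian).mul_left (continuousOn_potential hQ.cont)).mul_left
      (continuousOn_time hκ.cont_op)
  have h1 := ((thinFlux_isNice hκ hQ hJ).tendsto_slice hc.1).add
    ((thinDensity_isNice (a := a) hκ hQ hJ.W_nice).tendsto_slice hc.1)
  have h2 := (nF.tendsto_bottom hc.1).neg
  -- The identity valid at each height y > 0 passes to y → 0, since all three integrals are
  -- continuous there.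
  have h3 := tendsto_nhds_unique h1 (h2.congr' (by
    filter_upwards [self_mem_nhdsWithin] with y hy
    exact (thinFlux_integral_slice hκ hQ hJ hy hc.1).symm))
  rw [e1]
  linarith

end

/-! ### Gaussian Hardy and trace inequalities -/

theorem integral_const_mul_add_add {X : Type*} [MeasurableSpace X] {μ : Measure X} {f g h : X → ℝ}
    (hf : Integrable f μ) (hg : Integrable g μ) (hh : Integrable h μ) (p q r : ℝ) :
    ∫ x, (p * f x + q * g x + r * h x) ∂μ = p * (∫ x, f x ∂μ) + q * (∫ x, g x ∂μ) + r * ∫ x, h x ∂μ := by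
  rw [← integral_const_mul, ← integral_const_mul, ← integral_const_mul,
    ← integral_add (hf.const_mul p) (hg.const_mul q)]
  exact integral_add ((hf.const_mul p).add (hg.const_mul q)) (hh.const_mul r)

section
variable {a τ T : ℝ} {W : EuclideanSpace ℝ (Fin n) × ℝ × ℝ → ℝ} {gX : Fin n → EuclideanSpace ℝ (Fin n) × ℝ × ℝ → ℝ}
  {gt gφ gf : EuclideanSpace ℝ (Fin n) × ℝ × ℝ → ℝ}

theorem continuousOn_normSq_div : ContinuousOn (fun p : EuclideanSpace ℝ (Fin n) × ℝ × ℝ => ‖p.1‖ ^ 2 / p.2.2)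
    {p | 0 ≤ p.2.1 ∧ 0 < p.2.2 ∧ p.2.2 < T} :=
  ContinuousOn.div (by fun_prop) (by fun_prop) fun _ hp => hp.2.1.ne'

/-- Hardy's inequality with Gaussian weight on a slice `y = const`, `t = const`. -/
theorem hardy_slice (hJ : JetExt a τ T W gX gt gφ gf) {y t : ℝ} (hy : 0 < y) (ht : 0 < t) :
    ∫ x, ‖x‖ ^ 2 / t * (gaussian a x y t * W (x, y, t) ^ 2)
      ≤ 4 * n * (∫ x, gaussian a x y t * W (x, y, t) ^ 2)
        + 16 * t * ∫ x, gaussian a x y t * ∑ i, gX i (x, y, t) ^ 2 := by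
  have hτ := hJ.W_nice.lt
  have cG := continuousOn_gaussian (n := n) (a := a) (T := T)
  have cX : ∀ i, ContinuousOn (fun p : EuclideanSpace ℝ (Fin n) × ℝ × ℝ => p.1 i)
    {p | 0 ≤ p.2.1 ∧ 0 < p.2.2 ∧ p.2.2 < T} := fun i => by fun_prop
  have n1 : ∀ p ∈ {p : EuclideanSpace ℝ (Fin n) × ℝ × ℝ | 0 ≤ p.2.1 ∧ 0 < p.2.2 ∧ p.2.2 < T}, 2 * p.2.2 ≠ 0 :=
    fun p hp => (mul_pos two_pos hp.2.1).ne'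
  have nW := hJ.W_nice.sq.mul_left cG
  set Z : Fin n → EuclideanSpace ℝ (Fin n) × ℝ × ℝ → ℝ := fun i p =>
    p.1 i * (gaussian a p.1 p.2.1 p.2.2 * W p ^ 2) with hZ
  set Z' : Fin n → EuclideanSpace ℝ (Fin n) × ℝ × ℝ → ℝ := fun i p =>
    gaussian a p.1 p.2.1 p.2.2 * W p ^ 2
      + p.1 i * (-p.1 i / (2 * p.2.2) * (gaussian a p.1 p.2.1 p.2.2 * W p ^ 2)
        + gaussian a p.1 p.2.1 p.2.2 * (2 * W p * gX i p)) with hZ'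
  have nZ : ∀ i, IsNice τ T (Z i) := fun i => nW.mul_left (cX i)
  have nZ' : ∀ i, IsNice τ T (Z' i) := fun i => nW.add (((nW.mul_left ((cX i).neg.div (by fun_prop) n1)).add
    (((hJ.gX_nice i).mul_left (continuousOn_const.mul hJ.W_nice.cont)).mul_left cG)).mul_left (cX i))
  have dZ : ∀ i, ∀ x y t, 0 < y → 0 < t → t < T →
      HasLineDerivAt ℝ (fun z => Z i (z, y, t)) (Z' i (x, y, t)) x (EuclideanSpace.single i (1 : ℝ)) := by
    intro i x y t hy ht hT
    have hW := HasLineDerivAt.slice_x (pd_hasLineDerivAt hJ.smooth (p := (x, y, t)) ⟨hy, ht⟩ (dir (some i)))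
    rw [hJ.gX_eq _ _ ⟨hy, ht⟩] at hW
    have hx := coord_slice_hasLineDerivAt x i
    have hg := gaussian_hasLineDerivAt_x (a := a) x hy ht i
    unfold HasLineDerivAt at *
    refine (hx.mul (hg.mul (hW.pow 2))).congr_deriv ?_
    simp only [hZ', Pi.mul_apply, Pi.pow_apply, zero_smul, add_zero]
    push_cast
    ring
  have eZ : ∀ i, ∫ x, Z' i (x, y, t) = 0 := fun i =>
    (nZ i).isInner.integral_x_line (nZ' i).isInner (dZ i) hy ht
  have iZ := fun i => (nZ' i).integrable_bottom hy.le ht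
  have i0 := nW.integrable_bottom hy.le ht
  have i1 := ((IsNice.sum hτ fun i => (hJ.gX_nice i).sq).mul_left cG).integrable_bottom hy.le ht
  have i2 := (nW.mul_left (continuousOn_normSq_div (n := n) (T := T))).integrable_bottom hy.le ht
  simp only at i0 i1 i2
  -- The divergence of x G W² has zero integral. It contains -(|x|²/(2t)) G W², half of which is
  -- kept after Young's inequality on the term 2 W x·∇_x W.
  have hsum : ∫ x, ∑ i, Z' i (x, y, t) = 0 := by
    rw [integral_finsetSum _ fun i _ => iZ i, Finset.sum_eq_zero fun i _ => eZ i]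
  have hle : ∫ x, ∑ i, Z' i (x, y, t) ≤ ∫ x, ((n * (gaussian a x y t * W (x, y, t) ^ 2)
      + 4 * t * (gaussian a x y t * ∑ i, gX i (x, y, t) ^ 2))
      + (-1 / 4) * (‖x‖ ^ 2 / t * (gaussian a x y t * W (x, y, t) ^ 2))) := by
    refine integral_mono (integrable_finsetSum _ fun i _ => iZ i) (((i0.const_mul _).add (i1.const_mul _)).add
      (i2.const_mul _)) fun x => ?_
    have hG := (gaussian_pos (a := a) (x := x) (y := y) ht).le
    simp only [hZ', EuclideanSpace.real_norm_sq_eq]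
    set G := gaussian a x y t
    set w := W (x, y, t)
    calc ∑ i, (G * w ^ 2 + x i * (-x i / (2 * t) * (G * w ^ 2) + G * (2 * w * gX i (x, y, t))))
        ≤ ∑ i, (G * w ^ 2 + 4 * t * G * gX i (x, y, t) ^ 2 - 1 / (4 * t) * (G * w ^ 2) * x i ^ 2) := by
          refine Finset.sum_le_sum fun i _ => ?_
          set g := gX i (x, y, t)
          have h : 0 ≤ G * (t * (2 * g - x i * w / (2 * t)) ^ 2) := by positivity
          have e : G * (t * (2 * g - x i * w / (2 * t)) ^ 2) = 4 * t * G * g ^ 2 - 2 * G * w * x i * g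
            + 1 / (4 * t) * (G * w ^ 2) * x i ^ 2 := by field_simp; ring
          rw [e] at h
          have e2 : x i * (-x i / (2 * t) * (G * w ^ 2) + G * (2 * w * g)) = 2 * G * w * x i * g
            - 2 * (1 / (4 * t) * (G * w ^ 2) * x i ^ 2) := by field_simp; ring
          rw [e2]; linarith
      _ = _ := by
          rw [Finset.sum_sub_distrib, Finset.sum_add_distrib, Finset.sum_const, Finset.card_univ, Fintype.card_fin,
            nsmul_eq_mul, ← Finset.mul_sum, ← Finset.mul_sum]
          field_simp
          ring
  rw [hsum, integral_const_mul_add_add i0 i1 i2] at hle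
  linarith

/-- Hardy's inequality with Gaussian weight at a fixed time. -/
theorem hardy_time (hJ : JetExt a τ T W gX gt gφ gf) (ha : -1 < a) {t : ℝ} (ht : 0 < t) :
    ∫ q : EuclideanSpace ℝ (Fin n) × ℝ, q.2 ^ a * (‖q.1‖ ^ 2 / t * (gaussian a q.1 q.2 t * W (q.1, q.2, t) ^ 2)) ∂halfSlab n 0
      ≤ 4 * n * (∫ q : EuclideanSpace ℝ (Fin n) × ℝ, q.2 ^ a * (gaussian a q.1 q.2 t * W (q.1, q.2, t) ^ 2) ∂halfSlab n 0)
        + 16 * t * ∫ q : EuclideanSpace ℝ (Fin n) × ℝ,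
          q.2 ^ a * (gaussian a q.1 q.2 t * ∑ i, gX i (q.1, q.2, t) ^ 2) ∂halfSlab n 0 := by
  have cG := continuousOn_gaussian (n := n) (a := a) (T := T)
  have nW := hJ.W_nice.sq.mul_left cG
  have i0 := nW.integrable_rpow_mul_slice ha ht
  have i1 := ((IsNice.sum hJ.W_nice.lt fun i => (hJ.gX_nice i).sq).mul_left cG).integrable_rpow_mul_slice ha ht
  have i2 := (nW.mul_left (continuousOn_normSq_div (n := n) (T := T))).integrable_rpow_mul_slice ha ht
  simp only [halfSlab] at i0 i1 i2 ⊢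
  rw [integral_prod_symm _ i0, integral_prod_symm _ i1, integral_prod_symm _ i2, ← integral_const_mul,
    ← integral_const_mul, ← integral_add (i0.integral_prod_right.const_mul _) (i1.integral_prod_right.const_mul _)]
  refine integral_mono_ae i2.integral_prod_right ((i0.integral_prod_right.const_mul _).add
    (i1.integral_prod_right.const_mul _)) ?_
  filter_upwards [ae_restrict_mem measurableSet_Ioi] with y hy
  simp only [integral_const_mul]
  have h := mul_le_mul_of_nonneg_left (hardy_slice hJ hy ht) (rpow_nonneg (le_of_lt hy) a)
  linarith

theorem gaussian_eq_mul {x : EuclideanSpace ℝ (Fin n)} {y t : ℝ} :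
    gaussian a x y t = gaussian a x 0 t * exp (-(y ^ 2) / (4 * t)) := by
  simp only [gaussian, normSq]
  rw [mul_assoc, ← exp_add]
  congr 2
  ring

/-- The pointwise trace inequality on the segment `0 ≤ y ≤ √t`. -/
theorem trace_segment (hJ : JetExt a τ T W gX gt gφ gf) (ha : a ≤ 0) (x : EuclideanSpace ℝ (Fin n)) {t ρ : ℝ}
    (ht : 0 < t) (hρ : 1 ≤ ρ) :
    ρ * (gaussian a x 0 t * W (x, 0, t) ^ 2) ≤ ∫ y in (0 : ℝ)..√t, gaussian a x y t *
      (5 / 2 * ρ ^ 2 / √t * W (x, y, t) ^ 2 + √t * (y ^ (-a) * gφ (x, y, t)) ^ 2) := by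
  set r := √t with hr
  have hr0 : 0 < r := sqrt_pos.2 ht
  have hrt : r ^ 2 = t := sq_sqrt ht.le
  have hG := gaussian_pos (a := a) (x := x) (y := 0) ht
  have cW : ContinuousOn (fun y => W (x, y, t)) (Ici 0) :=
    hJ.W_nice.continuousOn.comp (by fun_prop) fun y hy => ⟨hy, ht⟩
  have cφ : ContinuousOn (fun y => gφ (x, y, t)) (Ici 0) :=
    hJ.gφ_nice.continuousOn.comp (by fun_prop) fun y hy => ⟨hy, ht⟩
  have cp : ContinuousOn (fun y : ℝ => y ^ (-a)) (Ici 0) :=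
    ContinuousOn.rpow_const (by fun_prop) fun y _ => Or.inr (by linarith)
  have cg : ContinuousOn (fun y => gaussian a x y t) (Ici 0) := by
    unfold gaussian normSq
    exact Continuous.continuousOn (by fun_prop)
  have ce : Continuous (fun y : ℝ => exp (-(y ^ 2) / (4 * t))) := by fun_prop
  -- The cutoff 1 - y/√t equals 1 on the thin set and 0 at y = √t, so g(√t) - g(0) is the trace to
  -- be bounded. The one-sided inequality version of the fundamental theorem needs g to be
  -- differentiable only inside the segment.
  set g : ℝ → ℝ := fun y => -(ρ * gaussian a x 0 t) * (W (x, y, t) ^ 2 * exp (-(y ^ 2) / (4 * t)) * (1 - y / r)) with hg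
  have key := intervalIntegral.sub_le_integral_of_hasDeriv_right_of_le (g := g)
    (g' := fun y => -(ρ * gaussian a x 0 t) * ((2 * W (x, y, t) * (y ^ (-a) * gφ (x, y, t)) * exp (-(y ^ 2) / (4 * t))
      + W (x, y, t) ^ 2 * (exp (-(y ^ 2) / (4 * t)) * (-(2 * y) / (4 * t)))) * (1 - y / r)
      + W (x, y, t) ^ 2 * exp (-(y ^ 2) / (4 * t)) * (-(1 / r))))
    (φ := fun y => gaussian a x y t *
      (5 / 2 * ρ ^ 2 / r * W (x, y, t) ^ 2 + r * (y ^ (-a) * gφ (x, y, t)) ^ 2)) hr0.le ?_ ?_ ?_ ?_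
  · have h1 : g r = 0 := by simp [hg, hr0.ne']
    have h0 : g 0 = -(ρ * (gaussian a x 0 t * W (x, 0, t) ^ 2)) := by simp [hg]; ring
    rw [h1, h0] at key
    linarith
  · exact continuousOn_const.mul ((((cW.mono Icc_subset_Ici_self).pow 2).mul ce.continuousOn).mul (by fun_prop))
  · intro y hy
    have hW := HasLineDerivAt.hasDerivAt_y (pd_hasLineDerivAt hJ.smooth (p := (x, y, t)) ⟨hy.1, ht⟩ (dir none))
    rw [hJ.pd_none (p := (x, y, t)) ⟨hy.1, ht⟩] at hW
    have he : HasDerivAt (fun y : ℝ => exp (-(y ^ 2) / (4 * t))) (exp (-(y ^ 2) / (4 * t)) * (-(2 * y) / (4 * t))) y := by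
      have := (((hasDerivAt_pow 2 y).neg).div_const (4 * t)).exp
      simpa using this
    have hl : HasDerivAt (fun y : ℝ => 1 - y / r) (-(1 / r)) y := by
      simpa using ((hasDerivAt_id y).div_const r).const_sub 1
    refine ((((hW.pow 2).mul he).mul hl).const_mul _ |>.congr_deriv ?_).hasDerivWithinAt
    simp only [Pi.pow_apply, Pi.mul_apply]
    push_cast
    ring
  · exact ((cg.mul ((continuousOn_const.mul (cW.pow 2)).add (continuousOn_const.mul ((cp.mul cφ).pow 2)))).mono
      Icc_subset_Ici_self).integrableOn_Icc
  · intro y hy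
    simp only [gaussian_eq_mul (y := y)]
    set E := exp (-(y ^ 2) / (4 * t))
    set G := gaussian a x 0 t
    set w := W (x, y, t)
    set v := y ^ (-a) * gφ (x, y, t)
    have hE : 0 < E := exp_pos _
    have hz0 : 0 ≤ 1 - y / r := by rw [sub_nonneg, div_le_one hr0]; exact hy.2.le
    have hz1 : 1 - y / r ≤ 1 := by have := div_pos hy.1 hr0; linarith
    set z := 1 - y / r
    have e : -(ρ * G) * ((2 * w * v * E + w ^ 2 * (E * (-(2 * y) / (4 * t)))) * z + w ^ 2 * E * (-(1 / r)))
      = G * E * (-(2 * ρ * w * v * z) + ρ * w ^ 2 * (y / (2 * t)) * z + ρ * w ^ 2 / r) := by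
      field_simp; ring
    rw [e, mul_assoc]
    -- Young's inequality puts ρ² entirely on w², so the derivative of w enters without a weight in
    -- x. The constant 5/2 is 1 + 1/2 + 1, from the derivatives of w², of the Gaussian and of the
    -- cutoff, using ρ ≤ ρ².
    have h1 : -(2 * ρ * w * v * z) ≤ ρ ^ 2 / r * w ^ 2 + r * v ^ 2 := by
      have h : 0 ≤ (ρ * w / r + v * z) ^ 2 * r := by positivity
      have e1 : (ρ * w / r + v * z) ^ 2 * r = ρ ^ 2 / r * w ^ 2 + 2 * ρ * w * v * z + r * v ^ 2 * z ^ 2 := by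
        field_simp
        ring
      have h2 : r * v ^ 2 * z ^ 2 ≤ r * v ^ 2 := mul_le_of_le_one_right (by positivity) (by nlinarith)
      linarith
    have h2 : ρ * w ^ 2 * (y / (2 * t)) * z ≤ ρ ^ 2 / r * w ^ 2 / 2 := by
      have h3 : y / (2 * t) ≤ 1 / (2 * r) := by
        rw [← hrt, div_le_div_iff₀ (by positivity) (by positivity)]
        nlinarith [hy.1, hy.2]
      have hy0 : 0 ≤ y / (2 * t) := by have := hy.1; positivity
      calc ρ * w ^ 2 * (y / (2 * t)) * z ≤ ρ * w ^ 2 * (y / (2 * t)) * 1 := by gcongr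
        _ ≤ ρ * w ^ 2 * (1 / (2 * r)) * 1 := by gcongr
        _ = ρ / r * w ^ 2 / 2 := by field_simp
        _ ≤ _ := by gcongr; nlinarith
    have h3 : ρ * w ^ 2 / r ≤ ρ ^ 2 / r * w ^ 2 := by
      have : ρ * w ^ 2 / r = ρ / r * w ^ 2 := by field_simp
      rw [this]; gcongr; nlinarith
    have e5 : 5 / 2 * ρ ^ 2 / r * w ^ 2 = ρ ^ 2 / r * w ^ 2 * (5 / 2) := by ring
    rw [← mul_assoc G E]
    refine mul_le_mul_of_nonneg_left ?_ (by positivity)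
    rw [e5]; linarith

/-- The Gaussian trace inequality at a fixed time. -/
theorem trace_time (hJ : JetExt a τ T W gX gt gφ gf) (ha : -1 < a) (ha' : a ≤ 0) {t : ℝ} (ht : 0 < t) :
    ∫ x, (1 + ‖x‖ / √t) * (gaussian a x 0 t * W (x, 0, t) ^ 2)
      ≤ (20 * n + 80) * t ^ (-(1 + a) / 2) * ((∫ q, W (q.1, q.2, t) ^ 2 * wgt a (q.1, q.2, t) ∂halfSlab n 0)
        + t * ∫ q, gradN W (q.1, q.2, t) * wgt a (q.1, q.2, t) ∂halfSlab n 0) := by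
  set r := √t with hr
  have hr0 : 0 < r := sqrt_pos.2 ht
  have hrt : r ^ 2 = t := sq_sqrt ht.le
  have cG := continuousOn_gaussian (n := n) (a := a) (T := T)
  have nW := hJ.W_nice.sq.mul_left cG
  have i0 := nW.integrable_rpow_mul_slice ha ht
  have i1 := ((IsNice.sum hJ.W_nice.lt fun i => (hJ.gX_nice i).sq).mul_left cG).integrable_rpow_mul_slice ha ht
  have i2 := (nW.mul_left (continuousOn_normSq_div (n := n) (T := T))).integrable_rpow_mul_slice ha ht
  have i3 := (hJ.gφ_nice.sq.mul_left cG).integrable_rpow_mul_slice (b := -a) (by linarith) ht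
  have i4 : Integrable (fun x => (1 + ‖x‖ / r) * (gaussian a x 0 t * W (x, 0, t) ^ 2)) := by
    refine (nW.mul_left (h := fun p => 1 + ‖p.1‖ / r) (by fun_prop)).integrable_bottom le_rfl ht
  simp only at i0 i1 i2 i3
  -- The segment bound with ρ = 1 + |x|/√t and ρ² ≤ 2 + 2|x|²/t, rewritten with the weights y^a and
  -- y^(-a) of mass and energy.
  set Φ : EuclideanSpace ℝ (Fin n) × ℝ → ℝ := fun q =>
    5 / r * (q.2 ^ a * (gaussian a q.1 q.2 t * W (q.1, q.2, t) ^ 2))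
    + 5 / r * (q.2 ^ a * (‖q.1‖ ^ 2 / t * (gaussian a q.1 q.2 t * W (q.1, q.2, t) ^ 2)))
    + r * (q.2 ^ (-a) * (gaussian a q.1 q.2 t * gφ (q.1, q.2, t) ^ 2)) with hΦ
  have iΦ : Integrable Φ (halfSlab n 0) := ((i0.const_mul _).add (i2.const_mul _)).add (i3.const_mul _)
  have hta : r ^ a = t ^ (a / 2) := by
    rw [hr, sqrt_eq_rpow, ← rpow_mul ht.le]; congr 1; ring
  have step1 : ∫ x, (1 + ‖x‖ / r) * (gaussian a x 0 t * W (x, 0, t) ^ 2)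
      ≤ t ^ (-a / 2) * ∫ q, Φ q ∂halfSlab n 0 := by
    have iΦ' := iΦ
    unfold halfSlab at iΦ' ⊢
    rw [integral_prod _ iΦ', ← integral_const_mul]
    refine integral_mono_ae i4 (iΦ'.integral_prod_left.const_mul _) ?_
    filter_upwards [iΦ'.prod_right_ae] with x hx
    have hρ : 1 ≤ 1 + ‖x‖ / r := by have : 0 ≤ ‖x‖ / r := by positivity
                                    linarith
    refine (trace_segment hJ ha' x ht hρ).trans ?_
    rw [← hr, intervalIntegral.integral_of_le hr0.le]
    have hΦ0 : ∀ y, 0 < y → 0 ≤ Φ (x, y) := by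
      intro y hy
      have hG := gaussian_pos (a := a) (x := x) (y := y) ht
      simp only [hΦ]
      positivity
    have hxI : IntegrableOn (fun y => Φ (x, y)) (Ioi 0) := hx
    calc _ ≤ ∫ y in Ioc 0 r, t ^ (-a / 2) * Φ (x, y) := by
          refine integral_mono_of_nonneg ?_ ((hxI.mono_set Ioc_subset_Ioi_self).const_mul _) ?_
          · refine Eventually.of_forall fun y => ?_
            have hG := gaussian_pos (a := a) (x := x) (y := y) ht
            simp only [Pi.zero_apply]
            positivity
          · filter_upwards [ae_restrict_mem measurableSet_Ioc] with y hy
            have hG := gaussian_pos (a := a) (x := x) (y := y) ht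
            have hy0 := hy.1
            -- For a ≤ 0 the weight y^a is smallest at y = √t. This is the place where the
            -- unweighted segment integral is dominated by a weighted one.
            have h1 : 1 ≤ t ^ (-a / 2) * y ^ a := by
              have h2 : r ^ a ≤ y ^ a := rpow_le_rpow_of_nonpos hy0 hy.2 ha'
              rw [hta] at h2
              calc (1 : ℝ) = t ^ (-a / 2) * t ^ (a / 2) := by rw [← rpow_add ht]; simp [← add_div]
                _ ≤ _ := by gcongr
            have hyy : y ^ a * y ^ (-a) = 1 := by rw [← rpow_add hy0]; simp
            have h3 : (y ^ (-a)) ^ 2 ≤ t ^ (-a / 2) * y ^ (-a) := by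
              calc (y ^ (-a)) ^ 2 = 1 * (y ^ (-a)) ^ 2 := by ring
                _ ≤ t ^ (-a / 2) * y ^ a * (y ^ (-a)) ^ 2 := by gcongr
                _ = t ^ (-a / 2) * y ^ (-a) * (y ^ a * y ^ (-a)) := by ring
                _ = _ := by rw [hyy, mul_one]
            have h4 : 5 / 2 * (1 + ‖x‖ / r) ^ 2 / r ≤ (5 / r + 5 / r * (‖x‖ ^ 2 / t)) * (t ^ (-a / 2) * y ^ a) := by
              calc 5 / 2 * (1 + ‖x‖ / r) ^ 2 / r ≤ (5 / r + 5 / r * (‖x‖ ^ 2 / t)) * 1 := by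
                    rw [← hrt, mul_one, ← div_pow]
                    have h5 : (1 + ‖x‖ / r) ^ 2 ≤ 2 + 2 * (‖x‖ / r) ^ 2 := by nlinarith [sq_nonneg (1 - ‖x‖ / r)]
                    have e6 : 5 / r + 5 / r * (‖x‖ / r) ^ 2 = 5 / 2 * (2 + 2 * (‖x‖ / r) ^ 2) / r := by ring
                    rw [e6]; gcongr
                _ ≤ _ := by gcongr
            calc gaussian a x y t * (5 / 2 * (1 + ‖x‖ / r) ^ 2 / r * W (x, y, t) ^ 2
                  + r * (y ^ (-a) * gφ (x, y, t)) ^ 2)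
                = gaussian a x y t * (5 / 2 * (1 + ‖x‖ / r) ^ 2 / r * W (x, y, t) ^ 2
                  + r * ((y ^ (-a)) ^ 2 * gφ (x, y, t) ^ 2)) := by ring
              _ ≤ gaussian a x y t * ((5 / r + 5 / r * (‖x‖ ^ 2 / t)) * (t ^ (-a / 2) * y ^ a) * W (x, y, t) ^ 2
                  + r * (t ^ (-a / 2) * y ^ (-a) * gφ (x, y, t) ^ 2)) := by gcongr
              _ = t ^ (-a / 2) * Φ (x, y) := by simp only [hΦ]; ring
      _ = t ^ (-a / 2) * ∫ y in Ioc 0 r, Φ (x, y) := integral_const_mul _ _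
      _ ≤ t ^ (-a / 2) * ∫ y in Ioi 0, Φ (x, y) := by
          refine mul_le_mul_of_nonneg_left (setIntegral_mono_set hxI ?_ Ioc_subset_Ioi_self.eventuallyLE)
            (by positivity)
          filter_upwards [ae_restrict_mem measurableSet_Ioi] with y hy using hΦ0 y hy
  have eΦ : ∫ q, Φ q ∂halfSlab n 0 = 5 / r * (∫ q : EuclideanSpace ℝ (Fin n) × ℝ,
        q.2 ^ a * (gaussian a q.1 q.2 t * W (q.1, q.2, t) ^ 2) ∂halfSlab n 0)
      + 5 / r * (∫ q : EuclideanSpace ℝ (Fin n) × ℝ,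
        q.2 ^ a * (‖q.1‖ ^ 2 / t * (gaussian a q.1 q.2 t * W (q.1, q.2, t) ^ 2)) ∂halfSlab n 0)
      + r * ∫ q : EuclideanSpace ℝ (Fin n) × ℝ,
        q.2 ^ (-a) * (gaussian a q.1 q.2 t * gφ (q.1, q.2, t) ^ 2) ∂halfSlab n 0 := by
    simp only [hΦ]
    exact integral_const_mul_add_add i0 i2 i3 _ _ _
  have eH : ∫ q, W (q.1, q.2, t) ^ 2 * wgt a (q.1, q.2, t) ∂halfSlab n 0 = ∫ q : EuclideanSpace ℝ (Fin n) × ℝ,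
        q.2 ^ a * (gaussian a q.1 q.2 t * W (q.1, q.2, t) ^ 2) ∂halfSlab n 0 :=
    integral_congr_ae (Eventually.of_forall fun q => by simp only [wgt]; ring)
  have eD : ∫ q, gradN W (q.1, q.2, t) * wgt a (q.1, q.2, t) ∂halfSlab n 0
      = (∫ q : EuclideanSpace ℝ (Fin n) × ℝ, q.2 ^ a * (gaussian a q.1 q.2 t * ∑ i, gX i (q.1, q.2, t) ^ 2) ∂halfSlab n 0)
        + ∫ q : EuclideanSpace ℝ (Fin n) × ℝ,
        q.2 ^ (-a) * (gaussian a q.1 q.2 t * gφ (q.1, q.2, t) ^ 2) ∂halfSlab n 0 := by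
    rw [← integral_add i1 i3]
    refine integral_congr_ae ?_
    filter_upwards [ae_halfSlab 0] with q hq
    exact hJ.gradN_wgt (p := (q.1, q.2, t)) ⟨hq, ht⟩
  have hh := hardy_time hJ ha ht
  have p0 : ∀ (b : ℝ) (f : EuclideanSpace ℝ (Fin n) × ℝ → ℝ), (∀ q, 0 ≤ f q) →
      0 ≤ ∫ q : EuclideanSpace ℝ (Fin n) × ℝ, q.2 ^ b * (gaussian a q.1 q.2 t * f q) ∂halfSlab n 0 := by
    intro b f hf
    refine integral_nonneg_of_ae ?_
    filter_upwards [ae_halfSlab 0] with q hq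
    have hG := gaussian_pos (a := a) (x := q.1) (y := q.2) ht
    have hq : 0 < q.2 := hq
    have := hf q
    simp only [Pi.zero_apply]
    positivity
  have pH := p0 a (fun q => W (q.1, q.2, t) ^ 2) fun q => sq_nonneg _
  have pX := p0 a (fun q => ∑ i, gX i (q.1, q.2, t) ^ 2) fun q => Finset.sum_nonneg fun i _ => sq_nonneg _
  have pφ := p0 (-a) (fun q => gφ (q.1, q.2, t) ^ 2) fun q => sq_nonneg _
  rw [eH, eD]
  rw [eΦ] at step1
  refine step1.trans ?_
  set H := ∫ q : EuclideanSpace ℝ (Fin n) × ℝ, q.2 ^ a * (gaussian a q.1 q.2 t * W (q.1, q.2, t) ^ 2) ∂halfSlab n 0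
  set DX := ∫ q : EuclideanSpace ℝ (Fin n) × ℝ, q.2 ^ a * (gaussian a q.1 q.2 t * ∑ i, gX i (q.1, q.2, t) ^ 2) ∂halfSlab n 0
  set Dφ := ∫ q : EuclideanSpace ℝ (Fin n) × ℝ, q.2 ^ (-a) * (gaussian a q.1 q.2 t * gφ (q.1, q.2, t) ^ 2) ∂halfSlab n 0
  set Y := ∫ q : EuclideanSpace ℝ (Fin n) × ℝ,
        q.2 ^ a * (‖q.1‖ ^ 2 / t * (gaussian a q.1 q.2 t * W (q.1, q.2, t) ^ 2)) ∂halfSlab n 0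
  have hpow : t ^ (-(1 + a) / 2) = t ^ (-a / 2) / r := by
    rw [hr, sqrt_eq_rpow, ← rpow_sub ht]; congr 1; ring
  have hta0 : 0 < t ^ (-a / 2) := rpow_pos_of_pos ht _
  rw [hpow]
  have e7 : t ^ (-a / 2) * (5 / r * H + 5 / r * Y + r * Dφ) = t ^ (-a / 2) / r * (5 * H + 5 * Y + t * Dφ) := by
    rw [← hrt]; field_simp
  have hn0 : (0 : ℝ) ≤ n := n.cast_nonneg
  -- Hardy gives Y ≤ 4nH + 16t DX, whence 5 + 20n for the mass and 80 for the energy, both within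
  -- 20n + 80.
  have h8 : 5 * H + 5 * Y + t * Dφ ≤ (20 * n + 80) * (H + t * (DX + Dφ)) := by
    have q1 : 0 ≤ t * DX := by positivity
    have q2 : 0 ≤ t * Dφ := by positivity
    have q3 : 0 ≤ n * (t * DX) := by positivity
    have q4 : 0 ≤ n * (t * Dφ) := by positivity
    nlinarith
  rw [e7]
  calc t ^ (-a / 2) / r * (5 * H + 5 * Y + t * Dφ)
      ≤ t ^ (-a / 2) / r * ((20 * n + 80) * (H + t * (DX + Dφ))) := by gcongr
    _ = _ := by ring

end

/-! ### Slicing in time and the rescaled potential -/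

/-- Reassociating the product measure makes time the outer variable, so that the trace inequality
can be applied at each fixed t. -/
theorem integral_slab_eq_time {c : ℝ} {F : EuclideanSpace ℝ (Fin n) × ℝ × ℝ → ℝ} (hF : Integrable F (slab n 0 c)) :
    Integrable (fun t => ∫ q, F (q.1, q.2, t) ∂halfSlab n 0) (volume.restrict (Ioi c)) ∧
      ∫ p, F p ∂slab n 0 c = ∫ t in Ioi c, ∫ q, F (q.1, q.2, t) ∂halfSlab n 0 := by
  have hm : MeasurePreserving (MeasurableEquiv.prodAssoc : (EuclideanSpace ℝ (Fin n) × ℝ) × ℝ ≃ᵐ _)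
      ((halfSlab n 0).prod (volume.restrict (Ioi c))) (slab n 0 c) :=
    measurePreserving_prodAssoc volume (volume.restrict (Ioi 0)) (volume.restrict (Ioi c))
  have hi : Integrable (fun z : (EuclideanSpace ℝ (Fin n) × ℝ) × ℝ => F (z.1.1, z.1.2, z.2))
      ((halfSlab n 0).prod (volume.restrict (Ioi c))) := hm.integrable_comp_of_integrable hF
  refine ⟨hi.integral_prod_right, ?_⟩
  rw [← hm.integral_comp' F]
  exact integral_prod_symm _ hi

/-- The rescaled potential is a potential, with quantitative bounds on its derivatives. -/
theorem exists_potential {V : EuclideanSpace ℝ (Fin n) → ℝ → ℝ} {T₀ K T t₁ R A : ℝ} (hV : HasC2Bound V T₀ K)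
    (x₀ : EuclideanSpace ℝ (Fin n)) (ht₁ : 0 ≤ t₁) (hR : 0 < R) (hA : 0 ≤ A)
    (hT : ∀ t ∈ Ioo 0 T, R ^ 2 * t + t₁ < T₀) :
    ∃ Qt Qx, IsPotential T (fun x t => A * rescaledPotential V x₀ t₁ R x t) Qt Qx ∧
      ∀ x, ∀ t ∈ Ioo 0 T, |A * rescaledPotential V x₀ t₁ R x t| ≤ A * K ∧ |Qt x t| ≤ A * (K * R ^ 2) ∧
        |∑ i, x i * Qx i x t| ≤ A * (K * (R * ‖x‖)) := by
  set U := fun p : EuclideanSpace ℝ (Fin n) × ℝ => V p.1 p.2 with hU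
  set S := (univ : Set (EuclideanSpace ℝ (Fin n))) ×ˢ Ioo 0 T₀ with hS
  have hSo : IsOpen S := isOpen_univ.prod isOpen_Ioo
  set m : EuclideanSpace ℝ (Fin n) × ℝ → EuclideanSpace ℝ (Fin n) × ℝ := fun z =>
    (R • z.1 + x₀, R ^ 2 * z.2 + t₁) with hm
  have hmS : ∀ x, ∀ t ∈ Ioo 0 T, m (x, t) ∈ S := fun x t ht =>
    ⟨mem_univ _, by have := mul_pos (pow_pos hR 2) ht.1; simp only [hm]; linarith, hT t ht⟩
  have hmc : ContinuousOn m (univ ×ˢ Ioo 0 T) := by fun_prop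
  have hmm : MapsTo m (univ ×ˢ Ioo 0 T) S := fun z hz => hmS z.1 z.2 hz.2
  have hD : ContinuousOn (fderiv ℝ U) S := hV.1.continuousOn_fderiv_of_isOpen hSo (by norm_num)
  have hUd : ∀ p ∈ S, HasFDerivAt U (fderiv ℝ U p) p := fun p hp =>
    ((hV.1.differentiableOn (by norm_num)).differentiableAt (hSo.mem_nhds hp)).hasFDerivAt
  have b0 : ∀ p ∈ S, |U p| ≤ K := fun p hp => by
    have := hV.2 0 (by norm_num) p hp
    rwa [norm_iteratedFDeriv_zero] at this
  have b1 : ∀ p ∈ S, ‖fderiv ℝ U p‖ ≤ K := fun p hp => by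
    have := hV.2 1 (by norm_num) p hp
    rwa [norm_iteratedFDeriv_one] at this
  refine ⟨fun x t => A * fderiv ℝ U (m (x, t)) (0, R ^ 2),
    fun i x t => A * fderiv ℝ U (m (x, t)) (R • EuclideanSpace.single i 1, 0), ⟨?_, ?_, ?_, ?_, ?_⟩, ?_⟩
  · exact continuousOn_const.mul (hV.1.continuousOn.comp hmc hmm)
  · exact continuousOn_const.mul ((hD.comp hmc hmm).clm_apply continuousOn_const)
  · exact fun i => continuousOn_const.mul ((hD.comp hmc hmm).clm_apply continuousOn_const)
  · intro x t ht
    have h1 : HasDerivAt (fun r : ℝ => m (x, r)) ((0 : EuclideanSpace ℝ (Fin n)), R ^ 2) t := by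
      have h2 : HasDerivAt (fun r : ℝ => R ^ 2 * r + t₁) (R ^ 2) t := by
        simpa using ((hasDerivAt_id t).const_mul (R ^ 2)).add_const t₁
      exact (hasDerivAt_const t (R • x + x₀)).prodMk h2
    exact ((hUd _ (hmS x t ht)).comp_hasDerivAt t h1).const_mul A
  · intro i x t ht
    unfold HasLineDerivAt
    have h1 : HasDerivAt (fun r : ℝ => m (x + r • EuclideanSpace.single i (1 : ℝ), t))
        ((R • EuclideanSpace.single i 1 : EuclideanSpace ℝ (Fin n)), (0 : ℝ)) 0 := by
      have h2 : HasDerivAt (fun r : ℝ => R • (x + r • EuclideanSpace.single i (1 : ℝ)) + x₀)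
          (R • EuclideanSpace.single i 1 : EuclideanSpace ℝ (Fin n)) 0 := by
        have := ((((hasDerivAt_id (0 : ℝ)).smul_const (EuclideanSpace.single i (1 : ℝ) : EuclideanSpace ℝ (Fin n))).const_add
          x).const_smul R).add_const x₀
        simpa using this
      exact h2.prodMk (hasDerivAt_const (0 : ℝ) (R ^ 2 * t + t₁))
    have h3 : HasFDerivAt U (fderiv ℝ U (m (x, t))) (m (x + (0 : ℝ) • EuclideanSpace.single i (1 : ℝ), t)) := by
      simpa using hUd _ (hmS x t ht)
    exact (h3.comp_hasDerivAt (0 : ℝ) h1).const_mul A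
  · intro x t ht
    have hp := hmS x t ht
    refine ⟨?_, ?_, ?_⟩
    · rw [abs_mul, abs_of_nonneg hA]
      exact mul_le_mul_of_nonneg_left (b0 _ hp) hA
    · rw [abs_mul, abs_of_nonneg hA]
      refine mul_le_mul_of_nonneg_left ?_ hA
      refine ((fderiv ℝ U (m (x, t))).le_of_opNorm_le (b1 _ hp) _).trans_eq ?_
      rw [Prod.norm_mk, norm_zero, max_eq_right (norm_nonneg _), norm_of_nonneg (by positivity)]
    -- The sum is a single derivative in the direction (Rx, 0), so the operator norm bounds it
    -- without a factor n.
    · have e : ∑ i, x i * (A * fderiv ℝ U (m (x, t)) (R • EuclideanSpace.single i 1, 0))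
          = A * fderiv ℝ U (m (x, t)) (R • x, 0) := by
        have hx : (R • x, (0 : ℝ)) = ∑ i, x i • ((R • EuclideanSpace.single i 1 : EuclideanSpace ℝ (Fin n)), (0 : ℝ)) := by
          refine Prod.ext ?_ ?_
          · rw [Prod.fst_sum]
            ext j
            simp [Finset.sum_apply, Pi.single_apply, mul_comm]
          · rw [Prod.snd_sum]; simp
        rw [hx, map_sum, Finset.mul_sum]
        refine Finset.sum_congr rfl fun i _ => ?_
        rw [map_smul, smul_eq_mul]; ring
      rw [e, abs_mul, abs_of_nonneg hA]
      refine mul_le_mul_of_nonneg_left ?_ hA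
      refine ((fderiv ℝ U (m (x, t))).le_of_opNorm_le (b1 _ hp) _).trans_eq ?_
      rw [Prod.norm_mk, norm_zero, max_eq_left (norm_nonneg _), norm_smul, norm_of_nonneg hR.le]

/-! ### Absorption of the boundary terms -/

section
variable {a τ T : ℝ} {W : EuclideanSpace ℝ (Fin n) × ℝ × ℝ → ℝ} {gX : Fin n → EuclideanSpace ℝ (Fin n) × ℝ × ℝ → ℝ}
  {gt gφ gf : EuclideanSpace ℝ (Fin n) × ℝ × ℝ → ℝ} {α : ℝ} {κ γ θ : ℝ → ℝ}
  {Q Qt : EuclideanSpace ℝ (Fin n) → ℝ → ℝ} {Qx : Fin n → EuclideanSpace ℝ (Fin n) → ℝ → ℝ}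

theorem JetExt.sq_eq_zero (hJ : JetExt a τ T W gX gt gφ gf) {q : EuclideanSpace ℝ (Fin n) × ℝ} {t : ℝ} (hy : 0 < q.2)
    (ht : 0 < t) (hT : T ≤ t) : W (q.1, q.2, t) = 0 ∧ gradN W (q.1, q.2, t) = 0 := by
  have hp : (q.1, q.2, t) ∉ supportSet n τ := fun h => absurd (h.2.trans_lt hJ.W_nice.lt) (not_lt.2 hT)
  refine ⟨hJ.W_nice.zero _ hy.le ht hp, Finset.sum_eq_zero fun j _ => ?_⟩
  rw [hJ.pd_zero _ _ ⟨hy, ht⟩ hp, zero_pow two_ne_zero]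

/-- Weighted mass at time `t`. -/
noncomputable def massAt (a : ℝ) (W : EuclideanSpace ℝ (Fin n) × ℝ × ℝ → ℝ) (t : ℝ) : ℝ :=
  ∫ q, W (q.1, q.2, t) ^ 2 * wgt a (q.1, q.2, t) ∂halfSlab n 0

/-- Weighted Dirichlet energy at time `t`. -/
noncomputable def energyAt (a : ℝ) (W : EuclideanSpace ℝ (Fin n) × ℝ × ℝ → ℝ) (t : ℝ) : ℝ :=
  ∫ q, gradN W (q.1, q.2, t) * wgt a (q.1, q.2, t) ∂halfSlab n 0

theorem massAt_nonneg {t : ℝ} (ht : 0 < t) : 0 ≤ massAt a W t := by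
  refine integral_nonneg_of_ae ?_
  filter_upwards [ae_halfSlab 0] with q hq
  exact mul_nonneg (sq_nonneg _) (wgt_pos (p := (q.1, q.2, t)) ⟨hq, ht⟩).le

theorem energyAt_nonneg {t : ℝ} (ht : 0 < t) : 0 ≤ energyAt a W t := by
  refine integral_nonneg_of_ae ?_
  filter_upwards [ae_halfSlab 0] with q hq
  exact mul_nonneg (Finset.sum_nonneg fun _ _ => sq_nonneg _) (wgt_pos (p := (q.1, q.2, t)) ⟨hq, ht⟩).le

/-- Absorption of the initial boundary term. -/
theorem thin_initial_bound (hJ : JetExt a τ T W gX gt gφ gf) (ha : -1 < a) (ha' : a ≤ 0)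
    (hκ : IsTimeWeight T α κ γ θ) {c B ε : ℝ} (hc : c ∈ Ioo 0 T) (hQ : ∀ x, |Q x c| ≤ B)
    (hε : c * γ c * B * ((20 * n + 80) * c ^ (-(1 + a) / 2)) ≤ ε) :
    |∫ x, κ c * (c * γ c) * (Q x c * (gaussian a x 0 c * W (x, 0, c) ^ 2))|
      ≤ ε * κ c * (massAt a W c + c * energyAt a W c) := by
  have hB : 0 ≤ B := (abs_nonneg _).trans (hQ 0)
  have hκ0 := hκ.κ_pos c hc
  have hγ := hκ.γ_ge c hc
  have hc0 := hc.1
  have i4 : Integrable (fun x => (1 + ‖x‖ / √c) * (gaussian a x 0 c * W (x, 0, c) ^ 2)) :=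
    ((hJ.W_nice.sq.mul_left (continuousOn_gaussian (n := n) (a := a) (T := T))).mul_left (h := fun p => 1 + ‖p.1‖ / √c)
      (by fun_prop)).integrable_bottom le_rfl hc0
  have htr := trace_time hJ ha ha' hc0
  have hm := massAt_nonneg (a := a) (W := W) hc0
  have he := energyAt_nonneg (a := a) (W := W) hc0
  rw [← norm_eq_abs]
  calc _ ≤ ∫ x, κ c * (c * γ c * B) * ((1 + ‖x‖ / √c) * (gaussian a x 0 c * W (x, 0, c) ^ 2)) := by
        refine norm_integral_le_of_norm_le (i4.const_mul _) (Eventually.of_forall fun x => ?_)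
        have hG := gaussian_pos (a := a) (x := x) (y := 0) hc0
        have h1 : 1 ≤ 1 + ‖x‖ / √c := le_add_of_nonneg_right (by positivity)
        have h0 : 0 ≤ κ c * (c * γ c) := by positivity
        have h2 : 0 ≤ gaussian a x 0 c * W (x, 0, c) ^ 2 := by positivity
        rw [norm_mul _ (Q x c * _), norm_mul (Q x c), norm_of_nonneg h0, norm_of_nonneg h2, norm_eq_abs]
        calc κ c * (c * γ c) * (|Q x c| * (gaussian a x 0 c * W (x, 0, c) ^ 2))
            ≤ κ c * (c * γ c) * (B * (1 * (gaussian a x 0 c * W (x, 0, c) ^ 2))) := by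
              rw [one_mul]; gcongr; exact hQ x
          _ ≤ κ c * (c * γ c) * (B * ((1 + ‖x‖ / √c) * (gaussian a x 0 c * W (x, 0, c) ^ 2))) := by gcongr
          _ = _ := by ring
    _ = κ c * (c * γ c * B) * ∫ x, (1 + ‖x‖ / √c) * (gaussian a x 0 c * W (x, 0, c) ^ 2) := integral_const_mul _ _
    _ ≤ κ c * (c * γ c * B) * ((20 * n + 80) * c ^ (-(1 + a) / 2) * (massAt a W c + c * energyAt a W c)) := by
        refine mul_le_mul_of_nonneg_left htr ?_
        positivity
    _ = κ c * (c * γ c * B * ((20 * n + 80) * c ^ (-(1 + a) / 2))) * (massAt a W c + c * energyAt a W c) := by ring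
    _ ≤ κ c * ε * (massAt a W c + c * energyAt a W c) := by gcongr
    _ = _ := by ring

/-- Absorption of the boundary integral over the thin set. -/
theorem thin_bound (hJ : JetExt a τ T W gX gt gφ gf) (ha : -1 < a) (ha' : a ≤ 0)
    (hκ : IsTimeWeight T α κ γ θ) (hQ : IsPotential T Q Qt Qx) {c B ε : ℝ} (hc : 0 < c) (hB : 0 ≤ B)
    (hQB : ∀ x, ∀ t ∈ Ioo 0 T, |((1 - a) / 2 + θ t / 2) * Q x t + (t * Qt x t + (∑ i, x i * Qx i x t) / 2)|
      ≤ B * (1 + ‖x‖ / √t))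
    (hε : ∀ t ∈ Ioo 0 T, γ t * B * ((20 * n + 80) * t ^ (-(1 + a) / 2)) ≤ ε * (θ t / t)) :
    |∫ q, thinDensity a κ γ θ W Q Qt Qx (q.1, 0, q.2) ∂halfSlab n c|
      ≤ ε * ∫ p, (κ p.2.2 * (θ p.2.2 / p.2.2)) * (W p ^ 2 * wgt a p)
        + (κ p.2.2 * θ p.2.2) * (gradN W p * wgt a p) ∂slab n 0 c := by
  have i1 := JetExt.integrable_sq hJ.W_nice ha (h := fun t => κ t * (θ t / t))
    (hκ.κ_cont.mul (hκ.θ_cont.div continuousOn_id fun _ ht => ht.1.ne')) hc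
  have i2 := hJ.integrable_gradN ha (by linarith) (h := fun t => κ t * θ t) (hκ.κ_cont.mul hκ.θ_cont) hc
  have i3 := (thinDensity_isNice (a := a) hκ hQ hJ.W_nice).integrable_slice le_rfl hc
  obtain ⟨j1, j2⟩ := integral_slab_eq_time (i1.add i2)
  simp only [Pi.add_apply] at j1 j2
  rw [j2, ← integral_const_mul]
  unfold halfSlab at i3
  rw [halfSlab, integral_prod_symm _ i3, ← norm_eq_abs]
  refine norm_integral_le_of_norm_le (j1.const_mul _) ?_
  filter_upwards [ae_restrict_mem measurableSet_Ioi] with t ht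
  have ht0 : 0 < t := hc.trans ht
  by_cases hT : t < T
  · have htT : t ∈ Ioo 0 T := ⟨ht0, hT⟩
    have hκ0 := hκ.κ_pos t htT
    have hγ := hκ.γ_ge t htT
    have i4 : Integrable (fun x => (1 + ‖x‖ / √t) * (gaussian a x 0 t * W (x, 0, t) ^ 2)) :=
      ((hJ.W_nice.sq.mul_left (continuousOn_gaussian (n := n) (a := a) (T := T))).mul_left (h := fun p => 1 + ‖p.1‖ / √t)
        (by fun_prop)).integrable_bottom le_rfl ht0
    have htr := trace_time hJ ha ha' ht0
    have hm := massAt_nonneg (a := a) (W := W) ht0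
    have he := energyAt_nonneg (a := a) (W := W) ht0
    have e1 : ∫ q, (κ t * (θ t / t) * (W (q.1, q.2, t) ^ 2 * wgt a (q.1, q.2, t))
        + κ t * θ t * (gradN W (q.1, q.2, t) * wgt a (q.1, q.2, t))) ∂halfSlab n 0
        = κ t * (θ t / t) * massAt a W t + κ t * θ t * energyAt a W t := by
      rw [integral_add ((JetExt.integrable_sq_slice hJ.W_nice ha ht0).const_mul _)
        ((hJ.integrable_gradN_slice ha (by linarith) ht0).const_mul _), integral_const_mul, integral_const_mul]
      rfl
    rw [e1]
    calc ‖∫ x, thinDensity a κ γ θ W Q Qt Qx (x, 0, t)‖ ≤ ∫ x, κ t * (γ t * B) * ((1 + ‖x‖ / √t) * (gaussian a x 0 t * W (x, 0, t) ^ 2)) := by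
          refine norm_integral_le_of_norm_le (i4.const_mul _) (Eventually.of_forall fun x => ?_)
          have hG := gaussian_pos (a := a) (x := x) (y := 0) ht0
          have h0 : 0 ≤ κ t * γ t := by positivity
          have h2 : 0 ≤ gaussian a x 0 t * W (x, 0, t) ^ 2 := by positivity
          simp only [thinDensity]
          rw [norm_mul, norm_mul, norm_of_nonneg h0, norm_of_nonneg h2, norm_eq_abs]
          have h3 := hQB x t htT
          have h4 : (0 : ℝ) ^ 2 / (4 * t) = 0 := by simp
          rw [h4, add_zero]
          calc _ ≤ κ t * γ t * (B * (1 + ‖x‖ / √t)) * (gaussian a x 0 t * W (x, 0, t) ^ 2) := by gcongr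
            _ = _ := by ring
      _ = κ t * (γ t * B) * ∫ x, (1 + ‖x‖ / √t) * (gaussian a x 0 t * W (x, 0, t) ^ 2) := integral_const_mul _ _
      _ ≤ κ t * (γ t * B) * ((20 * n + 80) * t ^ (-(1 + a) / 2) * (massAt a W t + t * energyAt a W t)) := by
          refine mul_le_mul_of_nonneg_left htr ?_
          positivity
      _ = κ t * (γ t * B * ((20 * n + 80) * t ^ (-(1 + a) / 2))) * (massAt a W t + t * energyAt a W t) := by ring
      _ ≤ κ t * (ε * (θ t / t)) * (massAt a W t + t * energyAt a W t) := by
          have := hε t htT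
          gcongr
      _ = _ := by field_simp
  · have h1 : ∀ x, thinDensity a κ γ θ W Q Qt Qx (x, 0, t) = 0 := fun x =>
      (thinDensity_isNice (a := a) hκ hQ hJ.W_nice).zero _ le_rfl ht0
        fun h => hT (h.2.trans_lt hJ.W_nice.lt)
    have h2 : ∫ q, (κ t * (θ t / t) * (W (q.1, q.2, t) ^ 2 * wgt a (q.1, q.2, t))
        + κ t * θ t * (gradN W (q.1, q.2, t) * wgt a (q.1, q.2, t))) ∂halfSlab n 0 = 0 := by
      refine integral_eq_zero_of_ae ?_
      filter_upwards [ae_halfSlab 0] with q hq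
      obtain ⟨e1, e2⟩ := hJ.sq_eq_zero hq ht0 (not_lt.1 hT)
      simp [e1, e2]
    simp [h1, h2]

end

/-- Comparison of time weights is only available on (0, T); the vanishing of F beyond T makes that
enough. -/
theorem integral_time_mono {F : EuclideanSpace ℝ (Fin n) × ℝ × ℝ → ℝ} {h₁ h₂ : ℝ → ℝ} {T c : ℝ} (hc : 0 < c)
    (i₁ : Integrable (fun p => h₁ p.2.2 * F p) (slab n 0 c)) (i₂ : Integrable (fun p => h₂ p.2.2 * F p) (slab n 0 c))
    (h : ∀ t ∈ Ioo 0 T, h₁ t ≤ h₂ t) (F0 : ∀ p ∈ openRegion n, 0 ≤ F p)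
    (FT : ∀ p ∈ openRegion n, T ≤ p.2.2 → F p = 0) :
    ∫ p, h₁ p.2.2 * F p ∂slab n 0 c ≤ ∫ p, h₂ p.2.2 * F p ∂slab n 0 c := by
  refine integral_mono_ae i₁ i₂ ?_
  filter_upwards [ae_slab 0 c] with p hp
  have hp' : p ∈ openRegion n := ⟨hp.1, hc.trans hp.2⟩
  by_cases hT : p.2.2 < T
  · exact mul_le_mul_of_nonneg_right (h _ ⟨hc.trans hp.2, hT⟩) (F0 p hp')
  · simp [FT p hp' (not_lt.1 hT)]

section
variable {a τ T : ℝ} {W : EuclideanSpace ℝ (Fin n) × ℝ × ℝ → ℝ} {gX : Fin n → EuclideanSpace ℝ (Fin n) × ℝ × ℝ → ℝ}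
  {gt gφ gf : EuclideanSpace ℝ (Fin n) × ℝ × ℝ → ℝ} {α : ℝ} {κ γ θ : ℝ → ℝ}
  {Q Qt : EuclideanSpace ℝ (Fin n) → ℝ → ℝ} {Qx : Fin n → EuclideanSpace ℝ (Fin n) → ℝ → ℝ}

theorem IsNice.sq_wgt_nonneg_vanish {f : EuclideanSpace ℝ (Fin n) × ℝ × ℝ → ℝ} (hf : IsNice τ T f) :
    (∀ p ∈ openRegion n, 0 ≤ f p ^ 2 * wgt a p) ∧ ∀ p ∈ openRegion n, T ≤ p.2.2 → f p ^ 2 * wgt a p = 0 := by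
  refine ⟨fun p hp => mul_nonneg (sq_nonneg _) (wgt_pos hp).le, fun p hp hT => ?_⟩
  rw [hf.zero p (le_of_lt hp.1) hp.2 fun h => absurd (h.2.trans_lt hf.lt) (not_lt.2 hT)]
  simp

theorem JetExt.gradN_wgt_nonneg_vanish (hJ : JetExt a τ T W gX gt gφ gf) :
    (∀ p ∈ openRegion n, 0 ≤ gradN W p * wgt a p) ∧ ∀ p ∈ openRegion n, T ≤ p.2.2 → gradN W p * wgt a p = 0 :=
  ⟨fun p hp => mul_nonneg (Finset.sum_nonneg fun _ _ => sq_nonneg _) (wgt_pos hp).le, fun p hp hT => by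
    rw [(hJ.sq_eq_zero (q := (p.1, p.2.1)) hp.1 hp.2 hT).2, zero_mul]⟩

/-- The Carleman inequality with all the boundary terms on the thin set absorbed. -/
theorem carleman_absorbed (hJ : JetExt a τ T W gX gt gφ gf) (ha : -1 < a) (ha' : a ≤ 0)
    (hκ : IsTimeWeight T α κ γ θ) (hα : 1 ≤ α) (hQ : IsPotential T Q Qt Qx)
    (hb : ∀ x t, 0 < t → t < T → gφ (x, 0, t) = Q x t * W (x, 0, t))
    {c B B₀ : ℝ} (hc : c ∈ Ioo 0 T) (hB : 0 ≤ B) (hQ₀ : ∀ x, |Q x c| ≤ B₀)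
    (hQB : ∀ x, ∀ t ∈ Ioo 0 T, |((1 - a) / 2 + θ t / 2) * Q x t + (t * Qt x t + (∑ i, x i * Qx i x t) / 2)|
      ≤ B * (1 + ‖x‖ / √t))
    (hB₀ : c * γ c * B₀ * ((20 * n + 80) * c ^ (-(1 + a) / 2)) ≤ 1 / 2)
    (hε : ∀ t ∈ Ioo 0 T, γ t * B * ((20 * n + 80) * t ^ (-(1 + a) / 2)) ≤ 1 / 8 * (θ t / t)) :
    α * (∫ p, (κ p.2.2 * (θ p.2.2 / p.2.2)) * (W p ^ 2 * wgt a p) ∂slab n 0 c)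
        + ∫ p, (κ p.2.2 * θ p.2.2) * (gradN W p * wgt a p) ∂slab n 0 c
      ≤ 8 * (∫ p, (κ p.2.2 * (p.2.2 * γ p.2.2)) * (gf p ^ 2 * wgt a p) ∂slab n 0 c)
        + (16 * α * κ c * massAt a W c - 4 * κ c * c * energyAt a W c) := by
  have ha1 : a < 1 := by linarith
  have hc0 := hc.1
  have key := carleman_with_boundary ha ha1 hκ hJ hc0
  rw [integral_fluxExt_eq ha ha1 hκ hQ hJ hb hc] at key
  have b1 := abs_le.1 (thin_initial_bound hJ ha ha' hκ hc hQ₀ hB₀)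
  have b2 := abs_le.1 (thin_bound hJ ha ha' hκ hQ hc0 hB hQB hε)
  have i1 := JetExt.integrable_sq hJ.W_nice ha (h := fun t => κ t * (θ t / t))
    (hκ.κ_cont.mul (hκ.θ_cont.div continuousOn_id fun _ ht => ht.1.ne')) hc0
  have i2 := hJ.integrable_gradN ha ha1 (h := fun t => κ t * θ t) (hκ.κ_cont.mul hκ.θ_cont) hc0
  have i3 := hJ.integrable_gradN ha ha1 hκ.cont_grad hc0
  have i4 := JetExt.integrable_sq hJ.W_nice ha hκ.cont_sq hc0
  have eT : ∫ q, fluxT a α κ γ W (q.1, q.2, c) ∂halfSlab n 0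
      = α * κ c * massAt a W c - κ c * (c * γ c) * energyAt a W c := by
    rw [massAt, energyAt, ← integral_const_mul, ← integral_const_mul,
      ← integral_sub ((JetExt.integrable_sq_slice hJ.W_nice ha hc0).const_mul _)
      ((hJ.integrable_gradN_slice ha ha1 hc0).const_mul _)]
    refine integral_congr_ae (Eventually.of_forall fun q => ?_)
    simp only [fluxT]; ring
  have e4 : ∫ p, (1 / 4 * (α * κ p.2.2 * (θ p.2.2 / p.2.2))) * (W p ^ 2 * wgt a p) ∂slab n 0 c
      = 1 / 4 * α * ∫ p, (κ p.2.2 * (θ p.2.2 / p.2.2)) * (W p ^ 2 * wgt a p) ∂slab n 0 c := by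
    rw [← integral_const_mul]
    refine integral_congr_ae (Eventually.of_forall fun q => ?_)
    simp only; ring
  have i2' : Integrable (fun p : EuclideanSpace ℝ (Fin n) × ℝ × ℝ => (1 / 2 * (κ p.2.2 * θ p.2.2)) * (gradN W p * wgt a p))
      (slab n 0 c) := hJ.integrable_gradN ha ha1 (h := fun t => 1 / 2 * (κ t * θ t))
        (continuousOn_const.mul (hκ.κ_cont.mul hκ.θ_cont)) hc0
  have e3 : 1 / 2 * (∫ p, (κ p.2.2 * θ p.2.2) * (gradN W p * wgt a p) ∂slab n 0 c)
      ≤ ∫ p, (1 / 2 * (κ p.2.2 * γ p.2.2 * θ p.2.2)) * (gradN W p * wgt a p) ∂slab n 0 c := by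
    have e : 1 / 2 * (∫ p, (κ p.2.2 * θ p.2.2) * (gradN W p * wgt a p) ∂slab n 0 c)
        = ∫ p, (1 / 2 * (κ p.2.2 * θ p.2.2)) * (gradN W p * wgt a p) ∂slab n 0 c := by
      rw [← integral_const_mul]
      refine integral_congr_ae (Eventually.of_forall fun q => ?_)
      simp only; ring
    rw [e]
    refine integral_time_mono (h₁ := fun t => 1 / 2 * (κ t * θ t)) (h₂ := fun t => 1 / 2 * (κ t * γ t * θ t)) hc0 i2' i3
      (fun t ht => ?_) hJ.gradN_wgt_nonneg_vanish.1 hJ.gradN_wgt_nonneg_vanish.2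
    have h1 := hκ.κ_pos t ht
    have h2 := hκ.γ_ge t ht
    have h3 := hκ.θ_nonneg t ht
    have h4 : κ t * θ t * 1 ≤ κ t * θ t * γ t := by gcongr
    linarith
  have p1 : 0 ≤ ∫ p, (κ p.2.2 * (θ p.2.2 / p.2.2)) * (W p ^ 2 * wgt a p) ∂slab n 0 c := by
    have := integral_time_mono (h₁ := fun t => 0) (h₂ := fun t => κ t * (θ t / t)) hc0 (by simp) i1
      (fun t ht => mul_nonneg (hκ.κ_pos t ht).le (div_nonneg (hκ.θ_nonneg t ht) ht.1.le))
      hJ.W_nice.sq_wgt_nonneg_vanish.1 hJ.W_nice.sq_wgt_nonneg_vanish.2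
    simpa using this
  have p2 : 0 ≤ ∫ p, (κ p.2.2 * θ p.2.2) * (gradN W p * wgt a p) ∂slab n 0 c := by
    have := integral_time_mono (h₁ := fun t => 0) (h₂ := fun t => κ t * θ t) hc0 (by simp) i2
      (fun t ht => mul_nonneg (hκ.κ_pos t ht).le (hκ.θ_nonneg t ht)) hJ.gradN_wgt_nonneg_vanish.1
      hJ.gradN_wgt_nonneg_vanish.2
    simpa using this
  rw [integral_add i3 i4, eT, e4] at key
  rw [integral_add i1 i2] at b2
  have hm := massAt_nonneg (a := a) (W := W) hc0
  have he := energyAt_nonneg (a := a) (W := W) hc0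
  have hκ0 := hκ.κ_pos c hc
  have hγ := hκ.γ_ge c hc
  set P1 := ∫ p, (κ p.2.2 * (θ p.2.2 / p.2.2)) * (W p ^ 2 * wgt a p) ∂slab n 0 c
  set P2 := ∫ p, (κ p.2.2 * θ p.2.2) * (gradN W p * wgt a p) ∂slab n 0 c
  have q1 : P1 ≤ α * P1 := le_mul_of_one_le_left p1 hα
  have q2 : κ c * massAt a W c ≤ α * (κ c * massAt a W c) := le_mul_of_one_le_left (by positivity) hα
  have q3 : κ c * c * energyAt a W c ≤ γ c * (κ c * c * energyAt a W c) := le_mul_of_one_le_left (by positivity) hγ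
  have q4 : 0 ≤ α * (κ c * massAt a W c) := by positivity
  -- The thin-set density costs 1/8 of both bulk integrals, leaving at least α/8 of the first (as α
  -- ≥ 1) and 3/8 of the second. The thin-set term at t = c costs half the mass and half the energy
  -- there, the latter paid for by κcγ ≥ κc. Everything is then multiplied by 8.
  linarith [b1.1, b1.2, b2.1, b2.2]

end

/-! ### Choice of constants and conclusion -/

/-- The thin-set flux of a test function is determined by its weighted normal derivative. -/
theorem JetExt.flux_eq_of_normalDeriv {a τ T : ℝ} {w : EuclideanSpace ℝ (Fin n) → ℝ → ℝ → ℝ}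
    {gX : Fin n → EuclideanSpace ℝ (Fin n) × ℝ × ℝ → ℝ} {gt gφ gf : EuclideanSpace ℝ (Fin n) × ℝ × ℝ → ℝ}
    (hJ : JetExt a τ T (fun p => w p.1 p.2.1 p.2.2) gX gt gφ gf) {x : EuclideanSpace ℝ (Fin n)} {t b : ℝ} (ht : 0 < t)
    (h : HasWeightedNormalDeriv a w x t b) : gφ (x, 0, t) = b := by
  have h1 : Tendsto (fun ε : ℝ => gφ (x, 0 + ε, t)) (𝓝[>] 0) (𝓝 (gφ (x, 0, t))) := by
    have hp : (x, (0 : ℝ), t) ∈ closedRegion n := ⟨le_rfl, ht⟩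
    refine (hJ.gφ_nice.continuousOn (x, 0, t) hp).tendsto.comp
      (tendsto_nhdsWithin_iff.2 ⟨tendsto_to_thin (p := (x, (0 : ℝ), t)), ?_⟩)
    filter_upwards [self_mem_nhdsWithin] with ε hε
    exact ⟨add_nonneg le_rfl (le_of_lt hε), ht⟩
  refine tendsto_nhds_unique (h1.congr' ?_) h
  filter_upwards [self_mem_nhdsWithin] with y hy
  rw [zero_add, derivY_eq hJ.smooth hy ht, ← hJ.gφ_eq (x, y, t) ⟨hy, ht⟩]

theorem isTimeWeight_of_bounds {s lam α Γ T : ℝ} {σ γ : ℝ → ℝ} (hlam : 0 < lam) (hT : T ≤ 1 / lam)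
    (hγ : ∀ t ∈ Ioo 0 T, 1 ≤ γ t ∧ γ t ≤ Γ ∧ 0 < σ t ∧ HasDerivAt γ (γ t * theta s (lam * t) / t) t ∧
      HasDerivAt σ (σ t / (t * γ t)) t)
    (hθ : ∀ t ∈ Ioo 0 T, 0 ≤ theta s (lam * t) ∧ Γ * theta s (lam * t) ≤ 4 * α) :
    IsTimeWeight T α (fun t => σ t ^ (-2 * α)) γ (fun t => theta s (lam * t)) where
  κ_pos t ht := rpow_pos_of_pos (hγ t ht).2.2.1 _
  γ_ge t ht := (hγ t ht).1
  θ_nonneg t ht := (hθ t ht).1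
  θ_cont := continuousOn_theta.comp (by fun_prop) fun t ht => ⟨mul_pos hlam ht.1, by
    have := ht.2.trans_le hT
    rwa [lt_div_iff₀ hlam, mul_comm] at this⟩
  γ_deriv t ht := (hγ t ht).2.2.2.1
  κ_deriv t ht := by
    have hs := (hγ t ht).2.2.1
    refine ((hγ t ht).2.2.2.2.rpow_const (p := -2 * α) (Or.inl hs.ne')).congr_deriv ?_
    rw [rpow_sub_one hs.ne']
    have h1 : γ t ≠ 0 := by linarith [(hγ t ht).1]
    have h2 := ht.1.ne'
    have h3 := hs.ne'
    field_simp
  γθ_le t ht := by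
    have h1 := mul_le_mul_of_nonneg_right (hγ t ht).2.1 (hθ t ht).1
    exact h1.trans (hθ t ht).2

/-- The bound R²t ≤ 1 compensates the R² of the time derivative, and R√t ≤ 1 turns R|x| from x·∇Q
into |x|/√t. This is the reason for the weight 1 + |x|/√t in the trace inequality. -/
theorem rescaled_term_bound {s C A K R t q qt qx N θ : ℝ} (hs : 1 / 2 ≤ s) (hs' : s < 1) (hA : 0 ≤ A) (hK : 0 ≤ K)
    (hR : 1 ≤ R) (ht : 0 < t) (hRt : R ^ 2 * t ≤ 1) (hN : 0 ≤ N) (hC : 0 ≤ C) (hθ0 : 0 ≤ θ) (hθ : θ ≤ C)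
    (hq : |q| ≤ A * K) (hqt : |qt| ≤ A * (K * R ^ 2)) (hqx : |qx| ≤ A * (K * (R * N))) :
    |(s + θ / 2) * q + (t * qt + qx / 2)| ≤ K * (2 + C) * A * (1 + N / √t) := by
  have hr := sqrt_pos.2 ht
  have hrt : √t ^ 2 = t := sq_sqrt ht.le
  have hR1 : R * √t ≤ 1 := by
    have h : (R * √t) ^ 2 ≤ 1 ^ 2 := by rw [mul_pow, hrt]; linarith
    exact (pow_le_pow_iff_left₀ (by positivity) zero_le_one two_ne_zero).1 h
  have hRN : R * N ≤ N / √t := by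
    rw [le_div_iff₀ hr]
    calc R * N * √t = R * √t * N := by ring
      _ ≤ 1 * N := by gcongr
      _ = N := one_mul N
  have h1 : |(s + θ / 2) * q| ≤ (1 + C / 2) * (A * K) := by
    rw [abs_mul, abs_of_nonneg (by positivity)]
    gcongr
  have h2 : |t * qt| ≤ A * K := by
    rw [abs_mul, abs_of_pos ht]
    calc t * |qt| ≤ t * (A * (K * R ^ 2)) := by gcongr
      _ = A * K * (R ^ 2 * t) := by ring
      _ ≤ A * K * 1 := by gcongr
      _ = _ := mul_one _
  have h3 : |qx / 2| ≤ A * K * (N / √t) / 2 := by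
    rw [abs_div, abs_two]
    calc |qx| / 2 ≤ A * (K * (R * N)) / 2 := by gcongr
      _ ≤ A * (K * (N / √t)) / 2 := by gcongr
      _ = _ := by ring
  have h4 := abs_add_le ((s + θ / 2) * q) (t * qt + qx / 2)
  have h5 := abs_add_le (t * qt) (qx / 2)
  have hAK : 0 ≤ A * K := by positivity
  have hX : 0 ≤ A * K * (N / √t) := by positivity
  have hY : 0 ≤ A * K * C := by positivity
  have hZ : 0 ≤ A * K * (N / √t) * C := by positivity
  nlinarith

/-- The smallness of the boundary coefficients: `8 Λ (R² t)^s ≤ (λ t)^s`. -/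
theorem scaling_bound {s Λ R t lam : ℝ} (hs : 1 / 2 ≤ s) {M : ℝ} (hM : 1 ≤ M) (hΛM : (8 * Λ) ^ 2 ≤ M) (hR : 1 ≤ R)
    (ht : 0 < t) (hlam : M * R ^ 2 ≤ lam) : 8 * Λ * (R ^ (2 * s) * t ^ s) ≤ (lam * t) ^ s := by
  have h1 : R ^ (2 * s) = (R ^ 2) ^ s := by
    rw [← rpow_natCast R 2, ← rpow_mul (by linarith)]; norm_num
  -- For s ≥ 1/2 and M ≥ 1, M^s dominates √M, so M ≥ (8Λ)² is enough.
  have h2 : 8 * Λ ≤ M ^ s := by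
    calc 8 * Λ ≤ √M := le_sqrt_of_sq_le hΛM
      _ = M ^ (1 / 2 : ℝ) := sqrt_eq_rpow M
      _ ≤ M ^ s := rpow_le_rpow_of_exponent_le hM hs
  have hM0 : 0 ≤ M := by linarith
  calc 8 * Λ * (R ^ (2 * s) * t ^ s) ≤ M ^ s * (R ^ (2 * s) * t ^ s) := by
        have : 0 ≤ R := by linarith
        gcongr
    _ = (M * R ^ 2 * t) ^ s := by
        rw [h1, mul_rpow (by positivity) ht.le, mul_rpow hM0 (by positivity)]; ring
    _ ≤ (lam * t) ^ s := by gcongr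


/-- The Carleman estimate in its final form, from the version with absorbed boundary terms. -/
theorem estimate_of_absorbed {a τ T₁ α Γ M c : ℝ} {σ γ θ : ℝ → ℝ} {w : EuclideanSpace ℝ (Fin n) → ℝ → ℝ → ℝ}
    {gX : Fin n → EuclideanSpace ℝ (Fin n) × ℝ × ℝ → ℝ} {gt gφ gf : EuclideanSpace ℝ (Fin n) × ℝ × ℝ → ℝ}
    (hJ : JetExt a τ T₁ (fun p => w p.1 p.2.1 p.2.2) gX gt gφ gf) (ha1 : -1 < a) (ha2 : a < 1)
    (hκ : IsTimeWeight T₁ α (fun t => σ t ^ (-2 * α)) γ θ) (hcT : c ∈ Ioo 0 T₁) (hα0 : 0 < α) (hσc : ContinuousOn σ (Ioo 0 T₁))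
    (hb : ∀ t ∈ Ioo 0 T₁, 0 < σ t ∧ σ t ≤ t ∧ t ≤ Γ * σ t ∧ γ t ≤ Γ)
    (hθlam : ∀ t ∈ Ioo 0 T₁, α * t ≤ θ t) (hM16 : 16 ≤ M) (hMΓ : 8 * Γ ^ 2 ≤ M)
    (main : α * (∫ p, (σ p.2.2 ^ (-2 * α) * (θ p.2.2 / p.2.2)) * (w p.1 p.2.1 p.2.2 ^ 2 * wgt a p) ∂slab n 0 c)
        + ∫ p, (σ p.2.2 ^ (-2 * α) * θ p.2.2) * (gradN (fun p => w p.1 p.2.1 p.2.2) p * wgt a p) ∂slab n 0 c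
      ≤ 8 * (∫ p, (σ p.2.2 ^ (-2 * α) * (p.2.2 * γ p.2.2)) * (gf p ^ 2 * wgt a p) ∂slab n 0 c)
        + (16 * α * σ c ^ (-2 * α) * massAt a (fun p => w p.1 p.2.1 p.2.2) c
          - 4 * σ c ^ (-2 * α) * c * energyAt a (fun p => w p.1 p.2.1 p.2.2) c)) :
        (IntegrableOn (fun p : EuclideanSpace ℝ (Fin n) × ℝ × ℝ =>
            p.2.1 ^ a * σ p.2.2 ^ (-2 * α) * w p.1 p.2.1 p.2.2 ^ 2
              * gaussian a p.1 p.2.1 p.2.2) (halfSpaceTime n c) ∧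
          IntegrableOn (fun p : EuclideanSpace ℝ (Fin n) × ℝ × ℝ =>
            p.2.1 ^ a * σ p.2.2 ^ (1 - 2 * α) * gradSq w p.1 p.2.1 p.2.2
              * gaussian a p.1 p.2.1 p.2.2) (halfSpaceTime n c) ∧
          IntegrableOn (fun p : EuclideanSpace ℝ (Fin n) × ℝ × ℝ =>
            σ p.2.2 ^ (1 - 2 * α) * p.2.1 ^ (-a) * |backwardOp a w p.1 p.2.1 p.2.2| ^ 2
              * gaussian a p.1 p.2.1 p.2.2) (halfSpaceTime n c) ∧
          IntegrableOn (fun q : EuclideanSpace ℝ (Fin n) × ℝ =>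
            q.2 ^ a * gradSq w q.1 q.2 c * gaussian a q.1 q.2 c)
            (halfSpace n) ∧
          IntegrableOn (fun q : EuclideanSpace ℝ (Fin n) × ℝ =>
            q.2 ^ a * w q.1 q.2 c ^ 2 * gaussian a q.1 q.2 c)
            (halfSpace n)) ∧
        -- the Carleman estimate
        α ^ 2 * (∫ p in halfSpaceTime n c,
            p.2.1 ^ a * σ p.2.2 ^ (-2 * α) * w p.1 p.2.1 p.2.2 ^ 2
              * gaussian a p.1 p.2.1 p.2.2)
          + α * (∫ p in halfSpaceTime n c,
            p.2.1 ^ a * σ p.2.2 ^ (1 - 2 * α) * gradSq w p.1 p.2.1 p.2.2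
              * gaussian a p.1 p.2.1 p.2.2)
          ≤ M * (∫ p in halfSpaceTime n c,
              σ p.2.2 ^ (1 - 2 * α) * p.2.1 ^ (-a)
                * |backwardOp a w p.1 p.2.1 p.2.2| ^ 2
                * gaussian a p.1 p.2.1 p.2.2)
            + σ c ^ (-2 * α) *
              (-(c / M) * (∫ q in halfSpace n,
                  q.2 ^ a * gradSq w q.1 q.2 c * gaussian a q.1 q.2 c)
                + M * α * (∫ q in halfSpace n,
                  q.2 ^ a * w q.1 q.2 c ^ 2 * gaussian a q.1 q.2 c)) := by
  have hc := hcT.1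
  have hσ0 : ∀ t ∈ Ioo 0 T₁, 0 < σ t := fun t ht => (hb t ht).1
  set W : EuclideanSpace ℝ (Fin n) × ℝ × ℝ → ℝ := fun p => w p.1 p.2.1 p.2.2 with hW
  have cκ : ContinuousOn (fun t => σ t ^ (-2 * α)) (Ioo 0 T₁) := hκ.κ_cont
  have cσ : ContinuousOn (fun t => σ t ^ (1 - 2 * α)) (Ioo 0 T₁) :=
    hσc.rpow_const fun t ht => Or.inl (hσ0 t ht).ne'
  have eσ : ∀ t ∈ Ioo 0 T₁, σ t ^ (1 - 2 * α) = σ t ^ (-2 * α) * σ t := fun t ht => by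
    rw [← rpow_add_one (hσ0 t ht).ne']; congr 1; ring
  have iH := JetExt.integrable_sq hJ.W_nice ha1 cκ hc
  have iD := hJ.integrable_gradN ha1 ha2 cσ hc
  have iF := JetExt.integrable_sq hJ.gf_nice ha1 cσ hc
  have jH := JetExt.integrable_sq_slice hJ.W_nice ha1 hc
  have jD := hJ.integrable_gradN_slice ha1 ha2 hc
  have eH : (fun p : EuclideanSpace ℝ (Fin n) × ℝ × ℝ => σ p.2.2 ^ (-2 * α) * (W p ^ 2 * wgt a p))
      =ᵐ[slab n 0 c] fun p => p.2.1 ^ a * σ p.2.2 ^ (-2 * α) * w p.1 p.2.1 p.2.2 ^ 2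
              * gaussian a p.1 p.2.1 p.2.2 := Eventually.of_forall fun p => by
    simp only [hW, wgt]; ring
  have eD : (fun p : EuclideanSpace ℝ (Fin n) × ℝ × ℝ =>
        σ p.2.2 ^ (1 - 2 * α) * (gradN W p * wgt a p))
      =ᵐ[slab n 0 c] fun p => p.2.1 ^ a * σ p.2.2 ^ (1 - 2 * α) * gradSq w p.1 p.2.1 p.2.2
              * gaussian a p.1 p.2.1 p.2.2 := by
    filter_upwards [ae_slab 0 c] with p hp
    rw [gradSq_eq hJ.smooth hp.1 (hc.trans hp.2) p.1, wgt]
    ring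
  have eF : (fun p : EuclideanSpace ℝ (Fin n) × ℝ × ℝ => σ p.2.2 ^ (1 - 2 * α) * (gf p ^ 2 * wgt a p))
      =ᵐ[slab n 0 c] fun p => σ p.2.2 ^ (1 - 2 * α) * p.2.1 ^ (-a)
                * |backwardOp a w p.1 p.2.1 p.2.2| ^ 2
                * gaussian a p.1 p.2.1 p.2.2 := by
    filter_upwards [ae_slab 0 c] with p hp
    have hyy : p.2.1 ^ (-a) * p.2.1 ^ a = 1 := by rw [← rpow_add hp.1]; simp
    rw [backwardOp_eq hJ.smooth hp.1 (hc.trans hp.2) p.1, sq_abs,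
      hJ.gf_eq (p.1, p.2.1, p.2.2) ⟨hp.1, hc.trans hp.2⟩, wgt]
    linear_combination (-(σ p.2.2 ^ (1 - 2 * α) * gf p ^ 2 * p.2.1 ^ a * gaussian a p.1 p.2.1 p.2.2)) * hyy
  have eHs : (fun q : EuclideanSpace ℝ (Fin n) × ℝ => W (q.1, q.2, c) ^ 2 * wgt a (q.1, q.2, c))
      =ᵐ[halfSlab n 0] fun q => q.2 ^ a * w q.1 q.2 c ^ 2 * gaussian a q.1 q.2 c :=
    Eventually.of_forall fun p => by simp only [hW, wgt]; ring
  have eDs : (fun q : EuclideanSpace ℝ (Fin n) × ℝ => gradN W (q.1, q.2, c) * wgt a (q.1, q.2, c))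
      =ᵐ[halfSlab n 0] fun q => q.2 ^ a * gradSq w q.1 q.2 c * gaussian a q.1 q.2 c := by
    filter_upwards [ae_halfSlab 0] with q hq
    rw [gradSq_eq hJ.smooth hq hc q.1, wgt]
    ring
  simp only [IntegrableOn, restrict_halfSpaceTime, restrict_halfSpace]
  refine ⟨⟨iH.congr eH, iD.congr eD, iF.congr eF, jD.congr eDs, jH.congr eHs⟩, ?_⟩
  rw [← integral_congr_ae eH, ← integral_congr_ae eD, ← integral_congr_ae eF, ← integral_congr_ae eHs,
    ← integral_congr_ae eDs]
  change _ ≤ _ + σ c ^ (-2 * α) * (-(c / M) * energyAt a W c + M * α * massAt a W c)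
  have iP1 := JetExt.integrable_sq hJ.W_nice ha1 (h := fun t => σ t ^ (-2 * α) * (θ t / t))
    (cκ.mul (hκ.θ_cont.div continuousOn_id fun _ ht => ht.1.ne')) hc
  have iP2 := hJ.integrable_gradN ha1 ha2 (h := fun t => σ t ^ (-2 * α) * θ t) (cκ.mul hκ.θ_cont) hc
  have iF' := JetExt.integrable_sq hJ.gf_nice ha1 hκ.cont_op hc
  have vW := hJ.W_nice.sq_wgt_nonneg_vanish (a := a)
  have vf := hJ.gf_nice.sq_wgt_nonneg_vanish (a := a)
  have vD := hJ.gradN_wgt_nonneg_vanish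
  have hκp : ∀ t ∈ Ioo 0 T₁, 0 < σ t ^ (-2 * α) := fun t ht => hκ.κ_pos t ht
  -- The second factor α of the theorem comes from θ/t ≥ α.
  have m1 : α * (∫ p, σ p.2.2 ^ (-2 * α) * (W p ^ 2 * wgt a p) ∂slab n 0 c)
      ≤ ∫ p, (σ p.2.2 ^ (-2 * α) * (θ p.2.2 / p.2.2)) * (W p ^ 2 * wgt a p) ∂slab n 0 c := by
    have i := iH.const_mul α
    rw [← integral_const_mul]
    simp only [← mul_assoc α] at i ⊢
    refine integral_time_mono (h₁ := fun t => α * σ t ^ (-2 * α))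
      (h₂ := fun t => σ t ^ (-2 * α) * (θ t / t)) hc i iP1 (fun t ht => ?_) vW.1 vW.2
    rw [mul_comm α]
    refine mul_le_mul_of_nonneg_left ?_ (hκp t ht).le
    rw [le_div_iff₀ ht.1]
    exact hθlam t ht
  -- Here σ ≤ t and αt ≤ θ turn the weight κθ into ασ^(1-2α).
  have m2 : α * (∫ p, σ p.2.2 ^ (1 - 2 * α) * (gradN W p * wgt a p) ∂slab n 0 c)
      ≤ ∫ p, (σ p.2.2 ^ (-2 * α) * θ p.2.2) * (gradN W p * wgt a p) ∂slab n 0 c := by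
    have i := iD.const_mul α
    rw [← integral_const_mul]
    simp only [← mul_assoc α] at i ⊢
    refine integral_time_mono (h₁ := fun t => α * σ t ^ (1 - 2 * α))
      (h₂ := fun t => σ t ^ (-2 * α) * θ t) hc i iP2 (fun t ht => ?_) vD.1 vD.2
    have h1 := (hb t ht).2.1
    have h2 := hκp t ht
    calc α * σ t ^ (1 - 2 * α) = σ t ^ (-2 * α) * (α * σ t) := by rw [eσ t ht]; ring
      _ ≤ σ t ^ (-2 * α) * (α * t) := by gcongr
      _ ≤ σ t ^ (-2 * α) * θ t := by have := hθlam t ht; gcongr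
  -- Since t ≤ Γσ and γ ≤ Γ, the multiplier κtγ is at most Γ² σ^(1-2α).
  have m3 : (∫ p, (σ p.2.2 ^ (-2 * α) * (p.2.2 * γ p.2.2)) * (gf p ^ 2 * wgt a p) ∂slab n 0 c)
      ≤ Γ ^ 2 * ∫ p, σ p.2.2 ^ (1 - 2 * α) * (gf p ^ 2 * wgt a p) ∂slab n 0 c := by
    have i := iF.const_mul (Γ ^ 2)
    rw [← integral_const_mul]
    simp only [← mul_assoc (Γ ^ 2)] at i ⊢
    refine integral_time_mono (h₁ := fun t => σ t ^ (-2 * α) * (t * γ t))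
      (h₂ := fun t => Γ ^ 2 * σ t ^ (1 - 2 * α)) hc iF' i (fun t ht => ?_) vf.1 vf.2
    have h4 := (hb t ht).2.2.1
    have h2 := hκp t ht
    have h3 := (hb t ht).2.2.2
    have ht0 := ht.1
    have h5 := hσ0 t ht
    have h6 : 0 ≤ γ t := zero_le_one.trans (hκ.γ_ge t ht)
    have h7 : 0 ≤ Γ * σ t := ht0.le.trans h4
    calc σ t ^ (-2 * α) * (t * γ t) ≤ σ t ^ (-2 * α) * (Γ * σ t * Γ) := by gcongr
      _ = Γ ^ 2 * σ t ^ (1 - 2 * α) := by rw [eσ t ht]; ring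
  have m4 : 0 ≤ ∫ p, σ p.2.2 ^ (1 - 2 * α) * (gf p ^ 2 * wgt a p) ∂slab n 0 c := by
    have := integral_time_mono (T := T₁) (h₁ := fun _ => 0) (h₂ := fun t => σ t ^ (1 - 2 * α)) hc (by simp) iF
      (fun t ht => (rpow_pos_of_pos (hσ0 t ht) _).le) vf.1 vf.2
    simpa using this
  have hm := massAt_nonneg (a := a) (W := W) hc
  have he := energyAt_nonneg (a := a) (W := W) hc
  have hκc := hκp c hcT
  set IH := ∫ p, σ p.2.2 ^ (-2 * α) * (W p ^ 2 * wgt a p) ∂slab n 0 c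
  set ID := ∫ p, σ p.2.2 ^ (1 - 2 * α) * (gradN W p * wgt a p) ∂slab n 0 c
  set IF := ∫ p, σ p.2.2 ^ (1 - 2 * α) * (gf p ^ 2 * wgt a p) ∂slab n 0 c
  set k := σ c ^ (-2 * α)
  set H := massAt a W c
  set D := energyAt a W c
  have f1 : α ^ 2 * IH ≤ α * ∫ p, (σ p.2.2 ^ (-2 * α) * (θ p.2.2 / p.2.2)) * (W p ^ 2 * wgt a p)
      ∂slab n 0 c := by
    rw [sq, mul_assoc]; exact mul_le_mul_of_nonneg_left m1 hα0.le
  have f2 : 8 * (Γ ^ 2 * IF) ≤ M * IF := by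
    rw [← mul_assoc]; exact mul_le_mul_of_nonneg_right hMΓ m4
  have f3 : 16 * α * k * H ≤ k * (M * α * H) := by
    have : 16 * (α * k * H) ≤ M * (α * k * H) := mul_le_mul_of_nonneg_right hM16 (by positivity)
    linarith
  have f4 : k * (c / M * D) ≤ 4 * k * c * D := by
    have h1 : c / M ≤ 4 * c := by
      rw [div_le_iff₀ (by linarith)]; nlinarith
    calc k * (c / M * D) ≤ k * (4 * c * D) := by gcongr
      _ = _ := by ring
  have f5 : k * (-(c / M) * D + M * α * H) = k * (M * α * H) - k * (c / M * D) := by ring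
  rw [f5]
  linarith

set_option maxHeartbeats 1000000 in
/-- The Carleman estimate with its constants made explicit. -/
theorem estimate_of_constants {s a K C N Γ Λ M : ℝ} (hs : 1 / 2 ≤ s) (hs' : s < 1) (ha : a = 1 - 2 * s) (hC : 0 < C)
    (hθC : ∀ r ∈ Ioo (0 : ℝ) 1, 0 ≤ theta s r ∧ theta s r ≤ C * r ^ (s / 2))
    (hw : ∀ (lam : ℝ) (σ : ℝ → ℝ), 0 < lam → IsCarlemanWeight s lam σ → ∃ γ : ℝ → ℝ, ∀ t ∈ Ioo 0 (1 / lam),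
      1 ≤ γ t ∧ γ t ≤ exp N ∧ t * exp (-N) ≤ σ t ∧ σ t ≤ t ∧
      HasDerivAt γ (γ t * theta s (lam * t) / t) t ∧ HasDerivAt σ (σ t / (t * γ t)) t)
    (hΓ : Γ = exp N) (hΓ1 : 1 ≤ Γ) (hΛ : Λ = Γ * (|K| * (2 + C)) * (20 * n + 80)) (hM16 : 16 ≤ M)
    (hMΓ : 8 * Γ ^ 2 ≤ M) (hMC : Γ * C ≤ M) (hMΛ : (8 * Λ) ^ 2 ≤ M) {T : ℝ} {V : EuclideanSpace ℝ (Fin n) → ℝ → ℝ}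
    {x₀ : EuclideanSpace ℝ (Fin n)} {t₁ R δ α lam c : ℝ} {σ : ℝ → ℝ} {w : EuclideanSpace ℝ (Fin n) → ℝ → ℝ → ℝ}
    (hV : HasC2Bound V T K) (ht₁ : 0 ≤ t₁) (hT : t₁ + 1 ≤ T) (hR : 1 ≤ R) (hδ : 0 < δ) (hδ' : δ ≤ 1 / 2)
    (hα : M * R ^ 2 ≤ α) (hlam : lam = α / δ ^ 2) (hc : 0 < c) (hc' : c ≤ 1 / (5 * lam))
    (hσ : IsCarlemanWeight s lam σ) (htest : IsTestFunction a (1 / (exp 1 * lam)) w)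
    (hbd : ∀ (x : EuclideanSpace ℝ (Fin n)) (t : ℝ), 0 < t → t < 1 / (exp 1 * lam) →
      HasWeightedNormalDeriv a w x t (R ^ (2 * s) * rescaledPotential V x₀ t₁ R x t * w x 0 t)) :
    (IntegrableOn (fun p : EuclideanSpace ℝ (Fin n) × ℝ × ℝ =>
            p.2.1 ^ a * σ p.2.2 ^ (-2 * α) * w p.1 p.2.1 p.2.2 ^ 2
              * gaussian a p.1 p.2.1 p.2.2) (halfSpaceTime n c) ∧
          IntegrableOn (fun p : EuclideanSpace ℝ (Fin n) × ℝ × ℝ =>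
            p.2.1 ^ a * σ p.2.2 ^ (1 - 2 * α) * gradSq w p.1 p.2.1 p.2.2
              * gaussian a p.1 p.2.1 p.2.2) (halfSpaceTime n c) ∧
          IntegrableOn (fun p : EuclideanSpace ℝ (Fin n) × ℝ × ℝ =>
            σ p.2.2 ^ (1 - 2 * α) * p.2.1 ^ (-a) * |backwardOp a w p.1 p.2.1 p.2.2| ^ 2
              * gaussian a p.1 p.2.1 p.2.2) (halfSpaceTime n c) ∧
          IntegrableOn (fun q : EuclideanSpace ℝ (Fin n) × ℝ =>
            q.2 ^ a * gradSq w q.1 q.2 c * gaussian a q.1 q.2 c)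
            (halfSpace n) ∧
          IntegrableOn (fun q : EuclideanSpace ℝ (Fin n) × ℝ =>
            q.2 ^ a * w q.1 q.2 c ^ 2 * gaussian a q.1 q.2 c)
            (halfSpace n)) ∧
        -- the Carleman estimate
        α ^ 2 * (∫ p in halfSpaceTime n c,
            p.2.1 ^ a * σ p.2.2 ^ (-2 * α) * w p.1 p.2.1 p.2.2 ^ 2
              * gaussian a p.1 p.2.1 p.2.2)
          + α * (∫ p in halfSpaceTime n c,
            p.2.1 ^ a * σ p.2.2 ^ (1 - 2 * α) * gradSq w p.1 p.2.1 p.2.2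
              * gaussian a p.1 p.2.1 p.2.2)
          ≤ M * (∫ p in halfSpaceTime n c,
              σ p.2.2 ^ (1 - 2 * α) * p.2.1 ^ (-a)
                * |backwardOp a w p.1 p.2.1 p.2.2| ^ 2
                * gaussian a p.1 p.2.1 p.2.2)
            + σ c ^ (-2 * α) *
              (-(c / M) * (∫ q in halfSpace n,
                  q.2 ^ a * gradSq w q.1 q.2 c * gaussian a q.1 q.2 c)
                + M * α * (∫ q in halfSpace n,
                  q.2 ^ a * w q.1 q.2 c ^ 2 * gaussian a q.1 q.2 c)) := by
  have hs0 : 0 < s := by linarith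
  have ha1 : -1 < a := by linarith
  have ha0 : a ≤ 0 := by linarith
  have ha2 : a < 1 := by linarith
  have hR0 : 0 < R := by linarith
  have hR2 : 1 ≤ R ^ 2 := one_le_pow₀ hR
  have hαM : M ≤ α := by nlinarith
  have hα0 : 0 < α := by linarith
  have hαlam : α ≤ lam := by
    rw [hlam, le_div_iff₀ (by positivity)]
    have : δ ^ 2 ≤ 1 := by nlinarith
    nlinarith
  have hlam0 : 0 < lam := by linarith
  set T₁ := 1 / (exp 1 * lam) with hT₁
  have hT₁le : T₁ ≤ 1 / lam := one_div_le_one_div_of_le hlam0 (by nlinarith [add_one_le_exp (1 : ℝ)])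
  have hlt : ∀ t ∈ Ioo 0 T₁, 0 < lam * t ∧ lam * t ≤ 1 / exp 1 ∧ lam * t < 1 := by
    intro t ht
    have h1 : lam * t < 1 / exp 1 := by
      have := ht.2
      rw [hT₁, lt_div_iff₀ (by positivity)] at this
      rw [lt_div_iff₀ (exp_pos 1)]
      linarith
    have h2 : 1 / exp 1 ≤ 1 := by
      rw [div_le_one (exp_pos 1)]; linarith [add_one_le_exp (1 : ℝ)]
    exact ⟨mul_pos hlam0 ht.1, h1.le, h1.trans_le h2⟩
  -- The factor 5 in c ≤ 1/(5λ) exceeds e, so c lies strictly inside the time interval.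
  have hcT : c ∈ Ioo 0 T₁ := ⟨hc, hc'.trans_lt (one_div_lt_one_div_of_lt (by positivity)
    (by have := exp_one_lt_three; nlinarith))⟩
  have hRt : ∀ t ∈ Ioo 0 T₁, R ^ 2 * t < 1 := by
    intro t ht
    have h1 := (hlt t ht).2.2
    have h2 : R ^ 2 ≤ lam := by nlinarith
    nlinarith [ht.1]
  obtain ⟨γ, hγ⟩ := hw lam σ hlam0 hσ
  rw [← hΓ] at hγ
  have hin : ∀ t ∈ Ioo 0 T₁, t ∈ Ioo 0 (1 / lam) := fun t ht => ⟨ht.1, ht.2.trans_le hT₁le⟩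
  have hσ0 : ∀ t ∈ Ioo 0 T₁, 0 < σ t := fun t ht => hσ.pos t (hin t ht)
  set θ : ℝ → ℝ := fun t => theta s (lam * t) with hθdef
  have hθ0 : ∀ t ∈ Ioo 0 T₁, 0 ≤ θ t := fun t ht => (hθC _ ⟨(hlt t ht).1, (hlt t ht).2.2⟩).1
  have hθC' : ∀ t ∈ Ioo 0 T₁, θ t ≤ C := fun t ht =>
    (hθC _ ⟨(hlt t ht).1, (hlt t ht).2.2⟩).2.trans (mul_le_of_le_one_right hC.le
      (rpow_le_one (hlt t ht).1.le (hlt t ht).2.2.le (by positivity)))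
  have hθs : ∀ t ∈ Ioo 0 T₁, (lam * t) ^ s ≤ θ t := fun t ht =>
    rpow_le_theta hs0 (hlt t ht).1 (hlt t ht).2.1
  -- The chain is αt ≤ λt ≤ (λt)^s ≤ θ, using λt < 1, s < 1 and the range λt ≤ 1/e.
  have hθlam : ∀ t ∈ Ioo 0 T₁, α * t ≤ θ t := fun t ht => by
    have h1 : lam * t ≤ (lam * t) ^ s := by
      have := rpow_le_rpow_of_exponent_ge (hlt t ht).1 (hlt t ht).2.2.le hs'.le
      rwa [rpow_one] at this
    have h2 : α * t ≤ lam * t := by have := ht.1; gcongr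
    exact h2.trans (h1.trans (hθs t ht))
  have hκ : IsTimeWeight T₁ α (fun t => σ t ^ (-2 * α)) γ θ :=
    isTimeWeight_of_bounds (Γ := Γ) hlam0 hT₁le (fun t ht =>
      ⟨(hγ t (hin t ht)).1, (hγ t (hin t ht)).2.1, hσ0 t ht, (hγ t (hin t ht)).2.2.2.2⟩)
      fun t ht => ⟨hθ0 t ht, by
        have := mul_le_mul_of_nonneg_left (hθC' t ht) (by linarith : 0 ≤ Γ)
        linarith⟩
  set A := R ^ (2 * s) with hA
  have hA0 : 0 < A := rpow_pos_of_pos hR0 _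
  obtain ⟨Qt, Qx, hQ, hQb⟩ := exists_potential (T := T₁) hV x₀ ht₁ hR0 hA0.le
    fun t ht => by have := hRt t ht; linarith
  -- The existence of a potential bounded by K forces K ≥ 0, so |K| in the constants may be read as
  -- K.
  have hK0 : 0 ≤ K := by
    have h1 := (abs_nonneg _).trans (hQb 0 c hcT).1
    exact nonneg_of_mul_nonneg_right h1 hA0
  have hKabs : |K| = K := abs_of_nonneg hK0
  obtain ⟨τ, gX, gt, gφ, gf, hJ⟩ := exists_jetExt htest
  have hb : ∀ x t, 0 < t → t < T₁ → gφ (x, 0, t) = A * rescaledPotential V x₀ t₁ R x t * w x 0 t :=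
    fun x t ht ht' => hJ.flux_eq_of_normalDeriv ht (hbd x t ht ht')
  -- Since (1+a)/2 = 1 - s, the loss in the trace inequality is t^(s-1), matching θ/t ≥ (λt)^s/t in
  -- its power of t.
  have hpow : ∀ t : ℝ, 0 < t → t ^ (-(1 + a) / 2) = t ^ s / t := fun t ht => by
    rw [← rpow_sub_one ht.ne', ha]; congr 1; ring
  have hscale : ∀ t ∈ Ioo 0 T₁, 8 * Λ * (A * t ^ s) ≤ (lam * t) ^ s := fun t ht =>
    scaling_bound hs (by linarith) hMΛ hR ht.1 (hα.trans hαlam)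
  have hcoef : ∀ t ∈ Ioo 0 T₁, γ t * (K * (2 + C) * A) * ((20 * n + 80) * t ^ (-(1 + a) / 2))
      ≤ Λ * (A * t ^ s) / t := fun t ht => by
    have h1 := (hγ t (hin t ht)).2.1
    have ht0 := ht.1
    rw [hpow t ht0, hΛ, hKabs]
    calc γ t * (K * (2 + C) * A) * ((20 * n + 80) * (t ^ s / t))
        ≤ Γ * (K * (2 + C) * A) * ((20 * n + 80) * (t ^ s / t)) := by gcongr
      _ = _ := by ring
  have main := carleman_absorbed (B := K * (2 + C) * A) (B₀ := K * A) hJ ha1 ha0 hκ (by linarith) hQ hb hcT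
    (by positivity) (fun x => by rw [mul_comm K]; exact (hQb x c hcT).1)
    (fun x t ht => by
      have e : (1 - a) / 2 = s := by rw [ha]; ring
      rw [e]
      exact rescaled_term_bound hs hs' hA0.le hK0 hR ht.1 (hRt t ht).le (norm_nonneg x) hC.le (hθ0 t ht)
        (hθC' t ht) (hQb x t ht).1 (hQb x t ht).2.1 (hQb x t ht).2.2)
    (by
      have h1 := hcoef c hcT
      have h2 := hscale c hcT
      -- With λc < 1 the scaling bound gives ΛAc^s ≤ 1/8, more than the 1/2 required.
      have h3 : (lam * c) ^ s ≤ 1 := rpow_le_one (hlt c hcT).1.le (hlt c hcT).2.2.le hs0.le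
      have h4 : 1 ≤ γ c := (hγ c (hin c hcT)).1
      have hp : 0 < c ^ (-(1 + a) / 2) := rpow_pos_of_pos hc _
      calc c * γ c * (K * A) * ((20 * n + 80) * c ^ (-(1 + a) / 2))
          = c * (γ c * (K * 1 * A) * ((20 * n + 80) * c ^ (-(1 + a) / 2))) := by ring
        _ ≤ c * (γ c * (K * (2 + C) * A) * ((20 * n + 80) * c ^ (-(1 + a) / 2))) := by
            gcongr; linarith
        _ ≤ c * (Λ * (A * c ^ s) / c) := by gcongr
        _ = Λ * (A * c ^ s) := by field_simp
        _ ≤ 1 / 2 := by linarith)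
    (fun t ht => by
      have h1 := hcoef t ht
      have h2 := (hscale t ht).trans (hθs t ht)
      have ht0 := ht.1
      calc _ ≤ Λ * (A * t ^ s) / t := h1
        _ ≤ (1 / 8 * θ t) / t := div_le_div_of_nonneg_right (by linarith) ht0.le
        _ = _ := by ring)
  refine estimate_of_absorbed hJ ha1 ha2 hκ hcT hα0
    (fun t ht => (hγ t (hin t ht)).2.2.2.2.2.continuousAt.continuousWithinAt)
    (fun t ht => ⟨hσ0 t ht, (hγ t (hin t ht)).2.2.2.1, ?_, (hγ t (hin t ht)).2.1⟩) hθlam hM16 hMΓ main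
  have h1 := (hγ t (hin t ht)).2.2.1
  calc t = Γ * (t * exp (-N)) := by rw [exp_neg, hΓ]; field_simp
    _ ≤ Γ * σ t := by gcongr

end Carleman

theorem mainTheorem3 (n : ℕ) (hn : 1 ≤ n) (s a : ℝ) (hs : 1 / 2 ≤ s) (hs' : s < 1)
    (ha : a = 1 - 2 * s) (K : ℝ) :
    ∃ δ₀ M : ℝ, 0 < δ₀ ∧ δ₀ < 1 ∧ 1 < M ∧
      ∀ (T : ℝ) (V : EuclideanSpace ℝ (Fin n) → ℝ → ℝ) (x₀ : EuclideanSpace ℝ (Fin n))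
        (t₁ R δ α lam c : ℝ) (σ : ℝ → ℝ) (w : EuclideanSpace ℝ (Fin n) → ℝ → ℝ → ℝ),
        Carleman.HasC2Bound V T K → 0 ≤ t₁ → t₁ + 1 ≤ T → 1 ≤ R →
        0 < δ → δ ≤ δ₀ → M * R ^ 2 ≤ α → lam = α / δ ^ 2 →
        0 < c → c ≤ 1 / (5 * lam) →
        Carleman.IsCarlemanWeight s lam σ →
        Carleman.IsTestFunction a (1 / (Real.exp 1 * lam)) w →
        (∀ (x : EuclideanSpace ℝ (Fin n)) (t : ℝ), 0 < t → t < 1 / (Real.exp 1 * lam) →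
          Carleman.HasWeightedNormalDeriv a w x t
            (R ^ (2 * s) * Carleman.rescaledPotential V x₀ t₁ R x t * w x 0 t)) →
        -- all the integrals in the estimate converge
        (IntegrableOn (fun p : EuclideanSpace ℝ (Fin n) × ℝ × ℝ =>
            p.2.1 ^ a * σ p.2.2 ^ (-2 * α) * w p.1 p.2.1 p.2.2 ^ 2
              * Carleman.gaussian a p.1 p.2.1 p.2.2) (Carleman.halfSpaceTime n c) ∧
          IntegrableOn (fun p : EuclideanSpace ℝ (Fin n) × ℝ × ℝ =>
            p.2.1 ^ a * σ p.2.2 ^ (1 - 2 * α) * Carleman.gradSq w p.1 p.2.1 p.2.2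
              * Carleman.gaussian a p.1 p.2.1 p.2.2) (Carleman.halfSpaceTime n c) ∧
          IntegrableOn (fun p : EuclideanSpace ℝ (Fin n) × ℝ × ℝ =>
            σ p.2.2 ^ (1 - 2 * α) * p.2.1 ^ (-a) * |Carleman.backwardOp a w p.1 p.2.1 p.2.2| ^ 2
              * Carleman.gaussian a p.1 p.2.1 p.2.2) (Carleman.halfSpaceTime n c) ∧
          IntegrableOn (fun q : EuclideanSpace ℝ (Fin n) × ℝ =>
            q.2 ^ a * Carleman.gradSq w q.1 q.2 c * Carleman.gaussian a q.1 q.2 c)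
            (Carleman.halfSpace n) ∧
          IntegrableOn (fun q : EuclideanSpace ℝ (Fin n) × ℝ =>
            q.2 ^ a * w q.1 q.2 c ^ 2 * Carleman.gaussian a q.1 q.2 c)
            (Carleman.halfSpace n)) ∧
        -- the Carleman estimate
        α ^ 2 * (∫ p in Carleman.halfSpaceTime n c,
            p.2.1 ^ a * σ p.2.2 ^ (-2 * α) * w p.1 p.2.1 p.2.2 ^ 2
              * Carleman.gaussian a p.1 p.2.1 p.2.2)
          + α * (∫ p in Carleman.halfSpaceTime n c,
            p.2.1 ^ a * σ p.2.2 ^ (1 - 2 * α) * Carleman.gradSq w p.1 p.2.1 p.2.2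
              * Carleman.gaussian a p.1 p.2.1 p.2.2)
          ≤ M * (∫ p in Carleman.halfSpaceTime n c,
              σ p.2.2 ^ (1 - 2 * α) * p.2.1 ^ (-a)
                * |Carleman.backwardOp a w p.1 p.2.1 p.2.2| ^ 2
                * Carleman.gaussian a p.1 p.2.1 p.2.2)
            + σ c ^ (-2 * α) *
              (-(c / M) * (∫ q in Carleman.halfSpace n,
                  q.2 ^ a * Carleman.gradSq w q.1 q.2 c * Carleman.gaussian a q.1 q.2 c)
                + M * α * (∫ q in Carleman.halfSpace n,
                  q.2 ^ a * w q.1 q.2 c ^ 2 * Carleman.gaussian a q.1 q.2 c)) := by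
  have hs0 : 0 < s := by linarith
  obtain ⟨C, hC, hθC⟩ := Carleman.theta_le hs0
  obtain ⟨N, hN, hw⟩ := Carleman.weight_bounds hs0
  set Γ := exp N with hΓ
  have hΓ1 : 1 ≤ Γ := one_le_exp hN.le
  set Λ := Γ * (|K| * (2 + C)) * (20 * n + 80) with hΛ
  -- The summands serve in turn the mass term at t = c, the operator term, the condition γθ ≤ 4α,
  -- and the absorption of the thin-set terms.
  set M := 16 + 8 * Γ ^ 2 + Γ * C + (8 * Λ) ^ 2 with hM
  have hΓC : 0 ≤ Γ * C := by positivity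
  have hM16 : 16 ≤ M := by nlinarith [sq_nonneg (8 * Λ), sq_nonneg Γ]
  have hMΓ : 8 * Γ ^ 2 ≤ M := by nlinarith [sq_nonneg (8 * Λ)]
  have hMC : Γ * C ≤ M := by nlinarith [sq_nonneg (8 * Λ), sq_nonneg Γ]
  have hMΛ : (8 * Λ) ^ 2 ≤ M := by nlinarith [sq_nonneg Γ]
  -- Smallness of δ is used only through δ² ≤ 1, which gives λ ≥ α; the value 1/2 is a convenient
  -- choice below 1.
  refine ⟨1 / 2, M, by norm_num, by norm_num, by linarith, ?_⟩
  intro T V x₀ t₁ R δ α lam c σ w hV ht₁ hT hR hδ hδ' hα hlam hc hc' hσ htest hbd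
  exact Carleman.estimate_of_constants hs hs' ha hC hθC hw hΓ hΓ1 hΛ hM16 hMΓ hMC hMΛ hV ht₁ hT hR hδ hδ' hα hlam hc
    hc' hσ htest hbd
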